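/- Let $N, N'$ be finitely generated free abelian groups with duals $M, M'$. An enriched fan with partial compactification $(\Delta,\pi\colon N\to N',R)$ consists of a finite rational polyhedral fan $\Delta$ in $N'_{\mathbb R}$ having the origin as a cone, a surjection $\pi$, and a finite set $R$ of rational rays in $N_{\mathbb R}$. Give $\Delta$ the poset topology, in which the open stars $U_\sigma$ of the cones $\sigma$ (the unions of the relative interiors $\mathring\tau$, $\tau\supseteq\sigma$) form a basis. Let $\Omega^1$ be the sheaf on $\Delta$ with $$\Omega^1(U_\sigma)=\left(\frac{\bigcap_{\tau\supseteq\sigma}\operatorname{Span}(R_{\mathring\tau})^{\perp}+\operatorname{Span}(U_\sigma)^{\perp_{M'_{\mathbb R}}}}{\operatorname{Span}(U_\sigma)^{\perp_{M'_{\mathbb R}}}}\right)_{\mathbb C},$$ where $R_{\mathring\tau}\subseteq R$ is the set of rays whose nonzero points $\pi$ maps into $\mathring\tau$, the first annihilator is taken in $M_{\mathbb R}$, and $M'_{\mathbb R}\subseteq M_{\mathbb R}$ via $\pi^*$. Let $\iota\colon\Delta_{\max}\to\Delta$ be the inclusion of the set of points at which the tangent cone of $|\Delta|$ is a linear subspace,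 and let $\Omega^p$ be the image of $\bigwedge^p\Omega^1\to\iota_*(\bigwedge^p\Omega^1|_{\Delta_{\max}})$. A tropical vector bundle with integrable connection is a pair $(E,\theta)$ of a locally constant sheaf $E$ of finite-dimensional $\mathbb C$-vector spaces on $\Delta$ and $\theta\in\Gamma(\Delta,\Omega^1\otimes\operatorname{End}(E))$ with $\theta\wedge\theta=0$; a morphism is a map $T$ of sheaves with $\theta_2T(s)=T(\theta_1s)$; the tensor product is $(E_1\otimes E_2,\theta_1\otimes1+1\otimes\theta_2)$, with unit $\mathbf 1=(\mathbb C,0)$. It is unipotent if it has a finite filtration by subobjects whose graded pieces are direct sums of $\mathbf 1$. Let $\omega_0(E)=E(U_0)$ be the fiber functor at the origin on the category $\mathscr C^{\mathrm{un}}$ of unipotent objects, and let $\pi_1^{\mathrm{un}}((\Delta,N,R),\omega_0)=\operatorname{Aut}^{\otimes}(\omega_0)$, the group scheme whose $A$-points, for a commutative $\mathbb C$-algebra $A$, are the $A$-linear tensor automorphisms of $A\otimes\omega_0$. Let $\Omega^\bullet(\Delta)$ be the algebra of global sections of the sheaves $\Omega^p$, with zero differential, let $I\Omega=\Omega^{\ge1}(\Delta)$,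 and let $B=\bigoplus_{s\ge0}(I\Omega)^{\otimes s}$ with $\deg[\eta_1|\cdots|\eta_s]=\sum_i\deg\eta_i-s$ and $$d[\eta_1|\cdots|\eta_s]=\sum_{i=1}^{s-1}(-1)^{i+1}[J\eta_1|\cdots|J\eta_{i-1}|J\eta_i\wedge\eta_{i+1}|\eta_{i+2}|\cdots|\eta_s],\qquad J\eta=(-1)^{\deg\eta}\eta.$$ Theorem. $H^0(B)=\ker(d\colon B^0\to B^1)$ is a commutative Hopf algebra under the shuffle product, the deconcatenation coproduct, the unit $[\,]$, and the counit given by the coefficient of $[\,]$. There is an isomorphism of group schemes over $\mathbb C$ $$\pi_1^{\mathrm{un}}((\Delta,N,R),\omega_0)\cong\operatorname{Spec}H^0(B),$$ that is, a family of group isomorphisms, natural in the commutative $\mathbb C$-algebra $A$, between $\operatorname{Aut}^{\otimes}(\omega_0)(A)$ and $\operatorname{Hom}_{\mathbb C\text{-alg}}(H^0(B),A)$ with the convolution product. Moreover, there is an equivalence between $\mathscr C^{\mathrm{un}}$ and the category of finite-dimensional $H^0(B)$-comodules under which $\omega_0$ corresponds to the forgetful functor. -/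

import Mathlib

open CategoryTheory
open scoped TensorProduct

universe u v

noncomputable section

namespace TropFan

/-! ## Rational fans and enriched fans with partial compactification -/

section Fans

variable (N : Type u) [AddCommGroup N]

/-- The real vector space `N_ℝ` of a lattice `N`. -/
abbrev RealSpace : Type u := ℝ ⊗[ℤ] N

variable {N}

/-- The real-valued linear function on `N_ℝ` given by `m ∈ M = Hom(N, ℤ)`. -/
def realPairing (m : Module.Dual ℤ N) : RealSpace N →ₗ[ℝ] ℝ :=
  (TensorProduct.AlgebraTensorModule.rid ℤ ℝ ℝ).toLinearMap ∘ₗ LinearMap.baseChange ℝ m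

@[simp] theorem realPairing_tmul (m : Module.Dual ℤ N) (r : ℝ) (n : N) :
    realPairing m (r ⊗ₜ n) = (m n : ℝ) * r := by
  simp [realPairing]

/-- The cone cut out by the inequalities `⟨x, m⟩ ≥ 0`, `m ∈ S`. -/
def coneOf (S : Finset (Module.Dual ℤ N)) : Set (RealSpace N) :=
  {x | ∀ m ∈ S, 0 ≤ realPairing m x}

/-- Rational cones: finite intersections of rational half-spaces through the origin. -/
def IsRationalCone (σ : Set (RealSpace N)) : Prop :=
  ∃ S : Finset (Module.Dual ℤ N), σ = coneOf S

/-- `τ` is a face of the rational cone `σ`: it is obtained by turning some of the inequalities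
that define `σ` into equalities. -/
def IsFace (τ σ : Set (RealSpace N)) : Prop :=
  ∃ S T : Finset (Module.Dual ℤ N), T ⊆ S ∧ σ = coneOf S ∧
    τ = {x | x ∈ σ ∧ ∀ m ∈ T, realPairing m x = 0}

/-- Rational rays `ℝ_{≥0} n` with `0 ≠ n ∈ N`. -/
def IsRationalRay (ρ : Set (RealSpace N)) : Prop :=
  ∃ n : N, (1 : ℝ) ⊗ₜ[ℤ] n ≠ (0 : RealSpace N) ∧
    ρ = {x | ∃ t : ℝ, 0 ≤ t ∧ x = t • ((1 : ℝ) ⊗ₜ[ℤ] n)}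

/-- The relative interior: the interior in the affine span, for the usual topology of a
finite-dimensional real vector space. -/
def relInt {V : Type u} [AddCommGroup V] [Module ℝ V] (s : Set V) : Set V :=
  letI : TopologicalSpace V := moduleTopology ℝ V
  intrinsicInterior ℝ s

end Fans

/-- A (finite) rational fan in `N_ℝ` that has the origin as a cone. -/
structure RationalFan (N : Type u) [AddCommGroup N] where
  cones : Set (Set (RealSpace N))
  finite : cones.Finite
  isRationalCone : ∀ σ ∈ cones, IsRationalCone σ
  face_mem : ∀ σ ∈ cones, ∀ τ, IsFace τ σ → τ ∈ cones
  inter_isFace : ∀ σ ∈ cones, ∀ τ ∈ cones, IsFace (σ ∩ τ) σ ∧ IsFace (σ ∩ τ) τ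
  zero_mem : {0} ∈ cones

/-- An enriched fan with partial compactification `(Δ, π : N → N', R)`: a rational fan `Δ` in
`N'_ℝ`, a surjection `π : N → N'`, and a finite set `R` of rational rays in `N_ℝ`. -/
structure EnrichedFan (N N' : Type u) [AddCommGroup N] [AddCommGroup N'] where
  fan : RationalFan N'
  π : N →ₗ[ℤ] N'
  π_surjective : Function.Surjective π
  rays : Set (Set (RealSpace N))
  rays_finite : rays.Finite
  rays_isRationalRay : ∀ ρ ∈ rays, IsRationalRay ρ

namespace EnrichedFan

variable {N N' : Type u} [AddCommGroup N] [AddCommGroup N'] (X : EnrichedFan N N')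

/-- The poset of cones of the fan, ordered by inclusion. The open sets of the poset topology
are the upward closed families of cones, and the smallest open set that contains the relative
interior of `σ` is the open star of `σ`, that is, `{τ | σ ≤ τ}`. Hence a sheaf for the poset
topology is the same as a covariant system of objects (its sections on open stars, which are
also its stalks) indexed by this poset; sheaves are given in this form below. -/
abbrev Cone : Type u := {σ : Set (RealSpace N') // σ ∈ X.fan.cones}

/-- The origin, as a cone. -/
def origin : X.Cone := ⟨{0}, X.fan.zero_mem⟩

/-- The map `N_ℝ → N'_ℝ` induced by `π`. -/
def πReal : RealSpace N →ₗ[ℝ] RealSpace N' := X.π.baseChange ℝ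

/-- The support `|Δ|`. -/
def support : Set (RealSpace N') := ⋃₀ X.fan.cones

/-- The tangent cone of the fan at a point: all `v` such that `x + ε v` is in the support for
all sufficiently small `ε > 0`. -/
def tangentCone (x : RealSpace N') : Set (RealSpace N') :=
  {v | ∀ᶠ ε in nhdsWithin (0 : ℝ) (Set.Ioi 0), x + ε • v ∈ X.support}

/-- The cones whose relative interior is contained in `Δ_max`: the tangent cone of the fan at
each point of the relative interior is a linear subspace. -/
def InMax (σ : X.Cone) : Prop :=
  ∀ x ∈ relInt σ.1, ∃ W : Submodule ℝ (RealSpace N'), X.tangentCone x = W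

/-! ## Tropical differential forms -/

/-- `M_ℂ`, as the space of complex-valued real-linear functions on `N_ℝ`. -/
abbrev FormSpace (N : Type u) [AddCommGroup N] : Type u := RealSpace N →ₗ[ℝ] ℂ

/-- The rays of `R` that `π` maps into the relative interior of `σ`. -/
def raysOver (σ : X.Cone) : Set (Set (RealSpace N)) :=
  {ρ | ρ ∈ X.rays ∧ ∀ x ∈ ρ, x ≠ 0 → X.πReal x ∈ relInt σ.1}

/-- The intersection, over all cones `τ` in the open star of `σ`, of the complexified
annihilators in `M` of `Span(R_τ°)`. -/
def rayAnnihilator (σ : X.Cone) : Submodule ℂ (FormSpace N) where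
  carrier := {m | ∀ τ : X.Cone, σ ≤ τ → ∀ x ∈ Submodule.span ℝ (⋃₀ X.raysOver τ), m x = 0}
  add_mem' {a b} ha hb := by
    intro τ h x hx
    simp [ha τ h x hx, hb τ h x hx]
  zero_mem' := by
    intro τ h x hx
    simp
  smul_mem' c a ha := by
    intro τ h x hx
    simp [ha τ h x hx]

/-- The real span of the open star of `σ`. -/
def starSpan (σ : X.Cone) : Submodule ℝ (RealSpace N') :=
  Submodule.span ℝ (⋃ τ : {τ : X.Cone // σ ≤ τ}, relInt τ.1.1)

/-- The complexified annihilator of the span of the open star of `σ` in `M'`, viewed in `M_ℂ`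
through `π`. -/
def starAnnihilator (σ : X.Cone) : Submodule ℂ (FormSpace N) where
  carrier := {m | ∃ m' : FormSpace N', (∀ x ∈ X.starSpan σ, m' x = 0) ∧ m = m' ∘ₗ X.πReal}
  add_mem' := by
    rintro _ _ ⟨a, ha, rfl⟩ ⟨b, hb, rfl⟩
    refine ⟨a + b, fun x hx => by simp [ha x hx, hb x hx], ?_⟩
    ext; simp
  zero_mem' := ⟨0, fun x _ => by simp, by ext; simp⟩
  smul_mem' := by
    rintro c _ ⟨a, ha, rfl⟩
    refine ⟨c • a, fun x hx => by simp [ha x hx], ?_⟩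
    ext; simp

theorem rayAnnihilator_mono {σ τ : X.Cone} (h : σ ≤ τ) :
    X.rayAnnihilator σ ≤ X.rayAnnihilator τ :=
  fun _ hm ρ hρ => hm ρ (h.trans hρ)

theorem starAnnihilator_mono {σ τ : X.Cone} (h : σ ≤ τ) :
    X.starAnnihilator σ ≤ X.starAnnihilator τ := by
  rintro _ ⟨m', hm', rfl⟩
  refine ⟨m', fun x hx => hm' x (Submodule.span_mono ?_ hx), rfl⟩
  exact Set.iUnion_subset fun ρ => Set.subset_iUnion_of_subset ⟨ρ.1, h.trans ρ.2⟩ subset_rfl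

/-- The tropical `1`-forms on the open star of `σ` (relative to the base `Δ_S`), as a subspace
of the quotient of `M_ℂ` by the annihilator of the star. -/
def linearForms (σ : X.Cone) : Submodule ℂ (FormSpace N ⧸ X.starAnnihilator σ) :=
  (X.rayAnnihilator σ ⊔ X.starAnnihilator σ).map (X.starAnnihilator σ).mkQ

/-- Restriction of tropical `1`-forms to a smaller open star. -/
def restrictLinear {σ τ : X.Cone} (h : σ ≤ τ) : X.linearForms σ →ₗ[ℂ] X.linearForms τ :=
  LinearMap.restrict
    ((X.starAnnihilator σ).mapQ (X.starAnnihilator τ) LinearMap.id (X.starAnnihilator_mono h))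
    (by
      rintro _ ⟨m, hm, rfl⟩
      exact ⟨m, sup_le_sup (X.rayAnnihilator_mono h) (X.starAnnihilator_mono h) hm, rfl⟩)

theorem restrictLinear_restrictLinear {σ τ ρ : X.Cone} (h : σ ≤ τ) (h' : τ ≤ ρ)
    (ω : X.linearForms σ) :
    X.restrictLinear h' (X.restrictLinear h ω) = X.restrictLinear (h.trans h') ω := by
  obtain ⟨_, m, hm, rfl⟩ := ω
  refine Subtype.ext ?_
  simp only [restrictLinear, LinearMap.restrict_apply, Submodule.mkQ_apply, Submodule.mapQ_apply,
    LinearMap.id_apply]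

/-- The algebra of families of exterior forms, one on each cone of `Δ_max` in the open star of
`σ`. It contains the sections over that star of `ι_* (⋀ Ω¹|Δ_max)`, with `ι : Δ_max → Δ` the
inclusion, as the compatible families. -/
def StarForms (σ : X.Cone) : Type u :=
  (ρ : {ρ : X.Cone // σ ≤ ρ ∧ X.InMax ρ}) → ExteriorAlgebra ℂ (X.linearForms ρ.1)

instance (σ : X.Cone) : Ring (X.StarForms σ) := inferInstanceAs
  (Ring ((ρ : {ρ : X.Cone // σ ≤ ρ ∧ X.InMax ρ}) → ExteriorAlgebra ℂ (X.linearForms ρ.1)))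

instance (σ : X.Cone) : Algebra ℂ (X.StarForms σ) := inferInstanceAs
  (Algebra ℂ ((ρ : {ρ : X.Cone // σ ≤ ρ ∧ X.InMax ρ}) → ExteriorAlgebra ℂ (X.linearForms ρ.1)))

/-- Restriction to a smaller open star. -/
def restrictForms {σ τ : X.Cone} (h : σ ≤ τ) : X.StarForms σ →ₐ[ℂ] X.StarForms τ where
  toFun ω ρ := ω ⟨ρ.1, h.trans ρ.2.1, ρ.2.2⟩
  map_one' := rfl
  map_mul' _ _ := rfl
  map_zero' := rfl
  map_add' _ _ := rfl
  commutes' _ := rfl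

/-- The restriction of a `1`-form on the open star of `σ` to `Δ_max`. -/
def toStarForms (σ : X.Cone) : X.linearForms σ →ₗ[ℂ] X.StarForms σ where
  toFun ω ρ := ExteriorAlgebra.ι ℂ (X.restrictLinear ρ.2.1 ω)
  map_add' ω η := by
    funext ρ
    exact ((ExteriorAlgebra.ι ℂ).comp (X.restrictLinear ρ.2.1)).map_add ω η
  map_smul' c ω := by
    funext ρ
    exact ((ExteriorAlgebra.ι ℂ).comp (X.restrictLinear ρ.2.1)).map_smul c ω

/-- The stalk at `σ` of the sheaf of tropical `p`-forms `Ω^p`: the image of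
`⋀^p Ω¹ → ι_* (⋀^p Ω¹|Δ_max)`. It is the `p`-th power, in the algebra `StarForms σ`, of the
image of `Ω¹`. For `p = 1` the map is injective (every cone lies in a maximal one, and maximal
cones belong to `Δ_max`), so that `forms 1 σ` is a copy of `linearForms σ`. -/
def forms (p : ℕ) (σ : X.Cone) : Submodule ℂ (X.StarForms σ) :=
  LinearMap.range (X.toStarForms σ) ^ p

/-- Products of `1`-forms anticommute. -/
theorem forms_one_anticomm {σ : X.Cone} {a b : X.StarForms σ}
    (ha : a ∈ X.forms 1 σ) (hb : b ∈ X.forms 1 σ) : a * b + b * a = 0 := by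
  rw [forms, pow_one] at ha hb
  obtain ⟨x, rfl⟩ := ha
  obtain ⟨y, rfl⟩ := hb
  funext ρ
  exact ExteriorAlgebra.ι_add_mul_swap (R := ℂ)
    (X.restrictLinear ρ.2.1 x) (X.restrictLinear ρ.2.1 y)

/-! ## Tropical vector bundles with integrable connection -/

/-- A tropical vector bundle with integrable connection `(E, θ)`. The locally constant sheaf `E`
is given by its finite-dimensional spaces of sections on open stars and the restriction maps,
which are isomorphisms; the connection is a global section `θ` of `Ω¹ ⊗ End(E)`, that is, a
compatible family of elements of the stalks, with `θ ∧ θ = 0`. -/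
structure FlatBundle where
  fiber : X.Cone → Type u
  [addCommGroup : ∀ σ, AddCommGroup (fiber σ)]
  [module : ∀ σ, Module ℂ (fiber σ)]
  [finiteDimensional : ∀ σ, FiniteDimensional ℂ (fiber σ)]
  res : ∀ {σ τ : X.Cone}, σ ≤ τ → fiber σ ≃ₗ[ℂ] fiber τ
  res_refl : ∀ (σ : X.Cone) (v : fiber σ), res (le_refl σ) v = v
  res_trans : ∀ {σ τ ρ : X.Cone} (h : σ ≤ τ) (h' : τ ≤ ρ) (v : fiber σ),
    res h' (res h v) = res (h.trans h') v
  θ : ∀ σ, X.StarForms σ ⊗[ℂ] Module.End ℂ (fiber σ)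
  θ_mem : ∀ σ, θ σ ∈
    LinearMap.range (LinearMap.rTensor (Module.End ℂ (fiber σ)) (X.forms 1 σ).subtype)
  θ_res : ∀ {σ τ : X.Cone} (h : σ ≤ τ),
    TensorProduct.map (X.restrictForms h).toLinearMap (res h).conj.toLinearMap (θ σ) = θ τ
  integrable : ∀ σ, θ σ * θ σ = 0

namespace FlatBundle

attribute [instance] FlatBundle.addCommGroup FlatBundle.module FlatBundle.finiteDimensional

variable {X}

/-- The product `θ s` of the connection form with a local section. -/
def act (E : X.FlatBundle) (σ : X.Cone) (s : E.fiber σ) : X.StarForms σ ⊗[ℂ] E.fiber σ :=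
  LinearMap.lTensor (X.StarForms σ) (LinearMap.applyₗ s) (E.θ σ)

/-- Morphisms of bundles with connection: morphisms `T` of sheaves with `θ T(s) = T(θ s)`. -/
@[ext]
structure Hom (E F : X.FlatBundle) where
  app : ∀ σ, E.fiber σ →ₗ[ℂ] F.fiber σ
  app_res : ∀ {σ τ : X.Cone} (h : σ ≤ τ) (s : E.fiber σ), app τ (E.res h s) = F.res h (app σ s)
  horizontal : ∀ (σ : X.Cone) (s : E.fiber σ),
    F.act σ (app σ s) = LinearMap.lTensor (X.StarForms σ) (app σ) (E.act σ s)

instance : Category X.FlatBundle where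
  Hom := Hom
  id E :=
    { app := fun σ => LinearMap.id
      app_res := fun h s => rfl
      horizontal := fun σ s => by simp }
  comp {E F G} S T :=
    { app := fun σ => T.app σ ∘ₗ S.app σ
      app_res := fun h s => by simp [S.app_res, T.app_res]
      horizontal := fun σ s => by
        rw [LinearMap.comp_apply, T.horizontal, S.horizontal, LinearMap.lTensor_comp,
          LinearMap.comp_apply] }

/-- The trivial bundle with fiber `V` and `θ = 0`; it is a direct sum of `dim V` copies of the
unit object. -/
@[reducible] def trivial (X : EnrichedFan N N') (V : Type u) [AddCommGroup V] [Module ℂ V]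
    [FiniteDimensional ℂ V] : X.FlatBundle where
  fiber _ := V
  res _ := LinearEquiv.refl ℂ V
  res_refl _ _ := rfl
  res_trans _ _ _ := rfl
  θ _ := 0
  θ_mem _ := zero_mem _
  θ_res _ := map_zero _
  integrable _ := mul_zero _

/-- The unit object `𝟏`. -/
@[reducible] def unit (X : EnrichedFan N N') : X.FlatBundle := trivial X (ULift.{u} ℂ)

/-- Unipotent objects: those with a finite filtration by subobjects whose graded pieces are
direct sums of the unit object. The filtration is built one step at a time: zero objects are
unipotent, and `E` is unipotent if there is an exact sequence `0 → E' → E → 𝟏^k → 0` with `E'`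
unipotent. -/
inductive IsUnipotent : X.FlatBundle → Prop
  | zero (E : X.FlatBundle) (hE : ∀ σ, Subsingleton (E.fiber σ)) : IsUnipotent E
  | step (E' E : X.FlatBundle) (V : Type u) [AddCommGroup V] [Module ℂ V]
      [FiniteDimensional ℂ V] (f : E' ⟶ E) (g : E ⟶ trivial X V)
      (hf : ∀ σ, Function.Injective (f.app σ))
      (hfg : ∀ σ, Function.Exact (f.app σ) (g.app σ))
      (hg : ∀ σ, Function.Surjective (g.app σ))
      (hE' : IsUnipotent E') : IsUnipotent E

/-- `θ ⊗ 1 + 1 ⊗ θ'`. -/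
def tensorForm (E F : X.FlatBundle) (σ : X.Cone) :
    X.StarForms σ ⊗[ℂ] Module.End ℂ (E.fiber σ ⊗[ℂ] F.fiber σ) :=
  LinearMap.lTensor (X.StarForms σ) (LinearMap.rTensorHom (F.fiber σ)) (E.θ σ) +
    LinearMap.lTensor (X.StarForms σ) (LinearMap.lTensorHom (E.fiber σ)) (F.θ σ)

theorem tensorForm_mem (E F : X.FlatBundle) (σ : X.Cone) :
    E.tensorForm F σ ∈ LinearMap.range (LinearMap.rTensor
      (Module.End ℂ (E.fiber σ ⊗[ℂ] F.fiber σ)) (X.forms 1 σ).subtype) := by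
  obtain ⟨a, ha⟩ := E.θ_mem σ
  obtain ⟨b, hb⟩ := F.θ_mem σ
  refine ⟨LinearMap.lTensor _ (LinearMap.rTensorHom (F.fiber σ)) a +
    LinearMap.lTensor _ (LinearMap.lTensorHom (E.fiber σ)) b, ?_⟩
  rw [map_add, tensorForm, ← ha, ← hb]
  simp only [← LinearMap.comp_apply, LinearMap.rTensor_comp_lTensor,
    LinearMap.lTensor_comp_rTensor]

theorem tensorForm_res (E F : X.FlatBundle) {σ τ : X.Cone} (h : σ ≤ τ) :
    TensorProduct.map (X.restrictForms h).toLinearMap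
      (TensorProduct.congr (E.res h) (F.res h)).conj.toLinearMap (E.tensorForm F σ) =
      E.tensorForm F τ := by
  have h₁ : (TensorProduct.congr (E.res h) (F.res h)).conj.toLinearMap ∘ₗ
      LinearMap.rTensorHom (F.fiber σ) =
      LinearMap.rTensorHom (F.fiber τ) ∘ₗ (E.res h).conj.toLinearMap := by
    refine LinearMap.ext fun A => TensorProduct.ext' fun x y => ?_
    simp [LinearEquiv.conj_apply]
  have h₂ : (TensorProduct.congr (E.res h) (F.res h)).conj.toLinearMap ∘ₗ
      LinearMap.lTensorHom (E.fiber σ) =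
      LinearMap.lTensorHom (E.fiber τ) ∘ₗ (F.res h).conj.toLinearMap := by
    refine LinearMap.ext fun A => TensorProduct.ext' fun x y => ?_
    simp [LinearEquiv.conj_apply]
  rw [tensorForm, tensorForm, map_add, ← E.θ_res h, ← F.θ_res h]
  simp only [← LinearMap.comp_apply, LinearMap.map_comp_lTensor, LinearMap.lTensor_comp_map]
  rw [h₁, h₂]

theorem tensorForm_integrable (E F : X.FlatBundle) (σ : X.Cone) :
    E.tensorForm F σ * E.tensorForm F σ = 0 := by
  let r : X.StarForms σ ⊗[ℂ] Module.End ℂ (E.fiber σ) →ₐ[ℂ]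
      X.StarForms σ ⊗[ℂ] Module.End ℂ (E.fiber σ ⊗[ℂ] F.fiber σ) :=
    Algebra.TensorProduct.map (AlgHom.id ℂ _) (Module.End.rTensorAlgHom ℂ _ _)
  let l : X.StarForms σ ⊗[ℂ] Module.End ℂ (F.fiber σ) →ₐ[ℂ]
      X.StarForms σ ⊗[ℂ] Module.End ℂ (E.fiber σ ⊗[ℂ] F.fiber σ) :=
    Algebra.TensorProduct.map (AlgHom.id ℂ _) (Module.End.lTensorAlgHom ℂ _ _)
  have key : ∀ (a : X.forms 1 σ ⊗[ℂ] Module.End ℂ (E.fiber σ))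
      (b : X.forms 1 σ ⊗[ℂ] Module.End ℂ (F.fiber σ)),
      r (LinearMap.rTensor _ (X.forms 1 σ).subtype a) *
        l (LinearMap.rTensor _ (X.forms 1 σ).subtype b) +
      l (LinearMap.rTensor _ (X.forms 1 σ).subtype b) *
        r (LinearMap.rTensor _ (X.forms 1 σ).subtype a) = 0 := by
    intro a b
    induction a using TensorProduct.induction_on with
    | zero => simp
    | add a a' ha ha' =>
      simp only [map_add, add_mul, mul_add]
      rw [add_add_add_comm, ha, ha', add_zero]
    | tmul ω A =>
      induction b using TensorProduct.induction_on with
      | zero => simp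
      | add b b' hb hb' =>
        simp only [map_add, add_mul, mul_add]
        rw [add_add_add_comm, hb, hb', add_zero]
      | tmul η B =>
        have hc : LinearMap.rTensor (F.fiber σ) A * LinearMap.lTensor (E.fiber σ) B =
            LinearMap.lTensor (E.fiber σ) B * LinearMap.rTensor (F.fiber σ) A := by
          ext x y
          simp
        change ((ω : X.StarForms σ) ⊗ₜ[ℂ] LinearMap.rTensor (F.fiber σ) A) *
            ((η : X.StarForms σ) ⊗ₜ[ℂ] LinearMap.lTensor (E.fiber σ) B) +
          ((η : X.StarForms σ) ⊗ₜ[ℂ] LinearMap.lTensor (E.fiber σ) B) *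
            ((ω : X.StarForms σ) ⊗ₜ[ℂ] LinearMap.rTensor (F.fiber σ) A) = 0
        rw [Algebra.TensorProduct.tmul_mul_tmul, Algebra.TensorProduct.tmul_mul_tmul, hc,
          ← TensorProduct.add_tmul, X.forms_one_anticomm ω.2 η.2, TensorProduct.zero_tmul]
  obtain ⟨a, ha⟩ := E.θ_mem σ
  obtain ⟨b, hb⟩ := F.θ_mem σ
  have hr : LinearMap.lTensor (X.StarForms σ) (LinearMap.rTensorHom (F.fiber σ)) (E.θ σ) =
      r (E.θ σ) := rfl
  have hl : LinearMap.lTensor (X.StarForms σ) (LinearMap.lTensorHom (E.fiber σ)) (F.θ σ) =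
      l (F.θ σ) := rfl
  rw [tensorForm, hr, hl, add_mul, mul_add, mul_add, ← map_mul, ← map_mul, E.integrable,
    F.integrable, map_zero, map_zero, zero_add, add_zero, ← ha, ← hb]
  exact key a b

/-- The tensor product `(E ⊗ F, θ ⊗ 1 + 1 ⊗ θ')`. -/
@[reducible] def tensor (E F : X.FlatBundle) : X.FlatBundle where
  fiber σ := E.fiber σ ⊗[ℂ] F.fiber σ
  res h := TensorProduct.congr (E.res h) (F.res h)
  res_refl σ v := by
    have : (TensorProduct.congr (E.res (le_refl σ)) (F.res (le_refl σ))).toLinearMap =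
        LinearMap.id := by
      ext x y
      simp [res_refl]
    exact LinearMap.congr_fun this v
  res_trans {σ τ ρ} h h' v := by
    have : (TensorProduct.congr (E.res h') (F.res h')).toLinearMap ∘ₗ
        (TensorProduct.congr (E.res h) (F.res h)).toLinearMap =
        (TensorProduct.congr (E.res (h.trans h')) (F.res (h.trans h'))).toLinearMap := by
      ext x y
      simp [res_trans]
    exact LinearMap.congr_fun this v
  θ := E.tensorForm F
  θ_mem := E.tensorForm_mem F
  θ_res := E.tensorForm_res F
  integrable := E.tensorForm_integrable F

theorem isUnipotent_unit (X : EnrichedFan N N') : IsUnipotent (unit X) :=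
  IsUnipotent.step (trivial X PUnit) (unit X) (ULift.{u} ℂ)
    { app := fun _ => 0, app_res := fun _ _ => rfl, horizontal := fun _ _ => by simp [act] }
    (𝟙 _)
    (fun _ _ _ _ => rfl)
    (fun _ x => ⟨fun h => ⟨PUnit.unit, h.symm⟩, fun ⟨_, h⟩ => h.symm⟩)
    (fun _ x => ⟨x, rfl⟩)
    (IsUnipotent.zero _ fun _ => inferInstanceAs (Subsingleton PUnit))

end FlatBundle

/-- The category of unipotent tropical vector bundles with integrable connection. -/
abbrev UnipotentBundle : Type (u + 1) :=
  ObjectProperty.FullSubcategory (fun E : X.FlatBundle => E.IsUnipotent)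

/-- The fiber functor `ω₀` at the origin, `E ↦ E(Star°(0))`. -/
def fiberFunctor : X.UnipotentBundle ⥤ ModuleCat.{u} ℂ where
  obj E := ModuleCat.of ℂ (E.obj.fiber X.origin)
  map T := ModuleCat.ofHom (T.hom.app X.origin)

/-! ## The unipotent tropical fundamental group -/

/-- The group of `A`-points of the unipotent tropical fundamental group `π₁^un(Δ, ω₀)`, the
group scheme `Aut^⊗(ω₀)`: the families of `A`-linear automorphisms of the modules
`A ⊗ ω₀(E)`, for `E` unipotent, that are natural in `E`, compatible with tensor products, and
trivial on the unit object. (Tensor products of unipotent objects are unipotent; `h` only names a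
proof of this, so that the condition can be written down.) -/
def fundamentalGroup (A : Type v) [CommRing A] [Algebra ℂ A] :
    Subgroup ((E : X.UnipotentBundle) →
      ((A ⊗[ℂ] E.obj.fiber X.origin) ≃ₗ[A] (A ⊗[ℂ] E.obj.fiber X.origin))) where
  carrier := {g |
    (∀ (E F : X.UnipotentBundle) (T : E.obj ⟶ F.obj) (x : A ⊗[ℂ] E.obj.fiber X.origin),
      g F ((T.app X.origin).baseChange A x) = (T.app X.origin).baseChange A (g E x)) ∧
    (∀ (E F : X.UnipotentBundle) (h : (E.obj.tensor F.obj).IsUnipotent)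
      (x : A ⊗[ℂ] (E.obj.fiber X.origin ⊗[ℂ] F.obj.fiber X.origin)),
      TensorProduct.AlgebraTensorModule.distribBaseChange ℂ A
          (E.obj.fiber X.origin) (F.obj.fiber X.origin) (g ⟨E.obj.tensor F.obj, h⟩ x) =
        TensorProduct.map (g E).toLinearMap (g F).toLinearMap
          (TensorProduct.AlgebraTensorModule.distribBaseChange ℂ A
            (E.obj.fiber X.origin) (F.obj.fiber X.origin) x)) ∧
    g ⟨FlatBundle.unit X, FlatBundle.isUnipotent_unit X⟩ = 1}
  mul_mem' := by
    rintro g g' ⟨h₁, h₂, h₃⟩ ⟨h₁', h₂', h₃'⟩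
    refine ⟨fun E F T x => ?_, fun E F h x => ?_, ?_⟩
    · simp only [Pi.mul_apply, LinearEquiv.mul_apply]
      rw [h₁', h₁]
    · simp only [Pi.mul_apply, LinearEquiv.mul_apply]
      rw [h₂, h₂', ← LinearMap.comp_apply, ← TensorProduct.map_comp]
      rfl
    · rw [Pi.mul_apply, h₃, h₃', mul_one]
  one_mem' := by
    refine ⟨fun E F T x => rfl, fun E F h x => ?_, rfl⟩
    change _ = TensorProduct.map LinearMap.id LinearMap.id _
    rw [TensorProduct.map_id]
    rfl
  inv_mem' := by
    rintro g ⟨h₁, h₂, h₃⟩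
    refine ⟨fun E F T x => ?_, fun E F h x => ?_, ?_⟩
    · change (g F).symm _ = _
      rw [LinearEquiv.symm_apply_eq, h₁]
      congr 1
      exact ((g E).apply_symm_apply x).symm
    · have key := h₂ E F h ((g ⟨E.obj.tensor F.obj, h⟩).symm x)
      rw [LinearEquiv.apply_symm_apply] at key
      rw [key, ← LinearMap.comp_apply, ← TensorProduct.map_comp]
      have e₁ : ((g⁻¹) E).toLinearMap ∘ₗ (g E).toLinearMap = LinearMap.id :=
        LinearMap.ext fun y => (g E).symm_apply_apply y
      have e₂ : ((g⁻¹) F).toLinearMap ∘ₗ (g F).toLinearMap = LinearMap.id :=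
        LinearMap.ext fun y => (g F).symm_apply_apply y
      rw [e₁, e₂, TensorProduct.map_id]
      rfl
    · rw [Pi.inv_apply, h₃, inv_one]

/-- The `A'`-point `g'` of the fundamental group is the image of the `A`-point `g` under
`f : A → A'`: on each fiber, `g'` is the extension of scalars of `g` along `f`. -/
def IsBaseChange {A A' : Type v} [CommRing A] [Algebra ℂ A] [CommRing A'] [Algebra ℂ A']
    (f : A →ₐ[ℂ] A') (g : X.fundamentalGroup A) (g' : X.fundamentalGroup A') : Prop :=
  ∀ (E : X.UnipotentBundle) (x : A ⊗[ℂ] E.obj.fiber X.origin),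
    LinearMap.rTensor (E.obj.fiber X.origin) f.toLinearMap (g.1 E x) =
      g'.1 E (LinearMap.rTensor (E.obj.fiber X.origin) f.toLinearMap x)

end EnrichedFan

/-! ## The bar construction -/

section Bar

variable {M : Type u} [AddCommGroup M] [Module ℂ M]

/-- Recursion on the first letter: the linear map `F` on the tensor algebra with `F 1 = y₀` and
`F (a w) = p a w + q a (F w)` for letters `a` and words `w`. -/
def wordRec {Y : Type u} [AddCommGroup Y] [Module ℂ Y] (y₀ : Y)
    (p : M →ₗ[ℂ] TensorAlgebra ℂ M →ₗ[ℂ] Y) (q : M →ₗ[ℂ] Y →ₗ[ℂ] Y) :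
    TensorAlgebra ℂ M →ₗ[ℂ] Y :=
  LinearMap.snd ℂ (TensorAlgebra ℂ M) Y ∘ₗ LinearMap.applyₗ (1, y₀) ∘ₗ
    (TensorAlgebra.lift ℂ
      ({ toFun := fun a =>
          (LinearMap.mulLeft ℂ (TensorAlgebra.ι ℂ a) ∘ₗ LinearMap.fst ℂ _ _).prod
            ((p a).coprod (q a))
         map_add' := fun a b => by
          ext <;> simp [add_mul]
         map_smul' := fun c a => by
          ext <;> simp } :
        M →ₗ[ℂ] Module.End ℂ (TensorAlgebra ℂ M × Y))).toLinearMap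

section wordRec

variable {Y : Type u} [AddCommGroup Y] [Module ℂ Y] (y₀ : Y)
  (p : M →ₗ[ℂ] TensorAlgebra ℂ M →ₗ[ℂ] Y) (q : M →ₗ[ℂ] Y →ₗ[ℂ] Y)

@[simp] theorem wordRec_one : wordRec y₀ p q 1 = y₀ := by
  simp [wordRec]

@[simp] theorem wordRec_ι_mul (a : M) (w : TensorAlgebra ℂ M) :
    wordRec y₀ p q (TensorAlgebra.ι ℂ a * w) = p a w + q a (wordRec y₀ p q w) := by
  have key : ∀ (w : TensorAlgebra ℂ M) (x : TensorAlgebra ℂ M × Y),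
      (TensorAlgebra.lift ℂ
      ({ toFun := fun a =>
          (LinearMap.mulLeft ℂ (TensorAlgebra.ι ℂ a) ∘ₗ LinearMap.fst ℂ _ _).prod
            ((p a).coprod (q a))
         map_add' := fun a b => by
          ext <;> simp [add_mul]
         map_smul' := fun c a => by
          ext <;> simp } :
        M →ₗ[ℂ] Module.End ℂ (TensorAlgebra ℂ M × Y)) w x).1 = w * x.1 := by
    intro w
    induction w using TensorAlgebra.induction with
    | algebraMap r => intro x; simp [Algebra.smul_def]
    | ι a => intro x; simp
    | mul a b ha hb => intro x; simp [ha, hb, mul_assoc]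
    | add a b ha hb => intro x; simp [ha, hb, add_mul]
  simp [wordRec, key]

end wordRec

/-- Splitting off the first letter: `a w ↦ a ⊗ w`, and `1 ↦ 0`. -/
def split : TensorAlgebra ℂ M →ₗ[ℂ] M ⊗[ℂ] TensorAlgebra ℂ M :=
  wordRec 0 (TensorProduct.mk ℂ M (TensorAlgebra ℂ M)) 0

/-- The coproduct `[η₁|⋯|ηₛ] ↦ ∑ᵢ [η₁|⋯|ηᵢ] ⊗ [ηᵢ₊₁|⋯|ηₛ]`. -/
def deconcat : TensorAlgebra ℂ M →ₗ[ℂ] TensorAlgebra ℂ M ⊗[ℂ] TensorAlgebra ℂ M :=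
  wordRec (1 ⊗ₜ 1)
    ((LinearMap.mul ℂ (TensorAlgebra ℂ M) ∘ₗ TensorAlgebra.ι ℂ).compr₂
      (TensorProduct.mk ℂ (TensorAlgebra ℂ M) (TensorAlgebra ℂ M) 1))
    (LinearMap.rTensorHom (TensorAlgebra ℂ M) ∘ₗ LinearMap.mul ℂ (TensorAlgebra ℂ M) ∘ₗ
      TensorAlgebra.ι ℂ)

@[simp] theorem deconcat_one : deconcat (1 : TensorAlgebra ℂ M) = 1 ⊗ₜ 1 := by
  simp [deconcat]

@[simp] theorem deconcat_ι_mul (a : M) (w : TensorAlgebra ℂ M) :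
    deconcat (TensorAlgebra.ι ℂ a * w) = 1 ⊗ₜ (TensorAlgebra.ι ℂ a * w) +
      LinearMap.rTensor _ (LinearMap.mulLeft ℂ (TensorAlgebra.ι ℂ a)) (deconcat w) := by
  rw [deconcat, wordRec_ι_mul]
  rfl

/-- Insertion of the letter `a` in front of the second factor, followed by the operator `S` on
that factor: `v₁ ⊗ v₂ ↦ v₁ a S(v₂)`. -/
def insertLetter : M →ₗ[ℂ] Module.End ℂ (TensorAlgebra ℂ M) →ₗ[ℂ]
    (TensorAlgebra ℂ M ⊗[ℂ] TensorAlgebra ℂ M →ₗ[ℂ] TensorAlgebra ℂ M) :=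
  LinearMap.mk₂ ℂ
    (fun a S => LinearMap.mul' ℂ (TensorAlgebra ℂ M) ∘ₗ
      LinearMap.lTensor _ (LinearMap.mulLeft ℂ (TensorAlgebra.ι ℂ a) ∘ₗ S))
    (fun a b S => TensorProduct.ext' fun x y => by simp [add_mul, mul_add])
    (fun c a S => TensorProduct.ext' fun x y => by simp)
    (fun a S T => TensorProduct.ext' fun x y => by simp [mul_add])
    (fun c a S => TensorProduct.ext' fun x y => by simp)

/-- The shuffle product of words (without signs: this is the product of the bar construction on
words of total degree `0`, whose letters all have weight `deg - 1 = 0`). The first letter `a`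
of a word `a u` is placed at any position of the word `v`, and `u` is shuffled with the rest
of `v`. -/
def shuffle : TensorAlgebra ℂ M →ₗ[ℂ] TensorAlgebra ℂ M →ₗ[ℂ] TensorAlgebra ℂ M :=
  wordRec (Y := Module.End ℂ (TensorAlgebra ℂ M)) LinearMap.id 0
    (insertLetter.compr₂ (LinearMap.lcomp ℂ (TensorAlgebra ℂ M) deconcat))

@[simp] theorem shuffle_one_left (v : TensorAlgebra ℂ M) : shuffle 1 v = v := by
  simp [shuffle]

theorem shuffle_ι_mul (a : M) (u v : TensorAlgebra ℂ M) :
    shuffle (TensorAlgebra.ι ℂ a * u) v = insertLetter a (shuffle u) (deconcat v) := by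
  rw [shuffle, wordRec_ι_mul]
  simp

theorem shuffle_ι_mul_one (a : M) (u : TensorAlgebra ℂ M) :
    shuffle (TensorAlgebra.ι ℂ a * u) 1 = TensorAlgebra.ι ℂ a * shuffle u 1 := by
  simp [shuffle_ι_mul, insertLetter]

/-- The defining recursion of the shuffle product. -/
theorem shuffle_ι_mul_ι_mul (a b : M) (u v : TensorAlgebra ℂ M) :
    shuffle (TensorAlgebra.ι ℂ a * u) (TensorAlgebra.ι ℂ b * v) =
      TensorAlgebra.ι ℂ a * shuffle u (TensorAlgebra.ι ℂ b * v) +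
      TensorAlgebra.ι ℂ b * shuffle (TensorAlgebra.ι ℂ a * u) v := by
  have key : ∀ z : TensorAlgebra ℂ M ⊗[ℂ] TensorAlgebra ℂ M,
      insertLetter a (shuffle u)
        (LinearMap.rTensor _ (LinearMap.mulLeft ℂ (TensorAlgebra.ι ℂ b)) z) =
      TensorAlgebra.ι ℂ b * insertLetter a (shuffle u) z := by
    intro z
    induction z using TensorProduct.induction_on with
    | zero => simp
    | tmul x y => simp [insertLetter, mul_assoc]
    | add x y hx hy => simp only [map_add, hx, hy, mul_add]
  rw [shuffle_ι_mul, shuffle_ι_mul, deconcat_ι_mul, map_add, key]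
  simp [insertLetter]

/-- Multiplication of the letter `c` into the first letter of a word:
`b ⊗ w ↦ [c ∧ b | w]`, for a product `μ` on letters. -/
def merge (μ : M →ₗ[ℂ] M →ₗ[ℂ] M) :
    M →ₗ[ℂ] M ⊗[ℂ] TensorAlgebra ℂ M →ₗ[ℂ] TensorAlgebra ℂ M :=
  ((LinearMap.rTensorHom (TensorAlgebra ℂ M)) ∘ₗ μ.compr₂ (TensorAlgebra.ι ℂ)).compr₂
    (LinearMap.mul' ℂ (TensorAlgebra ℂ M))

/-- The combinatorial differential of the bar construction for a product `μ` on letters and a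
sign operator `J`,
`[η₁|⋯|ηₛ] ↦ ∑ᵢ (-1)^(i+1) [J η₁|⋯|J ηᵢ₋₁|J ηᵢ ∧ ηᵢ₊₁|ηᵢ₊₂|⋯|ηₛ]`.
It is determined by `d 1 = 0`, `d [a] = 0`,
`d [a|b|w] = [J a ∧ b|w] - [J a|d [b|w]]`. -/
def barDifferential (J : M →ₗ[ℂ] M) (μ : M →ₗ[ℂ] M →ₗ[ℂ] M) :
    TensorAlgebra ℂ M →ₗ[ℂ] TensorAlgebra ℂ M :=
  wordRec 0 ((merge μ ∘ₗ J).compl₂ split)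
    (-(LinearMap.mul ℂ (TensorAlgebra ℂ M) ∘ₗ TensorAlgebra.ι ℂ ∘ₗ J))

theorem barDifferential_one (J : M →ₗ[ℂ] M) (μ : M →ₗ[ℂ] M →ₗ[ℂ] M) :
    barDifferential J μ 1 = 0 := by
  simp [barDifferential]

theorem barDifferential_ι (J : M →ₗ[ℂ] M) (μ : M →ₗ[ℂ] M →ₗ[ℂ] M) (a : M) :
    barDifferential J μ (TensorAlgebra.ι ℂ a) = 0 := by
  rw [← mul_one (TensorAlgebra.ι ℂ a), barDifferential, wordRec_ι_mul]
  simp [split]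

theorem barDifferential_ι_mul_ι_mul (J : M →ₗ[ℂ] M) (μ : M →ₗ[ℂ] M →ₗ[ℂ] M) (a b : M)
    (w : TensorAlgebra ℂ M) :
    barDifferential J μ (TensorAlgebra.ι ℂ a * (TensorAlgebra.ι ℂ b * w)) =
      TensorAlgebra.ι ℂ (μ (J a) b) * w -
      TensorAlgebra.ι ℂ (J a) * barDifferential J μ (TensorAlgebra.ι ℂ b * w) := by
  rw [barDifferential, wordRec_ι_mul, ← barDifferential]
  simp [split, merge, sub_eq_add_neg]

end Bar

namespace EnrichedFan

variable {N N' : Type u} [AddCommGroup N] [AddCommGroup N'] (X : EnrichedFan N N')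

/-- The augmentation ideal `IΩ = Ω^{≥1}(Δ)` of the tropical de Rham algebra `Ω^•(Δ)`. Global
sections are sections over the open star of the origin, which is the whole fan. -/
def augIdeal : Submodule ℂ (X.StarForms X.origin) := ⨆ p : ℕ, X.forms (p + 1) X.origin

theorem mul_mem_augIdeal {a b : X.StarForms X.origin} (ha : a ∈ X.augIdeal)
    (hb : b ∈ X.augIdeal) : a * b ∈ X.augIdeal := by
  have h : X.augIdeal * X.augIdeal ≤ X.augIdeal := by
    rw [augIdeal, Submodule.iSup_mul]
    refine iSup_le fun p => ?_
    rw [Submodule.mul_iSup]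
    refine iSup_le fun q => ?_
    refine le_trans (le_of_eq ?_)
      (le_iSup (fun p : ℕ => X.forms (p + 1) X.origin) (p + 1 + q))
    simp only [forms, ← pow_add]
    rfl
  exact h (Submodule.mul_mem_mul ha hb)

/-- The wedge product on `IΩ`. -/
def augMul : X.augIdeal →ₗ[ℂ] X.augIdeal →ₗ[ℂ] X.augIdeal :=
  LinearMap.mk₂ ℂ (fun a b => ⟨a.1 * b.1, X.mul_mem_augIdeal a.2 b.2⟩)
    (fun a b c => Subtype.ext (add_mul a.1 b.1 c.1))
    (fun r a b => Subtype.ext (smul_mul_assoc r a.1 b.1))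
    (fun a b c => Subtype.ext (mul_add a.1 b.1 c.1))
    (fun r a b => Subtype.ext (mul_smul_comm r a.1 b.1))

/-- The sign operator `J ω = (-1)^{deg ω} ω` on forms. -/
def signForms (σ : X.Cone) : X.StarForms σ →ₐ[ℂ] X.StarForms σ where
  toFun ω ρ := CliffordAlgebra.involute (ω ρ)
  map_one' := funext fun _ => map_one _
  map_mul' _ _ := funext fun _ => map_mul _ _ _
  map_zero' := funext fun _ => map_zero _
  map_add' _ _ := funext fun _ => map_add _ _ _
  commutes' c := funext fun _ => AlgHom.commutes _ c

theorem signForms_of_mem {p : ℕ} {σ : X.Cone} {a : X.StarForms σ} (ha : a ∈ X.forms p σ) :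
    X.signForms σ a = (-1 : ℂ) ^ p • a := by
  rw [forms] at ha
  refine Submodule.pow_induction_on_left' _
    (C := fun p a _ => X.signForms σ a = (-1 : ℂ) ^ p • a) ?_ ?_ ?_ ha
  · intro r
    simp
  · intro x y i _ _ hx hy
    rw [map_add, hx, hy, smul_add]
  · rintro _ ⟨m, rfl⟩ i x _ hx
    have h : X.signForms σ (X.toStarForms σ m) = -X.toStarForms σ m :=
      funext fun ρ => CliffordAlgebra.involute_ι _
    rw [map_mul, hx, h, pow_succ]
    simp

theorem signForms_mem_augIdeal {a : X.StarForms X.origin} (ha : a ∈ X.augIdeal) :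
    X.signForms X.origin a ∈ X.augIdeal := by
  rw [augIdeal] at ha
  refine Submodule.iSup_induction (fun p : ℕ => X.forms (p + 1) X.origin)
    (motive := fun a => X.signForms X.origin a ∈ X.augIdeal) ha ?_ ?_ ?_
  · intro p a ha
    rw [X.signForms_of_mem ha]
    exact Submodule.smul_mem _ _
      (Submodule.mem_iSup_of_mem (p := fun p : ℕ => X.forms (p + 1) X.origin) p ha)
  · simp
  · intro a b ha hb
    rw [map_add]
    exact Submodule.add_mem _ ha hb

/-- The sign operator `J` on `IΩ`. -/
def augSign : X.augIdeal →ₗ[ℂ] X.augIdeal :=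
  (X.signForms X.origin).toLinearMap.restrict fun _ h => X.signForms_mem_augIdeal h

/-- The underlying space of the bar construction, `B = ⨁ₛ (IΩ)^{⊗ s}`. -/
abbrev Bar : Type u := TensorAlgebra ℂ X.augIdeal

/-- The differential of `B`. -/
def d : X.Bar →ₗ[ℂ] X.Bar := barDifferential X.augSign X.augMul

/-- The degree `0` part of `B`: the span of the words `[η₁|⋯|ηₛ]` all of whose letters are
`1`-forms. -/
def barZero : Submodule ℂ X.Bar :=
  Subalgebra.toSubmodule
    (Algebra.adjoin ℂ {w | ∃ η : X.augIdeal, η.1 ∈ X.forms 1 X.origin ∧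
      w = TensorAlgebra.ι ℂ η})

/-- `H⁰(B) = ker (d : B⁰ → B¹)`; there are no coboundaries, because `B` is zero in negative
degrees. -/
def H0 : Submodule ℂ X.Bar := X.barZero ⊓ LinearMap.ker X.d

/-- `e` identifies the commutative Hopf algebra `H` with `H⁰(B)`, with the shuffle product, the
unit `[]`, the deconcatenation coproduct, and the counit that takes the coefficient of `[]`.
(The antipode of a Hopf algebra is determined by the rest.) -/
structure IsHopfModel (H : Type u) [CommRing H] [HopfAlgebra ℂ H] (e : H ≃ₗ[ℂ] X.H0) :
    Prop where
  one : (e 1 : X.Bar) = 1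
  mul : ∀ x y : H, (e (x * y) : X.Bar) = shuffle (e x : X.Bar) (e y : X.Bar)
  comul : ∀ x : H, TensorProduct.map (X.H0.subtype ∘ₗ e.toLinearMap)
    (X.H0.subtype ∘ₗ e.toLinearMap) (Coalgebra.comul (R := ℂ) x) = deconcat (e x : X.Bar)
  counit : ∀ x : H, Coalgebra.counit (R := ℂ) x = TensorAlgebra.algebraMapInv (e x : X.Bar)

end EnrichedFan

/-! ## Comodules -/

/-- Finite-dimensional right comodules over a coalgebra `H`. -/
structure FDComodule (H : Type u) [AddCommGroup H] [Module ℂ H] [Coalgebra ℂ H] where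
  carrier : Type u
  [addCommGroup : AddCommGroup carrier]
  [module : Module ℂ carrier]
  [finiteDimensional : FiniteDimensional ℂ carrier]
  coact : carrier →ₗ[ℂ] carrier ⊗[ℂ] H
  coassoc : ∀ v : carrier, TensorProduct.assoc ℂ carrier H H (LinearMap.rTensor H coact (coact v)) =
    LinearMap.lTensor carrier Coalgebra.comul (coact v)
  counit : ∀ v : carrier, TensorProduct.rid ℂ carrier
    (LinearMap.lTensor carrier (Coalgebra.counit (R := ℂ) (A := H)) (coact v)) = v

namespace FDComodule

attribute [instance] FDComodule.addCommGroup FDComodule.module FDComodule.finiteDimensional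

variable {H : Type u} [AddCommGroup H] [Module ℂ H] [Coalgebra ℂ H]

/-- Morphisms of comodules. -/
@[ext]
structure Hom (V W : FDComodule H) where
  map : V.carrier →ₗ[ℂ] W.carrier
  coact : ∀ v, W.coact (map v) = LinearMap.rTensor H map (V.coact v)

instance : Category (FDComodule H) where
  Hom := Hom
  id V := { map := LinearMap.id, coact := fun v => by simp }
  comp S T :=
    { map := T.map ∘ₗ S.map
      coact := fun v => by
        rw [LinearMap.comp_apply, T.coact, S.coact, LinearMap.rTensor_comp,
          LinearMap.comp_apply] }

variable (H) in
/-- The forgetful functor to vector spaces. -/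
def forget : FDComodule H ⥤ ModuleCat.{u} ℂ where
  obj V := ModuleCat.of ℂ V.carrier
  map T := ModuleCat.ofHom T.map

end FDComodule

end TropFan

end

noncomputable section

namespace TropFan

/-! ## The shuffle Hopf algebra -/

section Words

variable {M : Type u} [AddCommGroup M] [Module ℂ M]

theorem word_induction {p : TensorAlgebra ℂ M → Prop} (one : p 1)
    (ι_mul : ∀ a w, p w → p (TensorAlgebra.ι ℂ a * w))
    (add : ∀ x y, p x → p y → p (x + y)) (smul : ∀ (c : ℂ) x, p x → p (c • x)) (w) : p w := by
  have key : ∀ t w : TensorAlgebra ℂ M, p w → p (t * w) := by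
    intro t
    induction t using TensorAlgebra.induction with
    | algebraMap r => intro w hw; rw [← Algebra.smul_def]; exact smul r w hw
    | ι a => exact ι_mul a
    | mul a b ha hb => intro w hw; rw [mul_assoc]; exact ha _ (hb _ hw)
    | add a b ha hb => intro w hw; rw [add_mul]; exact add _ _ (ha _ hw) (hb _ hw)
  simpa using key w 1 one

theorem shuffle_one_right (u : TensorAlgebra ℂ M) : shuffle u 1 = u := by
  induction u using word_induction with
  | one => simp
  | ι_mul a w hw => rw [shuffle_ι_mul_one, hw]
  | add x y hx hy => simp [hx, hy]
  | smul c x hx => simp [hx]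

theorem shuffle_comm (u v : TensorAlgebra ℂ M) : shuffle u v = shuffle v u := by
  induction u using word_induction generalizing v with
  | one => simp [shuffle_one_right]
  | add x y hx hy => simp [hx, hy]
  | smul c x hx => simp [hx]
  | ι_mul a u hu =>
    induction v using word_induction with
    | one => simp [shuffle_one_right]
    | add x y hx hy => simp [hx, hy]
    | smul c x hx => simp [hx]
    | ι_mul b v hv =>
      rw [shuffle_ι_mul_ι_mul, shuffle_ι_mul_ι_mul, hu, hv, add_comm]

theorem shuffle_assoc (x y z : TensorAlgebra ℂ M) :
    shuffle (shuffle x y) z = shuffle x (shuffle y z) := by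
  induction x using word_induction generalizing y z with
  | one => simp
  | add x y hx hy => simp [hx, hy]
  | smul c x hx => simp [hx]
  | ι_mul a u hu =>
    induction y using word_induction generalizing z with
    | one => simp [shuffle_one_right]
    | add x y hx hy => simp [hx, hy]
    | smul c x hx => simp [hx]
    | ι_mul b v hv =>
      induction z using word_induction with
      | one => simp [shuffle_one_right]
      | add x y hx hy => simp [hx, hy]
      | smul c x hx => simp [hx]
      | ι_mul c w hw =>
        have hw' := hw
        rw [shuffle_ι_mul_ι_mul, map_add, LinearMap.add_apply] at hw'
        rw [shuffle_ι_mul_ι_mul a b, shuffle_ι_mul_ι_mul b c, map_add, map_add,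
          LinearMap.add_apply, shuffle_ι_mul_ι_mul, shuffle_ι_mul_ι_mul, shuffle_ι_mul_ι_mul,
          shuffle_ι_mul_ι_mul, hu, hv, ← hw, shuffle_ι_mul_ι_mul b c,
          shuffle_ι_mul_ι_mul a b, map_add, map_add, LinearMap.add_apply]
        simp only [mul_add]
        abel

end Words

/-- The tensor algebra, as a vector space; it carries the shuffle product. -/
def ShuffleAlgebra (M : Type u) [AddCommGroup M] [Module ℂ M] : Type u := TensorAlgebra ℂ M

namespace ShuffleAlgebra

variable {M : Type u} [AddCommGroup M] [Module ℂ M]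

instance : CommRing (ShuffleAlgebra M) :=
  { (inferInstance : AddCommGroup (TensorAlgebra ℂ M)) with
    one := (1 : TensorAlgebra ℂ M)
    mul := fun x y => shuffle (M := M) x y
    mul_assoc := shuffle_assoc (M := M)
    mul_comm := shuffle_comm (M := M)
    one_mul := shuffle_one_left (M := M)
    mul_one := shuffle_one_right (M := M)
    left_distrib := fun x => map_add (shuffle (M := M) x)
    right_distrib := LinearMap.map_add₂ (shuffle (M := M))
    zero_mul := LinearMap.map_zero₂ (shuffle (M := M))
    mul_zero := fun x => map_zero (shuffle (M := M) x) }

instance : Algebra ℂ (ShuffleAlgebra M) :=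
  letI : Module ℂ (ShuffleAlgebra M) := inferInstanceAs (Module ℂ (TensorAlgebra ℂ M))
  Algebra.ofModule
    (fun r x y => LinearMap.map_smul₂ (shuffle (M := M)) r x y)
    (fun r x y => map_smul (shuffle (M := M) x) r y)

variable (M) in
/-- The underlying word of an element of the shuffle algebra. -/
def toTensor : ShuffleAlgebra M ≃ₗ[ℂ] TensorAlgebra ℂ M where
  toFun x := x
  invFun x := x
  map_add' _ _ := rfl
  map_smul' _ _ := rfl
  left_inv _ := rfl
  right_inv _ := rfl

@[simp] theorem toTensor_one : toTensor M 1 = 1 := rfl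

@[simp] theorem toTensor_symm_one : (toTensor M).symm 1 = 1 := rfl

/-- Prepending a letter to a word. -/
def cons : M →ₗ[ℂ] ShuffleAlgebra M →ₗ[ℂ] ShuffleAlgebra M :=
  LinearMap.mk₂ ℂ (fun a w => (toTensor M).symm (TensorAlgebra.ι ℂ a * toTensor M w))
    (fun a b w => by simp [add_mul]) (fun c a w => by simp)
    (fun a b w => by simp [mul_add]) (fun c a w => by simp)

theorem toTensor_cons (a : M) (w : ShuffleAlgebra M) :
    toTensor M (cons a w) = TensorAlgebra.ι ℂ a * toTensor M w := rfl

theorem toTensor_symm_ι_mul (a : M) (w : TensorAlgebra ℂ M) :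
    (toTensor M).symm (TensorAlgebra.ι ℂ a * w) = cons a ((toTensor M).symm w) := rfl

@[elab_as_elim]
theorem induction {p : ShuffleAlgebra M → Prop} (one : p 1)
    (cons : ∀ a w, p w → p (cons a w))
    (add : ∀ x y, p x → p y → p (x + y)) (smul : ∀ (c : ℂ) x, p x → p (c • x)) (w) : p w :=
  word_induction one cons add smul w

theorem cons_mul_cons (a b : M) (u v : ShuffleAlgebra M) :
    cons a u * cons b v = cons a (u * cons b v) + cons b (cons a u * v) :=
  shuffle_ι_mul_ι_mul a b u v

theorem hom_ext {Y : Type*} [AddCommMonoid Y] [Module ℂ Y] {f g : ShuffleAlgebra M →ₗ[ℂ] Y}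
    (one : f 1 = g 1) (cons : ∀ a w, f w = g w → f (cons a w) = g (cons a w)) : f = g := by
  refine LinearMap.ext fun w => ?_
  induction w using induction with
  | one => exact one
  | cons a w hw => exact cons a w hw
  | add x y hx hy => rw [map_add, map_add, hx, hy]
  | smul c x hx => rw [map_smul, map_smul, hx]

/-- Recursion on the first letter. -/
def wordLift {Y : Type u} [AddCommGroup Y] [Module ℂ Y] (y₀ : Y)
    (p : M →ₗ[ℂ] ShuffleAlgebra M →ₗ[ℂ] Y) (q : M →ₗ[ℂ] Y →ₗ[ℂ] Y) :
    ShuffleAlgebra M →ₗ[ℂ] Y :=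
  wordRec y₀ (p.compl₂ (toTensor M).symm.toLinearMap) q ∘ₗ (toTensor M).toLinearMap

section wordLift

variable {Y : Type u} [AddCommGroup Y] [Module ℂ Y] (y₀ : Y)
  (p : M →ₗ[ℂ] ShuffleAlgebra M →ₗ[ℂ] Y) (q : M →ₗ[ℂ] Y →ₗ[ℂ] Y)

theorem wordLift_one : wordLift y₀ p q 1 = y₀ := wordRec_one ..

theorem wordLift_cons (a : M) (w : ShuffleAlgebra M) :
    wordLift y₀ p q (cons a w) = p a w + q a (wordLift y₀ p q w) :=
  wordRec_ι_mul ..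

end wordLift

/-- Deconcatenation as a linear map. -/
def deconcatMap : ShuffleAlgebra M →ₗ[ℂ] ShuffleAlgebra M ⊗[ℂ] ShuffleAlgebra M :=
  TensorProduct.map (toTensor M).symm.toLinearMap (toTensor M).symm.toLinearMap ∘ₗ
    deconcat ∘ₗ (toTensor M).toLinearMap

theorem deconcatMap_one : deconcatMap (1 : ShuffleAlgebra M) = 1 ⊗ₜ 1 := by
  simp [deconcatMap]

theorem deconcatMap_cons (a : M) (w : ShuffleAlgebra M) :
    deconcatMap (cons a w) = 1 ⊗ₜ cons a w + LinearMap.rTensor _ (cons a) (deconcatMap w) := by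
  simp only [deconcatMap, LinearMap.comp_apply, LinearEquiv.coe_coe, toTensor_cons,
    deconcat_ι_mul, map_add, TensorProduct.map_tmul, toTensor_symm_ι_mul, toTensor_symm_one,
    LinearEquiv.symm_apply_apply]
  congr 1
  induction deconcat (toTensor M w) using TensorProduct.induction_on with
  | zero => simp
  | tmul x y => simp [toTensor_symm_ι_mul]
  | add x y hx hy => simp only [map_add, hx, hy]

/-- The coefficient of the empty word. -/
def coeffOne : ShuffleAlgebra M →ₗ[ℂ] ℂ :=
  TensorAlgebra.algebraMapInv.toLinearMap ∘ₗ (toTensor M).toLinearMap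

@[simp] theorem coeffOne_one : coeffOne (1 : ShuffleAlgebra M) = 1 := by
  simp [coeffOne]

@[simp] theorem coeffOne_cons (a : M) (w : ShuffleAlgebra M) : coeffOne (cons a w) = 0 := by
  simp [coeffOne, toTensor_cons, TensorAlgebra.algebraMapInv]

theorem coeffOne_mul (x y : ShuffleAlgebra M) : coeffOne (x * y) = coeffOne x * coeffOne y := by
  induction x using induction with
  | one => simp
  | add x x' hx hx' => simp [add_mul, hx, hx']
  | smul c x hx => simp [hx, mul_assoc]
  | cons a u hu =>
    clear hu
    induction y using induction with
    | one => simp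
    | add x x' hx hx' => rw [mul_add, map_add, hx, hx', map_add, mul_add]
    | smul c x hx => rw [mul_smul_comm, map_smul, hx, map_smul, smul_eq_mul, smul_eq_mul]; ring
    | cons b v => simp [cons_mul_cons]

section

variable (X Y : ShuffleAlgebra M ⊗[ℂ] ShuffleAlgebra M)

theorem rTensor_cons_mul_rTensor_cons (a b : M) :
    LinearMap.rTensor _ (cons a) X * LinearMap.rTensor _ (cons b) Y =
      LinearMap.rTensor _ (cons a) (X * LinearMap.rTensor _ (cons b) Y) +
      LinearMap.rTensor _ (cons b) (LinearMap.rTensor _ (cons a) X * Y) := by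
  induction X using TensorProduct.induction_on with
  | zero => simp
  | add x y hx hy => simp only [map_add, add_mul, hx, hy]; abel
  | tmul x x' =>
    induction Y using TensorProduct.induction_on with
    | zero => simp
    | add x y hx hy => simp only [map_add, mul_add, hx, hy]; abel
    | tmul y y' => simp [cons_mul_cons, TensorProduct.add_tmul]

theorem one_tmul_mul_rTensor_cons (x : ShuffleAlgebra M) (b : M) :
    ((1 : ShuffleAlgebra M) ⊗ₜ[ℂ] x) * LinearMap.rTensor _ (cons b) Y =
      LinearMap.rTensor _ (cons b) (((1 : ShuffleAlgebra M) ⊗ₜ[ℂ] x) * Y) := by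
  induction Y using TensorProduct.induction_on with
  | zero => simp
  | add x y hx hy => simp only [map_add, mul_add, hx, hy]
  | tmul y y' => simp

end

theorem deconcatMap_mul (x y : ShuffleAlgebra M) :
    deconcatMap (x * y) = deconcatMap x * deconcatMap y := by
  induction x using induction generalizing y with
  | one => rw [deconcatMap_one, ← Algebra.TensorProduct.one_def, one_mul, one_mul]
  | add x x' hx hx' => simp [add_mul, hx, hx']
  | smul c x hx => simp [hx]
  | cons a u hu =>
    induction y using induction with
    | one => rw [deconcatMap_one, ← Algebra.TensorProduct.one_def, mul_one, mul_one]
    | add x x' hx hx' => rw [mul_add, map_add, hx, hx', map_add, mul_add]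
    | smul c x hx => rw [mul_smul_comm, map_smul, hx, map_smul, mul_smul_comm]
    | cons b v hv =>
      rw [cons_mul_cons, map_add, deconcatMap_cons, deconcatMap_cons, hu, hv,
        deconcatMap_cons a, deconcatMap_cons b]
      simp only [add_mul, mul_add, map_add]
      rw [rTensor_cons_mul_rTensor_cons, one_tmul_mul_rTensor_cons,
        mul_comm (LinearMap.rTensor _ (cons a) (deconcatMap u)) (1 ⊗ₜ[ℂ] cons b v),
        one_tmul_mul_rTensor_cons, Algebra.TensorProduct.tmul_mul_tmul, cons_mul_cons a b, mul_one,
        TensorProduct.tmul_add, mul_comm (1 ⊗ₜ[ℂ] cons b v) (deconcatMap u)]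
      abel

instance : Coalgebra ℂ (ShuffleAlgebra M) where
  comul := deconcatMap
  counit := coeffOne
  coassoc := by
    refine hom_ext (by simp [deconcatMap_one]) fun a w hw => ?_
    simp only [LinearMap.comp_apply, LinearEquiv.coe_coe] at hw ⊢
    have h₁ : ∀ z : ShuffleAlgebra M ⊗[ℂ] ShuffleAlgebra M,
        TensorProduct.assoc ℂ _ _ _ (LinearMap.rTensor (ShuffleAlgebra M) deconcatMap
          (LinearMap.rTensor (ShuffleAlgebra M) (cons a) z)) =
        1 ⊗ₜ[ℂ] LinearMap.rTensor _ (cons a) z + LinearMap.rTensor _ (cons a)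
          (TensorProduct.assoc ℂ _ _ _ (LinearMap.rTensor (ShuffleAlgebra M) deconcatMap z)) := by
      intro z
      induction z using TensorProduct.induction_on with
      | zero => simp
      | add x y hx hy => simp only [map_add, hx, hy, TensorProduct.tmul_add]; abel
      | tmul x y =>
        simp only [LinearMap.rTensor_tmul, deconcatMap_cons, TensorProduct.add_tmul, map_add,
          TensorProduct.assoc_tmul]
        congr 1
        induction deconcatMap x using TensorProduct.induction_on with
        | zero => simp
        | add x y hx hy => simp only [map_add, hx, hy, TensorProduct.add_tmul]
        | tmul x y => simp
    have h₂ : ∀ z : ShuffleAlgebra M ⊗[ℂ] ShuffleAlgebra M,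
        LinearMap.lTensor (ShuffleAlgebra M) deconcatMap (LinearMap.rTensor _ (cons a) z) =
          LinearMap.rTensor _ (cons a) (LinearMap.lTensor _ deconcatMap z) := fun z => by
      rw [← LinearMap.comp_apply, LinearMap.lTensor_comp_rTensor, ← LinearMap.rTensor_comp_lTensor,
        LinearMap.comp_apply]
    rw [deconcatMap_cons, map_add, map_add, map_add, h₁, h₂, hw]
    simp [deconcatMap_one, deconcatMap_cons, TensorProduct.tmul_add, add_assoc]
  rTensor_counit_comp_comul := by
    refine hom_ext (by simp [deconcatMap_one]) fun a w hw => ?_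
    have h₁ : (coeffOne : ShuffleAlgebra M →ₗ[ℂ] ℂ) ∘ₗ cons a = 0 := by ext; simp
    simp only [LinearMap.comp_apply, deconcatMap_cons, map_add]
    rw [← LinearMap.comp_apply, ← LinearMap.rTensor_comp, h₁]
    simp
  lTensor_counit_comp_comul := by
    refine hom_ext (by simp [deconcatMap_one]) fun a w hw => ?_
    simp only [LinearMap.comp_apply, deconcatMap_cons, map_add] at hw ⊢
    rw [← LinearMap.comp_apply (LinearMap.lTensor _ _), LinearMap.lTensor_comp_rTensor,
      ← LinearMap.rTensor_comp_lTensor, LinearMap.comp_apply, hw]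
    simp

theorem comul_cons (a : M) (w : ShuffleAlgebra M) :
    Coalgebra.comul (R := ℂ) (cons a w) =
      1 ⊗ₜ cons a w + LinearMap.rTensor _ (cons a) (Coalgebra.comul (R := ℂ) w) :=
  deconcatMap_cons a w

theorem counit_eq_coeffOne (x : ShuffleAlgebra M) :
    Coalgebra.counit (R := ℂ) x = coeffOne x := rfl

instance : Bialgebra ℂ (ShuffleAlgebra M) :=
  Bialgebra.mk' ℂ (ShuffleAlgebra M) coeffOne_one (coeffOne_mul _ _)
    deconcatMap_one (deconcatMap_mul _ _)

/-- The graph `(1 ⊗ g) Δ` of the right convolution inverse `g` of `f`. -/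
def invGraph (f : ShuffleAlgebra M →ₗ[ℂ] ShuffleAlgebra M) :
    ShuffleAlgebra M →ₗ[ℂ] ShuffleAlgebra M ⊗[ℂ] ShuffleAlgebra M :=
  wordLift (1 ⊗ₜ 1) 0
    ((LinearMap.id - TensorProduct.mk ℂ (ShuffleAlgebra M) (ShuffleAlgebra M) 1 ∘ₗ
      LinearMap.mul' ℂ _ ∘ₗ LinearMap.rTensor _ f).compRight ℂ ∘ₗ
        LinearMap.rTensorHom (ShuffleAlgebra M) ∘ₗ cons)

/-- The right convolution inverse of a linear map that preserves the unit. -/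
def rightInv (f : ShuffleAlgebra M →ₗ[ℂ] ShuffleAlgebra M) :
    ShuffleAlgebra M →ₗ[ℂ] ShuffleAlgebra M :=
  (TensorProduct.lid ℂ _).toLinearMap ∘ₗ LinearMap.rTensor _ coeffOne ∘ₗ invGraph f

variable (f : ShuffleAlgebra M →ₗ[ℂ] ShuffleAlgebra M)

theorem invGraph_one : invGraph f 1 = 1 ⊗ₜ 1 := wordLift_one ..

theorem invGraph_cons (a : M) (w : ShuffleAlgebra M) :
    invGraph f (cons a w) = LinearMap.rTensor _ (cons a) (invGraph f w) -
      1 ⊗ₜ LinearMap.mul' ℂ _ (LinearMap.rTensor _ f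
        (LinearMap.rTensor _ (cons a) (invGraph f w))) := by
  rw [invGraph, wordLift_cons]
  simp

@[simp] theorem rightInv_one : rightInv f 1 = 1 := by
  simp [rightInv, invGraph_one]

theorem rightInv_cons (a : M) (w : ShuffleAlgebra M) :
    rightInv f (cons a w) = - LinearMap.mul' ℂ _ (LinearMap.rTensor _ f
        (LinearMap.rTensor _ (cons a) (invGraph f w))) := by
  have h₁ : (coeffOne : ShuffleAlgebra M →ₗ[ℂ] ℂ) ∘ₗ cons a = 0 := by ext; simp
  rw [rightInv, LinearMap.comp_apply, LinearMap.comp_apply, invGraph_cons, map_sub,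
    ← LinearMap.comp_apply (LinearMap.rTensor _ coeffOne), ← LinearMap.rTensor_comp, h₁]
  simp

theorem invGraph_eq (w : ShuffleAlgebra M) :
    invGraph f w = LinearMap.lTensor _ (rightInv f) (Coalgebra.comul (R := ℂ) w) := by
  rw [← LinearMap.comp_apply]
  refine LinearMap.congr_fun (hom_ext ?_ fun a w hw => ?_) w
  · simp [invGraph_one, Algebra.TensorProduct.one_def]
  · rw [LinearMap.comp_apply] at hw ⊢
    rw [comul_cons, map_add, ← LinearMap.comp_apply _ (LinearMap.rTensor _ (cons a)),
      LinearMap.lTensor_comp_rTensor,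
      ← LinearMap.rTensor_comp_lTensor, LinearMap.comp_apply, ← hw, invGraph_cons,
      LinearMap.lTensor_tmul, rightInv_cons, TensorProduct.tmul_neg, sub_eq_add_neg, add_comm]

theorem mul_rightInv (hf : f 1 = 1) :
    WithConv.toConv f * WithConv.toConv (rightInv f) = 1 := by
  refine WithConv.ofConv_injective (hom_ext ?_ fun a w _ => ?_)
  · simp [LinearMap.convMul_def, LinearMap.convOne_def, hf, Algebra.TensorProduct.one_def]
  · have h : ∀ z, LinearMap.mul' ℂ (ShuffleAlgebra M)
        (TensorProduct.map f (rightInv f) (Coalgebra.comul (R := ℂ) z)) =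
        LinearMap.mul' ℂ _ (LinearMap.rTensor _ f (invGraph f z)) := fun z => by
      rw [invGraph_eq, ← LinearMap.comp_apply (LinearMap.rTensor _ f),
        LinearMap.rTensor_comp_lTensor]
    simp only [LinearMap.convMul_def, LinearMap.convOne_def, WithConv.ofConv_toConv,
      LinearMap.comp_apply, h, invGraph_cons, counit_eq_coeffOne, coeffOne_cons]
    simp [hf]

instance : HopfAlgebra ℂ (ShuffleAlgebra M) where
  antipode := rightInv LinearMap.id
  mul_antipode_rTensor_comul := by
    have h₁ := mul_rightInv (LinearMap.id : ShuffleAlgebra M →ₗ[ℂ] _) rfl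
    have h₂ := mul_rightInv (rightInv (LinearMap.id : ShuffleAlgebra M →ₗ[ℂ] _)) (rightInv_one _)
    rw [← left_inv_eq_right_inv h₁ h₂] at h₂
    exact congrArg WithConv.ofConv h₂
  mul_antipode_lTensor_comul :=
    congrArg WithConv.ofConv (mul_rightInv (LinearMap.id : ShuffleAlgebra M →ₗ[ℂ] _) rfl)

end ShuffleAlgebra

/-! ## Tensor products over a field -/

section TensorField

variable {E W P : Type*} [AddCommGroup E] [Module ℂ E] [AddCommGroup W] [Module ℂ W]
  [AddCommGroup P] [Module ℂ P]

/-- Contraction of the first tensor factor with a linear form. -/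
def contractLeft (ξ : E →ₗ[ℂ] ℂ) : E ⊗[ℂ] W →ₗ[ℂ] W :=
  (TensorProduct.lid ℂ W).toLinearMap ∘ₗ LinearMap.rTensor W ξ

/-- Contraction of the second tensor factor with a linear form. -/
def contractRight (ξ : W →ₗ[ℂ] ℂ) : E ⊗[ℂ] W →ₗ[ℂ] E :=
  (TensorProduct.rid ℂ E).toLinearMap ∘ₗ LinearMap.lTensor E ξ

@[simp] theorem contractLeft_tmul (ξ : E →ₗ[ℂ] ℂ) (e : E) (w : W) :
    contractLeft ξ (e ⊗ₜ[ℂ] w) = ξ e • w := by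
  simp [contractLeft]

@[simp] theorem contractRight_tmul (ξ : W →ₗ[ℂ] ℂ) (e : E) (w : W) :
    contractRight ξ (e ⊗ₜ[ℂ] w) = ξ w • e := by
  simp [contractRight]

theorem contractLeft_comp (ξ : E →ₗ[ℂ] ℂ) (f : P →ₗ[ℂ] E) (z : P ⊗[ℂ] W) :
    contractLeft (ξ ∘ₗ f) z = contractLeft ξ (LinearMap.rTensor W f z) := by
  simp [contractLeft, LinearMap.rTensor_comp]

theorem contractLeft_lTensor (ξ : E →ₗ[ℂ] ℂ) (f : W →ₗ[ℂ] P) (z : E ⊗[ℂ] W) :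
    contractLeft ξ (LinearMap.lTensor E f z) = f (contractLeft ξ z) := by
  have h : contractLeft ξ ∘ₗ LinearMap.lTensor E f = f ∘ₗ contractLeft ξ := by ext; simp
  exact LinearMap.congr_fun h z

theorem contractRight_comp (ξ : P →ₗ[ℂ] ℂ) (f : W →ₗ[ℂ] P) (z : E ⊗[ℂ] W) :
    contractRight (ξ ∘ₗ f) z = contractRight ξ (LinearMap.lTensor E f z) := by
  simp [contractRight, LinearMap.lTensor_comp]

theorem contractRight_rTensor (ξ : W →ₗ[ℂ] ℂ) (f : E →ₗ[ℂ] P) (z : E ⊗[ℂ] W) :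
    contractRight ξ (LinearMap.rTensor W f z) = f (contractRight ξ z) := by
  have h : contractRight ξ ∘ₗ LinearMap.rTensor W f = f ∘ₗ contractRight ξ := by ext; simp
  exact LinearMap.congr_fun h z

theorem lTensor_rTensor_comm {Q : Type*} [AddCommGroup Q] [Module ℂ Q] (f : E →ₗ[ℂ] P)
    (g : W →ₗ[ℂ] Q) (z : E ⊗[ℂ] W) : LinearMap.lTensor P g (LinearMap.rTensor W f z) =
      LinearMap.rTensor Q f (LinearMap.lTensor E g z) := by
  rw [← LinearMap.comp_apply, ← LinearMap.comp_apply, LinearMap.lTensor_comp_rTensor,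
    LinearMap.rTensor_comp_lTensor]

theorem contractLeft_comm (ξ : W →ₗ[ℂ] ℂ) (z : E ⊗[ℂ] W) :
    contractLeft ξ (TensorProduct.comm ℂ E W z) = contractRight ξ z := by
  have h : contractLeft ξ ∘ₗ (TensorProduct.comm ℂ E W).toLinearMap = contractRight ξ := by
    ext; simp
  exact LinearMap.congr_fun h z

theorem eq_zero_of_contractLeft {z : E ⊗[ℂ] W}
    (h : ∀ ξ : E →ₗ[ℂ] ℂ, contractLeft ξ z = 0) : z = 0 := by
  classical
  let b := Module.Basis.ofVectorSpace ℂ E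
  refine (TensorProduct.equivFinsuppOfBasisLeft (N := W) b).injective ?_
  rw [map_zero]
  ext i
  rw [Finsupp.zero_apply, ← h (b.coord i)]
  have h : Finsupp.lapply i ∘ₗ
      (TensorProduct.equivFinsuppOfBasisLeft (N := W) b).toLinearMap =
      contractLeft (b.coord i) := by ext; simp
  exact LinearMap.congr_fun h z

theorem eq_zero_of_contractRight {z : E ⊗[ℂ] W}
    (h : ∀ ξ : W →ₗ[ℂ] ℂ, contractRight ξ z = 0) : z = 0 := by
  refine (TensorProduct.comm ℂ E W).injective ?_
  rw [map_zero]
  exact eq_zero_of_contractLeft fun ξ => by rw [contractLeft_comm, h]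

theorem mem_range_lTensor {S : Submodule ℂ W} {z : E ⊗[ℂ] W}
    (h : ∀ ξ : E →ₗ[ℂ] ℂ, contractLeft ξ z ∈ S) :
    z ∈ LinearMap.range (LinearMap.lTensor E S.subtype) := by
  have hex : Function.Exact S.subtype S.mkQ := by
    rw [LinearMap.exact_iff]; simp
  refine (lTensor_exact E hex S.mkQ_surjective z).1 (eq_zero_of_contractLeft fun ξ => ?_)
  rw [contractLeft_lTensor]
  simpa using h ξ

theorem mem_range_rTensor {S : Submodule ℂ E} {z : E ⊗[ℂ] W}
    (h : ∀ ξ : W →ₗ[ℂ] ℂ, contractRight ξ z ∈ S) :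
    z ∈ LinearMap.range (LinearMap.rTensor W S.subtype) := by
  have hex : Function.Exact S.subtype S.mkQ := by
    rw [LinearMap.exact_iff]; simp
  refine (rTensor_exact W hex S.mkQ_surjective z).1 (eq_zero_of_contractRight fun ξ => ?_)
  rw [contractRight_rTensor]
  simpa using h ξ

theorem mem_range_map {S : Submodule ℂ E} {S' : Submodule ℂ W} {z : E ⊗[ℂ] W}
    (h : ∀ ξ : W →ₗ[ℂ] ℂ, contractRight ξ z ∈ S)
    (h' : ∀ ξ : E →ₗ[ℂ] ℂ, contractLeft ξ z ∈ S') :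
    z ∈ LinearMap.range (TensorProduct.map S.subtype S'.subtype) := by
  obtain ⟨y, rfl⟩ := mem_range_rTensor h
  have hy : y ∈ LinearMap.range (LinearMap.lTensor S S'.subtype) := by
    refine mem_range_lTensor fun ξ => ?_
    obtain ⟨η, rfl⟩ := LinearMap.exists_extend ξ
    rw [contractLeft_comp]
    exact h' η
  obtain ⟨x, rfl⟩ := hy
  exact ⟨x, by rw [← LinearMap.comp_apply, LinearMap.rTensor_comp_lTensor]⟩

theorem contractLeft_mem {S : Submodule ℂ W} {z : E ⊗[ℂ] W}
    (h : z ∈ LinearMap.range (LinearMap.lTensor E S.subtype)) (ξ : E →ₗ[ℂ] ℂ) :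
    contractLeft ξ z ∈ S := by
  obtain ⟨y, rfl⟩ := h
  rw [contractLeft_lTensor]
  exact Submodule.coe_mem _

theorem contractRight_mem {S : Submodule ℂ E} {z : E ⊗[ℂ] W}
    (h : z ∈ LinearMap.range (LinearMap.rTensor W S.subtype)) (ξ : W →ₗ[ℂ] ℂ) :
    contractRight ξ z ∈ S := by
  obtain ⟨y, rfl⟩ := h
  rw [contractRight_rTensor]
  exact Submodule.coe_mem _

/-- The lift of a linear map through an injective linear map whose range contains its values. -/
def liftInjective (j : P →ₗ[ℂ] W) (hj : Function.Injective j) (f : E →ₗ[ℂ] W)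
    (hf : ∀ x, f x ∈ LinearMap.range j) : E →ₗ[ℂ] P :=
  (LinearEquiv.ofInjective j hj).symm.toLinearMap ∘ₗ f.codRestrict (LinearMap.range j) hf

@[simp] theorem apply_liftInjective (j : P →ₗ[ℂ] W) (hj : Function.Injective j)
    (f : E →ₗ[ℂ] W) (hf : ∀ x, f x ∈ LinearMap.range j) (x : E) :
    j (liftInjective j hj f hf x) = f x := by
  have h := (LinearEquiv.ofInjective j hj).apply_symm_apply (f.codRestrict _ hf x)
  exact congrArg Subtype.val h

theorem lTensor_injective (E : Type*) [AddCommGroup E] [Module ℂ E] {f : W →ₗ[ℂ] P}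
    (hf : Function.Injective f) : Function.Injective (LinearMap.lTensor E f) :=
  Module.Flat.lTensor_preserves_injective_linearMap f hf

theorem rTensor_injective (E : Type*) [AddCommGroup E] [Module ℂ E] {f : W →ₗ[ℂ] P}
    (hf : Function.Injective f) : Function.Injective (LinearMap.rTensor E f) :=
  Module.Flat.rTensor_preserves_injective_linearMap f hf

theorem map_injective {E' W' : Type*} [AddCommGroup E'] [Module ℂ E'] [AddCommGroup W']
    [Module ℂ W'] {f : E →ₗ[ℂ] E'} {g : W →ₗ[ℂ] W'} (hf : Function.Injective f)
    (hg : Function.Injective g) : Function.Injective (TensorProduct.map f g) := by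
  rw [← LinearMap.lTensor_comp_rTensor]
  exact (lTensor_injective E' hg).comp (rTensor_injective W hf)

end TensorField

/-! ## Hopf subalgebras -/

section SubHopf

variable {B : Type u} [CommRing B] [HopfAlgebra ℂ B]

/-- Hopf subalgebras: subalgebras that are stable under the coproduct and the antipode. -/
structure IsHopfSubalgebra (S : Subalgebra ℂ B) : Prop where
  comul_mem : ∀ x ∈ S, Coalgebra.comul (R := ℂ) x ∈
    LinearMap.range (TensorProduct.map S.val.toLinearMap S.val.toLinearMap)
  antipode_mem : ∀ x ∈ S, HopfAlgebra.antipode ℂ x ∈ S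

variable {S : Subalgebra ℂ B} (hS : IsHopfSubalgebra S)

theorem Subalgebra.val_toLinearMap_injective (S : Subalgebra ℂ B) :
    Function.Injective S.val.toLinearMap := Subtype.val_injective

namespace IsHopfSubalgebra

/-- The restricted coproduct. -/
def comul : S →ₗ[ℂ] S ⊗[ℂ] S :=
  liftInjective (TensorProduct.map S.val.toLinearMap S.val.toLinearMap)
    (map_injective (Subalgebra.val_toLinearMap_injective S)
      (Subalgebra.val_toLinearMap_injective S))
    (Coalgebra.comul ∘ₗ S.val.toLinearMap) fun x => hS.comul_mem x x.2

theorem map_comul (x : S) :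
    TensorProduct.map S.val.toLinearMap S.val.toLinearMap (hS.comul x) =
      Coalgebra.comul (R := ℂ) (x : B) :=
  apply_liftInjective ..

/-- The restricted antipode. -/
def antipode : S →ₗ[ℂ] S :=
  ((HopfAlgebra.antipode ℂ).comp S.val.toLinearMap).codRestrict (Subalgebra.toSubmodule S)
    fun x => hS.antipode_mem x x.2

/-- A Hopf subalgebra is a coalgebra. -/
@[reducible] def coalgebra : Coalgebra ℂ S where
  comul := hS.comul
  counit := Coalgebra.counit ∘ₗ S.val.toLinearMap
  coassoc := by
    refine LinearMap.ext fun x => ?_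
    have hi := Subalgebra.val_toLinearMap_injective S
    refine map_injective hi (map_injective hi hi) ?_
    have h₁ : TensorProduct.map S.val.toLinearMap
        (TensorProduct.map S.val.toLinearMap S.val.toLinearMap) ∘ₗ
        (TensorProduct.assoc ℂ S S S).toLinearMap ∘ₗ hS.comul.rTensor S =
        (TensorProduct.assoc ℂ B B B).toLinearMap ∘ₗ
        Coalgebra.comul.rTensor B ∘ₗ TensorProduct.map S.val.toLinearMap S.val.toLinearMap := by
      refine TensorProduct.ext' fun a b => ?_
      have h : Coalgebra.comul (R := ℂ) (S.val.toLinearMap a) =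
          TensorProduct.map S.val.toLinearMap S.val.toLinearMap (hS.comul a) :=
        (hS.map_comul a).symm
      simp only [LinearMap.comp_apply, TensorProduct.map_tmul, LinearMap.rTensor_tmul, h]
      exact LinearMap.congr_fun
        (TensorProduct.map_map_comp_assoc_eq S.val.toLinearMap S.val.toLinearMap
          S.val.toLinearMap) (hS.comul a ⊗ₜ b)
    have h₂ : TensorProduct.map S.val.toLinearMap
        (TensorProduct.map S.val.toLinearMap S.val.toLinearMap) ∘ₗ hS.comul.lTensor S =
        Coalgebra.comul.lTensor B ∘ₗ TensorProduct.map S.val.toLinearMap S.val.toLinearMap := by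
      refine TensorProduct.ext' fun a b => ?_
      have h : Coalgebra.comul (R := ℂ) (S.val.toLinearMap b) =
          TensorProduct.map S.val.toLinearMap S.val.toLinearMap (hS.comul b) :=
        (hS.map_comul b).symm
      simp only [LinearMap.comp_apply, TensorProduct.map_tmul, LinearMap.lTensor_tmul, h]
    have h₁' := LinearMap.congr_fun h₁ (hS.comul x)
    have h₂' := LinearMap.congr_fun h₂ (hS.comul x)
    simp only [LinearMap.comp_apply] at h₁' h₂' ⊢
    rw [h₁', h₂', map_comul]
    exact Coalgebra.coassoc_apply (R := ℂ) (x : B)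
  rTensor_counit_comp_comul := by
    refine LinearMap.ext fun x => ?_
    refine lTensor_injective ℂ (Subalgebra.val_toLinearMap_injective S) ?_
    have h := Coalgebra.rTensor_counit_comul (R := ℂ) (x : B)
    rw [← hS.map_comul] at h
    simp only [LinearMap.comp_apply, TensorProduct.mk_apply, LinearMap.lTensor_tmul]
    refine Eq.trans ?_ h
    have e : S.val.toLinearMap.lTensor ℂ ∘ₗ (Coalgebra.counit ∘ₗ S.val.toLinearMap).rTensor S =
        Coalgebra.counit.rTensor B ∘ₗ TensorProduct.map S.val.toLinearMap S.val.toLinearMap :=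
      TensorProduct.ext' fun _ _ => rfl
    exact LinearMap.congr_fun e (hS.comul x)
  lTensor_counit_comp_comul := by
    refine LinearMap.ext fun x => ?_
    refine rTensor_injective ℂ (Subalgebra.val_toLinearMap_injective S) ?_
    have h := Coalgebra.lTensor_counit_comul (R := ℂ) (x : B)
    rw [← hS.map_comul] at h
    simp only [LinearMap.comp_apply, LinearMap.flip_apply, TensorProduct.mk_apply,
      LinearMap.rTensor_tmul]
    refine Eq.trans ?_ h
    have e : S.val.toLinearMap.rTensor ℂ ∘ₗ (Coalgebra.counit ∘ₗ S.val.toLinearMap).lTensor S =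
        Coalgebra.counit.lTensor B ∘ₗ TensorProduct.map S.val.toLinearMap S.val.toLinearMap :=
      TensorProduct.ext' fun _ _ => rfl
    exact LinearMap.congr_fun e (hS.comul x)

/-- A Hopf subalgebra is a bialgebra. -/
@[reducible] def bialgebra : Bialgebra ℂ S :=
  letI := hS.coalgebra
  have hi := Subalgebra.val_toLinearMap_injective S
  Bialgebra.mk' ℂ S
    (Bialgebra.counit_one (R := ℂ) (A := B))
    (fun {a b} => Bialgebra.counit_mul (R := ℂ) (a : B) b)
    (map_injective hi hi (by
      change TensorProduct.map S.val.toLinearMap S.val.toLinearMap (hS.comul 1) = _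
      rw [map_comul]
      simp [Algebra.TensorProduct.one_def]))
    (fun {a b} => map_injective hi hi (by
      change TensorProduct.map S.val.toLinearMap S.val.toLinearMap (hS.comul (a * b)) =
        Algebra.TensorProduct.map S.val S.val (hS.comul a * hS.comul b)
      refine Eq.trans ?_
        (map_mul (Algebra.TensorProduct.map S.val S.val) (hS.comul a) (hS.comul b)).symm
      change _ = TensorProduct.map S.val.toLinearMap S.val.toLinearMap (hS.comul a) *
        TensorProduct.map S.val.toLinearMap S.val.toLinearMap (hS.comul b)
      rw [map_comul, map_comul, map_comul]
      exact Bialgebra.comul_mul (R := ℂ) (a : B) b))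

/-- A Hopf subalgebra is a Hopf algebra. -/
@[reducible] def hopfAlgebra : HopfAlgebra ℂ S :=
  letI := hS.bialgebra
  { antipode := hS.antipode
    mul_antipode_rTensor_comul := by
      refine LinearMap.ext fun x => Subtype.ext ?_
      refine Eq.trans ?_ (HopfAlgebra.mul_antipode_rTensor_comul_apply (R := ℂ) (x : B))
      rw [← hS.map_comul]
      have h : S.val.toLinearMap ∘ₗ LinearMap.mul' ℂ S ∘ₗ hS.antipode.rTensor S =
          LinearMap.mul' ℂ B ∘ₗ (HopfAlgebra.antipode ℂ).rTensor B ∘ₗ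
            TensorProduct.map S.val.toLinearMap S.val.toLinearMap :=
        TensorProduct.ext' fun a b => rfl
      exact LinearMap.congr_fun h (hS.comul x)
    mul_antipode_lTensor_comul := by
      refine LinearMap.ext fun x => Subtype.ext ?_
      refine Eq.trans ?_ (HopfAlgebra.mul_antipode_lTensor_comul_apply (R := ℂ) (x : B))
      rw [← hS.map_comul]
      have h : S.val.toLinearMap ∘ₗ LinearMap.mul' ℂ S ∘ₗ hS.antipode.lTensor S =
          LinearMap.mul' ℂ B ∘ₗ (HopfAlgebra.antipode ℂ).lTensor B ∘ₗ
            TensorProduct.map S.val.toLinearMap S.val.toLinearMap :=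
        TensorProduct.ext' fun a b => rfl
      exact LinearMap.congr_fun h (hS.comul x) }

end IsHopfSubalgebra

end SubHopf

namespace ShuffleAlgebra

/-! ## Words with letters in a subspace -/

variable {M : Type u} [AddCommGroup M] [Module ℂ M]

/-- The span of the words with letters in `V`. -/
def wordsIn (V : Submodule ℂ M) : Submodule ℂ (ShuffleAlgebra M) :=
  (Subalgebra.toSubmodule (Algebra.adjoin ℂ (TensorAlgebra.ι ℂ '' (V : Set M)))).comap
    (toTensor M).toLinearMap

section wordsIn

variable {V : Submodule ℂ M}

theorem one_mem_wordsIn : (1 : ShuffleAlgebra M) ∈ wordsIn V :=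
  one_mem (Algebra.adjoin ℂ (TensorAlgebra.ι ℂ '' (V : Set M)))

theorem cons_mem_wordsIn {a : M} (ha : a ∈ V) {w : ShuffleAlgebra M} (hw : w ∈ wordsIn V) :
    cons a w ∈ wordsIn V :=
  mul_mem (S := Subalgebra ℂ (TensorAlgebra ℂ M))
    (Algebra.subset_adjoin (Set.mem_image_of_mem _ ha)) hw

@[elab_as_elim]
theorem wordsIn_induction {p : ∀ w : ShuffleAlgebra M, w ∈ wordsIn V → Prop}
    (one : p 1 one_mem_wordsIn)
    (cons : ∀ a (ha : a ∈ V) w (hw : w ∈ wordsIn V), p w hw → p (cons a w) (cons_mem_wordsIn ha hw))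
    (add : ∀ x y hx hy, p x hx → p y hy → p (x + y) (add_mem hx hy))
    (smul : ∀ (c : ℂ) x hx, p x hx → p (c • x) (Submodule.smul_mem _ c hx))
    {w : ShuffleAlgebra M} (hw : w ∈ wordsIn V) : p w hw := by
  have key : ∀ t ∈ Algebra.adjoin ℂ (TensorAlgebra.ι ℂ '' (V : Set M)),
      ∀ w (hw : w ∈ wordsIn V), p w hw →
      ∃ h : (toTensor M).symm (t * toTensor M w) ∈ wordsIn V,
        p ((toTensor M).symm (t * toTensor M w)) h := by
    intro t ht
    induction ht using Algebra.adjoin_induction with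
    | mem x hx =>
      obtain ⟨a, ha, rfl⟩ := hx
      exact fun w hw hp => ⟨cons_mem_wordsIn ha hw, cons a ha w hw hp⟩
    | algebraMap r =>
      intro w hw hp
      rw [← Algebra.smul_def, map_smul, LinearEquiv.symm_apply_apply]
      exact ⟨Submodule.smul_mem _ _ hw, smul r w _ hp⟩
    | add x y _ _ hx hy =>
      intro w hw hp
      obtain ⟨h₁, h₁'⟩ := hx w hw hp
      obtain ⟨h₂, h₂'⟩ := hy w hw hp
      rw [add_mul, map_add]
      exact ⟨add_mem h₁ h₂, add _ _ _ _ h₁' h₂'⟩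
    | mul x y _ _ hx hy =>
      intro w hw hp
      obtain ⟨h₁, h₁'⟩ := hy w hw hp
      have h := hx _ h₁ h₁'
      rwa [LinearEquiv.apply_symm_apply, ← mul_assoc] at h
  obtain ⟨h, h'⟩ := key (toTensor M w) hw 1 one_mem_wordsIn one
  have e : (toTensor M).symm (toTensor M w * toTensor M 1) = w := by
    rw [toTensor_one, mul_one, LinearEquiv.symm_apply_apply]
  simp only [e] at h'
  exact h'

theorem mul_mem_wordsIn {x y : ShuffleAlgebra M} (hx : x ∈ wordsIn V)
    (hy : y ∈ wordsIn V) :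
    x * y ∈ wordsIn V := by
  induction hx using wordsIn_induction generalizing y with
  | one => rwa [one_mul]
  | add x x' _ _ hx hx' => rw [add_mul]; exact add_mem (hx hy) (hx' hy)
  | smul c x _ hx => rw [smul_mul_assoc]; exact Submodule.smul_mem _ _ (hx hy)
  | cons a ha u hu ihu =>
    induction hy using wordsIn_induction with
    | one => rw [mul_one]; exact cons_mem_wordsIn ha hu
    | add x x' _ _ hx hx' => rw [mul_add]; exact add_mem hx hx'
    | smul c x _ hx => rw [mul_smul_comm]; exact Submodule.smul_mem _ _ hx
    | cons b hb v hv ihv =>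
      rw [cons_mul_cons]
      exact add_mem (cons_mem_wordsIn ha (ihu (cons_mem_wordsIn hb hv))) (cons_mem_wordsIn hb ihv)

theorem map_subtype_mem_range {E F E' F' : Type*} [AddCommGroup E] [Module ℂ E]
    [AddCommGroup F] [Module ℂ F] [AddCommGroup E'] [Module ℂ E'] [AddCommGroup F'] [Module ℂ F']
    {S : Submodule ℂ E} {T : Submodule ℂ F} {S' : Submodule ℂ E'} {T' : Submodule ℂ F'}
    {f : E →ₗ[ℂ] E'} {g : F →ₗ[ℂ] F'} (hf : ∀ x ∈ S, f x ∈ S') (hg : ∀ x ∈ T, g x ∈ T')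
    {z : E ⊗[ℂ] F} (hz : z ∈ LinearMap.range (TensorProduct.map S.subtype T.subtype)) :
    TensorProduct.map f g z ∈ LinearMap.range (TensorProduct.map S'.subtype T'.subtype) := by
  obtain ⟨y, rfl⟩ := hz
  refine ⟨TensorProduct.map (f.restrict hf) (g.restrict hg) y, ?_⟩
  rw [← LinearMap.comp_apply, ← LinearMap.comp_apply, ← TensorProduct.map_comp,
    ← TensorProduct.map_comp]
  rfl

theorem rTensor_cons_mem_range {a : M} (ha : a ∈ V)
    {z : ShuffleAlgebra M ⊗[ℂ] ShuffleAlgebra M}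
    (hz : z ∈ LinearMap.range (TensorProduct.map (wordsIn V).subtype (wordsIn V).subtype)) :
    LinearMap.rTensor _ (cons a) z ∈
      LinearMap.range (TensorProduct.map (wordsIn V).subtype (wordsIn V).subtype) :=
  map_subtype_mem_range (fun _ hx => cons_mem_wordsIn ha hx) (fun _ hx => hx) hz

theorem mul'_mem_wordsIn {z : ShuffleAlgebra M ⊗[ℂ] ShuffleAlgebra M}
    (hz : z ∈ LinearMap.range (TensorProduct.map (wordsIn V).subtype (wordsIn V).subtype)) :
    LinearMap.mul' ℂ _ z ∈ wordsIn V := by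
  obtain ⟨y, rfl⟩ := hz
  induction y using TensorProduct.induction_on with
  | zero => simp
  | add x y hx hy => rw [map_add, map_add]; exact add_mem hx hy
  | tmul x y => exact mul_mem_wordsIn x.2 y.2

theorem comul_mem_wordsIn {x : ShuffleAlgebra M} (hx : x ∈ wordsIn V) :
    Coalgebra.comul (R := ℂ) x ∈
      LinearMap.range (TensorProduct.map (wordsIn V).subtype (wordsIn V).subtype) := by
  induction hx using wordsIn_induction with
  | one => exact ⟨⟨1, one_mem_wordsIn⟩ ⊗ₜ ⟨1, one_mem_wordsIn⟩, deconcatMap_one.symm⟩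
  | add x y _ _ hx hy => rw [map_add]; exact add_mem hx hy
  | smul c x _ hx => rw [map_smul]; exact Submodule.smul_mem _ _ hx
  | cons a ha w hw ih =>
    rw [comul_cons]
    exact add_mem ⟨⟨1, one_mem_wordsIn⟩ ⊗ₜ ⟨_, cons_mem_wordsIn ha hw⟩, rfl⟩
      (rTensor_cons_mem_range ha ih)

theorem range_map_le_rTensor {E F : Type*} [AddCommGroup E] [Module ℂ E]
    [AddCommGroup F] [Module ℂ F] (S : Submodule ℂ E) (T : Submodule ℂ F) :
    LinearMap.range (TensorProduct.map S.subtype T.subtype) ≤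
      LinearMap.range (LinearMap.rTensor F S.subtype) := by
  rw [← LinearMap.rTensor_comp_lTensor]
  exact LinearMap.range_comp_le_range _ _

theorem range_map_le_lTensor {E F : Type*} [AddCommGroup E] [Module ℂ E]
    [AddCommGroup F] [Module ℂ F] (S : Submodule ℂ E) (T : Submodule ℂ F) :
    LinearMap.range (TensorProduct.map S.subtype T.subtype) ≤
      LinearMap.range (LinearMap.lTensor E T.subtype) := by
  rw [← LinearMap.lTensor_comp_rTensor]
  exact LinearMap.range_comp_le_range _ _

theorem invGraph_id_mem_wordsIn {x : ShuffleAlgebra M} (hx : x ∈ wordsIn V) :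
    invGraph LinearMap.id x ∈
      LinearMap.range (TensorProduct.map (wordsIn V).subtype (wordsIn V).subtype) := by
  induction hx using wordsIn_induction with
  | one => rw [invGraph_one]; exact ⟨⟨1, one_mem_wordsIn⟩ ⊗ₜ ⟨1, one_mem_wordsIn⟩, rfl⟩
  | add x y _ _ hx hy => rw [map_add]; exact add_mem hx hy
  | smul c x _ hx => rw [map_smul]; exact Submodule.smul_mem _ _ hx
  | cons a ha w hw ih =>
    rw [invGraph_cons, LinearMap.rTensor_id, LinearMap.id_apply]
    exact sub_mem (rTensor_cons_mem_range ha ih)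
      ⟨⟨1, one_mem_wordsIn⟩ ⊗ₜ ⟨_, mul'_mem_wordsIn (rTensor_cons_mem_range ha ih)⟩, rfl⟩

theorem antipode_mem_wordsIn {x : ShuffleAlgebra M} (hx : x ∈ wordsIn V) :
    HopfAlgebra.antipode ℂ x ∈ wordsIn V :=
  contractLeft_mem (range_map_le_lTensor _ _ (invGraph_id_mem_wordsIn hx)) coeffOne

end wordsIn

/-! ## The bar differential on words of `1`-forms -/

section Bar

variable (J : M →ₗ[ℂ] M) (μ : M →ₗ[ℂ] M →ₗ[ℂ] M) (V : Submodule ℂ M)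

/-- The conditions satisfied by the product `μ` and the sign operator `J` of an anticommutative
graded algebra on its subspace `V` of elements of degree one. -/
structure IsOddSubspace : Prop where
  sign : ∀ a ∈ V, J a = -a
  sign_mul : ∀ a ∈ V, ∀ b ∈ V, J (μ a b) = μ a b
  anticomm : ∀ a ∈ V, ∀ b ∈ V, μ a b + μ b a = 0

/-- The bar differential on the shuffle algebra. -/
def barD : ShuffleAlgebra M →ₗ[ℂ] ShuffleAlgebra M :=
  (toTensor M).symm.toLinearMap ∘ₗ barDifferential J μ ∘ₗ (toTensor M).toLinearMap

/-- Multiplication of `a` into the first letter of a word. -/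
def headMul (a : M) : ShuffleAlgebra M →ₗ[ℂ] ShuffleAlgebra M :=
  wordLift 0 (cons ∘ₗ μ a) 0

/-- Multiplication of `a` into the first letter of a word `u`, and of `v` into the rest of `u`. -/
def headMulWith (a : M) :
    ShuffleAlgebra M →ₗ[ℂ] ShuffleAlgebra M →ₗ[ℂ] ShuffleAlgebra M :=
  wordLift 0 (LinearMap.mk₂ ℂ (fun b w => cons (μ a b) ∘ₗ LinearMap.mulLeft ℂ w)
    (fun b b' w => by ext; simp) (fun c b w => by ext; simp)
    (fun b w w' => by ext; simp [add_mul]) (fun c b w => by ext; simp)) 0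

/-- The automorphism of the tensor algebra that is `-J` on letters. -/
def barSign : ShuffleAlgebra M →ₗ[ℂ] ShuffleAlgebra M :=
  (toTensor M).symm.toLinearMap ∘ₗ
    (TensorAlgebra.lift ℂ (TensorAlgebra.ι ℂ ∘ₗ (-J))).toLinearMap ∘ₗ (toTensor M).toLinearMap

@[simp] theorem headMul_one (a : M) : headMul μ a 1 = 0 := wordLift_one ..

@[simp] theorem headMul_cons (a b : M) (w : ShuffleAlgebra M) :
    headMul μ a (cons b w) = cons (μ a b) w := by
  simp [headMul, wordLift_cons]

@[simp] theorem headMulWith_one (a : M) : headMulWith μ a 1 = 0 := wordLift_one ..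

@[simp] theorem headMulWith_cons (a b : M) (w v : ShuffleAlgebra M) :
    headMulWith μ a (cons b w) v = cons (μ a b) (w * v) := by
  simp [headMulWith, wordLift_cons]

theorem headMulWith_one_right (a : M) (w : ShuffleAlgebra M) :
    headMulWith μ a w 1 = headMul μ a w := by
  induction w using induction with
  | one => simp
  | add x y hx hy => simp [hx, hy]
  | smul c x hx => simp [hx]
  | cons b w hw => simp

@[simp] theorem barSign_one : barSign J 1 = 1 := by
  simp [barSign]

@[simp] theorem barSign_cons (a : M) (w : ShuffleAlgebra M) :
    barSign J (cons a w) = cons (-J a) (barSign J w) := by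
  simp only [barSign, LinearMap.comp_apply, LinearEquiv.coe_coe, toTensor_cons,
    AlgHom.toLinearMap_apply, map_mul, TensorAlgebra.lift_ι_apply, toTensor_symm_ι_mul]
  rfl

@[simp] theorem barD_one : barD J μ 1 = 0 := by
  simp [barD, barDifferential_one]

theorem barD_cons (a : M) (w : ShuffleAlgebra M) :
    barD J μ (cons a w) = headMul μ (J a) w - cons (J a) (barD J μ w) := by
  have h : (toTensor M).symm.toLinearMap ∘ₗ merge μ (J a) ∘ₗ split ∘ₗ (toTensor M).toLinearMap =
      headMul μ (J a) := by
    refine hom_ext ?_ fun b w _ => ?_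
    · simp [split]
    · simp only [LinearMap.comp_apply, LinearEquiv.coe_coe, toTensor_cons, headMul_cons]
      simp [split, merge, toTensor_symm_ι_mul]
  rw [← h]
  simp only [barD, LinearMap.comp_apply, LinearEquiv.coe_coe, toTensor_cons]
  rw [barDifferential, wordRec_ι_mul, map_add, sub_eq_add_neg]
  congr 1

theorem headMul_mul (a : M) (u v : ShuffleAlgebra M) :
    headMul μ a (u * v) = headMulWith μ a u v + headMulWith μ a v u := by
  induction u using induction with
  | one => simp [headMulWith_one_right]
  | add x y hx hy => simp only [add_mul, map_add, LinearMap.add_apply, hx, hy]; abel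
  | smul c x hx => simp [hx]
  | cons b u hu =>
    clear hu
    induction v using induction with
    | one => simp
    | add x y hx hy => simp only [mul_add, map_add, LinearMap.add_apply, hx, hy]; abel
    | smul c x hx => simp [hx]
    | cons c v hv => simp [cons_mul_cons, mul_comm]

theorem headMul_mul_cons (a b : M) (u v : ShuffleAlgebra M) :
    headMul μ a u * cons b v = headMulWith μ a u (cons b v) + cons b (headMul μ a u * v) := by
  induction u using induction with
  | one => simp
  | add x y hx hy => simp only [add_mul, map_add, LinearMap.add_apply, hx, hy]; abel
  | smul c x hx => simp [hx]
  | cons c u hu => simp [cons_mul_cons]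

theorem comul_headMul (a : M) (w : ShuffleAlgebra M) :
    Coalgebra.comul (R := ℂ) (headMul μ a w) =
      1 ⊗ₜ headMul μ a w + LinearMap.rTensor _ (headMul μ a) (Coalgebra.comul (R := ℂ) w) := by
  induction w using induction with
  | one => simp [Algebra.TensorProduct.one_def]
  | add x y hx hy => simp only [map_add, hx, hy, TensorProduct.tmul_add]; abel
  | smul c x hx => simp [hx]
  | cons b w hw =>
    have h : headMul μ a ∘ₗ cons b = cons (μ a b) := by ext; simp
    rw [headMul_cons, comul_cons, comul_cons, map_add, LinearMap.rTensor_tmul, headMul_one,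
      TensorProduct.zero_tmul, zero_add, ← h, LinearMap.rTensor_comp_apply]

namespace IsOddSubspace

variable {J μ V}

theorem barD_cons (hV : IsOddSubspace J μ V) {a : M} (ha : a ∈ V) (w : ShuffleAlgebra M) :
    barD J μ (cons a w) = cons a (barD J μ w) - headMul μ a w := by
  have h : headMul μ (-a) w = - headMul μ a w := by
    induction w using induction with
    | one => simp
    | add x y hx hy => simp only [map_add, hx, hy]; abel
    | smul c x hx => simp [hx]
    | cons b w hw => simp
  rw [ShuffleAlgebra.barD_cons, hV.sign a ha, h]
  simp
  abel

theorem barD_mul (hV : IsOddSubspace J μ V) {x y : ShuffleAlgebra M} (hx : x ∈ wordsIn V)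
    (hy : y ∈ wordsIn V) :
    barD J μ (x * y) = barD J μ x * y + x * barD J μ y := by
  induction hx using wordsIn_induction generalizing y with
  | one => simp
  | add x x' _ _ hx hx' => simp only [add_mul, map_add, hx hy, hx' hy]; abel
  | smul c x _ hx => simp [hx hy]
  | cons a ha u hu ihu =>
    induction hy using wordsIn_induction with
    | one => simp
    | add x x' _ _ hx hx' => simp only [mul_add, map_add, hx, hx']; abel
    | smul c x _ hx => simp [hx]
    | cons b hb v hv ihv =>
      have hab : cons (μ a b) (u * v) + cons (μ b a) (u * v) = 0 := by
        rw [← LinearMap.add_apply, ← map_add, hV.anticomm a ha b hb]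
        simp
      have h₁ := ihu (cons_mem_wordsIn hb hv)
      rw [cons_mul_cons, map_add, hV.barD_cons ha, hV.barD_cons hb, h₁, ihv,
        headMul_mul, headMul_mul, hV.barD_cons ha, hV.barD_cons hb]
      simp only [sub_mul, mul_sub, map_add, map_sub, headMulWith_cons]
      rw [headMul_mul_cons μ a b u v, cons_mul_cons a b (barD J μ u) v,
        cons_mul_cons a b u (barD J μ v), mul_comm (cons a u) (headMul μ b v),
        headMul_mul_cons μ b a v u, mul_comm (headMul μ b v) u, mul_comm v u]
      linear_combination -hab

theorem barSign_of_mem (hV : IsOddSubspace J μ V) {x : ShuffleAlgebra M} (hx : x ∈ wordsIn V) :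
    barSign J x = x := by
  induction hx using wordsIn_induction with
  | one => simp
  | add x x' _ _ hx hx' => simp only [map_add, hx, hx']
  | smul c x _ hx => simp [hx]
  | cons a ha u hu ihu => rw [barSign_cons, ihu, hV.sign a ha, neg_neg]

theorem barSign_headMul (hV : IsOddSubspace J μ V) {a : M} (ha : a ∈ V)
    {x : ShuffleAlgebra M} (hx : x ∈ wordsIn V) :
    barSign J (headMul μ a x) = -headMul μ a x := by
  induction hx using wordsIn_induction with
  | one => simp
  | add x x' _ _ hx hx' => simp only [map_add, hx, hx']; abel
  | smul c x _ hx => simp [hx]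
  | cons b hb u hu ihu =>
    rw [headMul_cons, barSign_cons, hV.sign_mul a ha b hb, hV.barSign_of_mem hu, map_neg,
      LinearMap.neg_apply]

theorem barSign_barD (hV : IsOddSubspace J μ V) {x : ShuffleAlgebra M} (hx : x ∈ wordsIn V) :
    barSign J (barD J μ x) = -barD J μ x := by
  induction hx using wordsIn_induction with
  | one => simp
  | add x x' _ _ hx hx' => simp only [map_add, hx, hx']; abel
  | smul c x _ hx => simp [hx]
  | cons a ha u hu ihu =>
    rw [hV.barD_cons ha, map_sub, barSign_cons, ihu, hV.sign a ha, neg_neg,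
      hV.barSign_headMul ha hu, map_neg]
    abel

theorem comul_barD (hV : IsOddSubspace J μ V) {x : ShuffleAlgebra M} (hx : x ∈ wordsIn V) :
    Coalgebra.comul (R := ℂ) (barD J μ x) =
      LinearMap.rTensor _ (barD J μ) (Coalgebra.comul (R := ℂ) x) +
        LinearMap.lTensor _ (barD J μ) (Coalgebra.comul (R := ℂ) x) := by
  induction hx using wordsIn_induction with
  | one => simp [Algebra.TensorProduct.one_def]
  | add x x' _ _ hx hx' => simp only [map_add, hx, hx']; abel
  | smul c x _ hx => simp [hx]
  | cons a ha u hu ihu =>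
    have h₁ : ∀ z,
        LinearMap.rTensor (ShuffleAlgebra M) (barD J μ) (LinearMap.rTensor _ (cons a) z) =
        LinearMap.rTensor _ (cons a) (LinearMap.rTensor _ (barD J μ) z) -
          LinearMap.rTensor _ (headMul μ a) z := by
      intro z
      rw [← LinearMap.rTensor_comp_apply, ← LinearMap.rTensor_comp_apply, ← LinearMap.sub_apply,
        ← LinearMap.rTensor_sub]
      congr 2
      exact LinearMap.ext fun w => hV.barD_cons ha w
    have h₂ : ∀ z,
        LinearMap.lTensor (ShuffleAlgebra M) (barD J μ) (LinearMap.rTensor _ (cons a) z) =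
        LinearMap.rTensor _ (cons a) (LinearMap.lTensor _ (barD J μ) z) := by
      intro z
      rw [← LinearMap.comp_apply, LinearMap.lTensor_comp_rTensor, ← LinearMap.rTensor_comp_lTensor,
        LinearMap.comp_apply]
    rw [hV.barD_cons ha, map_sub, comul_cons, comul_cons, comul_headMul, ihu, map_add, map_add,
      map_add, h₁, h₂, LinearMap.rTensor_tmul, LinearMap.lTensor_tmul, barD_one,
      TensorProduct.zero_tmul, zero_add, hV.barD_cons ha, TensorProduct.tmul_sub]
    abel

/-- The kernel of the bar differential on words with letters in `V`, as a subalgebra of the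
shuffle algebra. -/
def cocycles (hV : IsOddSubspace J μ V) : Subalgebra ℂ (ShuffleAlgebra M) where
  carrier := {x | x ∈ wordsIn V ∧ barD J μ x = 0}
  mul_mem' {x y} hx hy := ⟨mul_mem_wordsIn hx.1 hy.1, by
    rw [hV.barD_mul hx.1 hy.1, hx.2, hy.2, zero_mul, mul_zero, add_zero]⟩
  add_mem' {x y} hx hy := ⟨add_mem hx.1 hy.1, by rw [map_add, hx.2, hy.2, add_zero]⟩
  algebraMap_mem' r := by
    rw [Algebra.algebraMap_eq_smul_one]
    exact ⟨Submodule.smul_mem _ _ one_mem_wordsIn, by rw [map_smul, barD_one, smul_zero]⟩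

theorem mem_cocycles (hV : IsOddSubspace J μ V) {x : ShuffleAlgebra M} :
    x ∈ hV.cocycles ↔ x ∈ wordsIn V ∧ barD J μ x = 0 := Iff.rfl

theorem comul_mem_cocycles (hV : IsOddSubspace J μ V) {x : ShuffleAlgebra M}
    (hx : x ∈ hV.cocycles) : Coalgebra.comul (R := ℂ) x ∈ LinearMap.range
      (TensorProduct.map (Subalgebra.toSubmodule hV.cocycles).subtype
        (Subalgebra.toSubmodule hV.cocycles).subtype) := by
  have h₁ := comul_mem_wordsIn hx.1
  have h₂ : LinearMap.rTensor _ (barD J μ) (Coalgebra.comul (R := ℂ) x) +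
      LinearMap.lTensor _ (barD J μ) (Coalgebra.comul (R := ℂ) x) = 0 := by
    rw [← hV.comul_barD hx.1, hx.2, map_zero]
  have h₃ : -LinearMap.rTensor _ (barD J μ) (Coalgebra.comul (R := ℂ) x) +
      LinearMap.lTensor _ (barD J μ) (Coalgebra.comul (R := ℂ) x) = 0 := by
    have h := congrArg (LinearMap.rTensor (ShuffleAlgebra M) (barSign J)) h₂
    rw [map_add, map_zero] at h
    obtain ⟨y, hy⟩ := h₁
    have e₁ : LinearMap.rTensor (ShuffleAlgebra M) (barSign J) ∘ₗ
        LinearMap.rTensor (ShuffleAlgebra M) (barD J μ) ∘ₗ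
        TensorProduct.map (wordsIn V).subtype (wordsIn V).subtype =
        -(LinearMap.rTensor (ShuffleAlgebra M) (barD J μ) ∘ₗ
        TensorProduct.map (wordsIn V).subtype (wordsIn V).subtype) := by
      refine TensorProduct.ext' fun a b => ?_
      simp [hV.barSign_barD a.2, TensorProduct.neg_tmul]
    have e₂ : LinearMap.rTensor (ShuffleAlgebra M) (barSign J) ∘ₗ
        LinearMap.lTensor (ShuffleAlgebra M) (barD J μ) ∘ₗ
        TensorProduct.map (wordsIn V).subtype (wordsIn V).subtype =
        LinearMap.lTensor (ShuffleAlgebra M) (barD J μ) ∘ₗ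
        TensorProduct.map (wordsIn V).subtype (wordsIn V).subtype := by
      refine TensorProduct.ext' fun a b => ?_
      simp [hV.barSign_of_mem a.2]
    have e₁' := LinearMap.congr_fun e₁ y
    have e₂' := LinearMap.congr_fun e₂ y
    simp only [LinearMap.comp_apply, LinearMap.neg_apply, hy] at e₁' e₂'
    rwa [e₁', e₂'] at h
  have h₄ : LinearMap.lTensor _ (barD J μ) (Coalgebra.comul (R := ℂ) x) = 0 := by
    have h : (2 : ℂ) • LinearMap.lTensor _ (barD J μ) (Coalgebra.comul (R := ℂ) x) = 0 := by
      rw [two_smul]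
      linear_combination h₂ + h₃
    simpa using h
  have h₅ : LinearMap.rTensor _ (barD J μ) (Coalgebra.comul (R := ℂ) x) = 0 := by
    simpa [h₄] using h₂
  refine mem_range_map (fun ξ => ⟨?_, ?_⟩) (fun ξ => ⟨?_, ?_⟩)
  · exact contractRight_mem (range_map_le_rTensor _ _ h₁) ξ
  · rw [← contractRight_rTensor, h₅, map_zero]
  · exact contractLeft_mem (range_map_le_lTensor _ _ h₁) ξ
  · rw [← contractLeft_lTensor, h₄, map_zero]

theorem barD_antipode (hV : IsOddSubspace J μ V) {x : ShuffleAlgebra M}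
    (hx : x ∈ hV.cocycles) : barD J μ (HopfAlgebra.antipode ℂ x) = 0 := by
  let F : WithConv (ShuffleAlgebra M →ₗ[ℂ] ShuffleAlgebra M) :=
    WithConv.toConv LinearMap.id * WithConv.toConv (barD J μ ∘ₗ HopfAlgebra.antipode ℂ)
  have hF : ∀ y ∈ hV.cocycles, F.ofConv y = 0 := by
    intro y hy
    obtain ⟨z, hz⟩ := hV.comul_mem_cocycles hy
    have h := congrArg (barD J μ) (HopfAlgebra.mul_antipode_lTensor_comul_apply (R := ℂ) y)
    rw [Algebra.algebraMap_eq_smul_one, map_smul, barD_one, smul_zero, ← hz] at h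
    change LinearMap.mul' ℂ _ (TensorProduct.map LinearMap.id
      (barD J μ ∘ₗ HopfAlgebra.antipode ℂ) (Coalgebra.comul (R := ℂ) y)) = 0
    rw [← hz, ← h]
    have e : LinearMap.mul' ℂ _ ∘ₗ TensorProduct.map LinearMap.id
        (barD J μ ∘ₗ HopfAlgebra.antipode ℂ) ∘ₗ
        TensorProduct.map (Subalgebra.toSubmodule hV.cocycles).subtype
          (Subalgebra.toSubmodule hV.cocycles).subtype =
        barD J μ ∘ₗ LinearMap.mul' ℂ _ ∘ₗ (HopfAlgebra.antipode ℂ).lTensor _ ∘ₗ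
        TensorProduct.map (Subalgebra.toSubmodule hV.cocycles).subtype
          (Subalgebra.toSubmodule hV.cocycles).subtype := by
      refine TensorProduct.ext' fun a b => ?_
      have ha := a.2.2
      simp [hV.barD_mul a.2.1 (antipode_mem_wordsIn b.2.1), ha]
    exact LinearMap.congr_fun e z
  have h : WithConv.toConv (barD J μ ∘ₗ HopfAlgebra.antipode ℂ) =
      WithConv.toConv (HopfAlgebra.antipode ℂ) * F := by
    rw [← mul_assoc, LinearMap.antipode_mul_id, one_mul]
  have h' := LinearMap.congr_fun (congrArg WithConv.ofConv h) x
  refine h'.trans ?_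
  change LinearMap.mul' ℂ _ (TensorProduct.map (HopfAlgebra.antipode ℂ) F.ofConv
    (Coalgebra.comul (R := ℂ) x)) = 0
  obtain ⟨z, hz⟩ := hV.comul_mem_cocycles hx
  rw [← hz]
  have e : TensorProduct.map (HopfAlgebra.antipode ℂ) F.ofConv ∘ₗ
      TensorProduct.map (Subalgebra.toSubmodule hV.cocycles).subtype
        (Subalgebra.toSubmodule hV.cocycles).subtype = 0 := by
    refine TensorProduct.ext' fun a b => ?_
    simp [hF b b.2]
  rw [← LinearMap.comp_apply (TensorProduct.map _ _), e, LinearMap.zero_apply, map_zero]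

theorem isHopfSubalgebra_cocycles (hV : IsOddSubspace J μ V) :
    IsHopfSubalgebra hV.cocycles where
  comul_mem _ hx := hV.comul_mem_cocycles hx
  antipode_mem _ hx := ⟨antipode_mem_wordsIn hx.1, hV.barD_antipode hx⟩

end IsOddSubspace

end Bar

end ShuffleAlgebra

open ShuffleAlgebra

/-! ## Nilpotent families of endomorphisms and fixed point equations -/

section Nilpotent

variable {n : ℕ} {E F P Y : Type*} [AddCommGroup E] [Module ℂ E] [AddCommGroup F] [Module ℂ F]
  [AddCommGroup P] [Module ℂ P] [AddCommGroup Y] [Module ℂ Y]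

/-- A family of endomorphisms is nilpotent if all long products vanish. -/
def IsNilpotentFamily (θ : Fin n → Module.End ℂ E) : Prop :=
  ∃ k, ∀ l : List (Fin n), l.length = k → (l.map θ).prod = 0

/-- The operator `∑ₐ θₐ ⊗ qₐ`. -/
def opSum (θ : Fin n → Module.End ℂ E) (q : Fin n → Module.End ℂ Y) : Module.End ℂ (E ⊗[ℂ] Y) :=
  ∑ a, TensorProduct.map (θ a) (q a)

theorem opSum_apply (θ : Fin n → Module.End ℂ E) (q : Fin n → Module.End ℂ Y) (z : E ⊗[ℂ] Y) :
    opSum θ q z = ∑ a, TensorProduct.map (θ a) (q a) z := by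
  simp [opSum, LinearMap.sum_apply]

@[simp] theorem opSum_tmul (θ : Fin n → Module.End ℂ E) (q : Fin n → Module.End ℂ Y) (e : E)
    (y : Y) : opSum θ q (e ⊗ₜ y) = ∑ a, θ a e ⊗ₜ q a y := by
  simp [opSum_apply]

theorem rTensor_opSum_pow (θ : Fin n → Module.End ℂ E) (q : Fin n → Module.End ℂ Y) (k : ℕ)
    (φ : E →ₗ[ℂ] P) (h : ∀ l : List (Fin n), l.length = k → φ ∘ₗ (l.map θ).prod = 0)
    (z : E ⊗[ℂ] Y) : LinearMap.rTensor Y φ ((opSum θ q ^ k) z) = 0 := by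
  induction k generalizing φ with
  | zero =>
    have h' : φ = 0 := h [] rfl
    simp [h']
  | succ k ih =>
    rw [pow_succ', Module.End.mul_apply, opSum_apply, map_sum]
    refine Finset.sum_eq_zero fun a _ => ?_
    have h₁ := ih (φ ∘ₗ θ a) fun l hl => h (a :: l) (by simp [hl])
    rw [← LinearMap.comp_apply, LinearMap.rTensor_comp_map, ← LinearMap.lTensor_comp_rTensor,
      LinearMap.comp_apply, h₁, map_zero]

theorem IsNilpotentFamily.isNilpotent_opSum {θ : Fin n → Module.End ℂ E}
    (h : IsNilpotentFamily θ) (q : Fin n → Module.End ℂ Y) : IsNilpotent (opSum θ q) := by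
  obtain ⟨k, hk⟩ := h
  refine ⟨k, LinearMap.ext fun z => ?_⟩
  have h := rTensor_opSum_pow θ q k LinearMap.id (fun l hl => by
    rw [hk l hl, LinearMap.comp_zero]) z
  rwa [LinearMap.rTensor_id, LinearMap.id_apply] at h

theorem IsNilpotentFamily.eq_of_fixed {θ : Fin n → Module.End ℂ E}
    (h : IsNilpotentFamily θ) {q : Fin n → Module.End ℂ Y} {c x y : E ⊗[ℂ] Y}
    (hx : x = c + opSum θ q x) (hy : y = c + opSum θ q y) : x = y := by
  obtain ⟨k, hk⟩ := h.isNilpotent_opSum q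
  have h₁ : opSum θ q (x - y) = x - y := by
    have hx' : opSum θ q x = x - c := by rw [eq_sub_iff_add_eq', ← hx]
    have hy' : opSum θ q y = y - c := by rw [eq_sub_iff_add_eq', ← hy]
    rw [map_sub, hx', hy', sub_sub_sub_cancel_right]
  have h₂ : ∀ m : ℕ, (opSum θ q ^ m) (x - y) = x - y := by
    intro m
    induction m with
    | zero => rfl
    | succ m ih => rw [pow_succ, Module.End.mul_apply, h₁, ih]
  rw [← sub_eq_zero, ← h₂ k, hk, LinearMap.zero_apply]

end Nilpotent

/-! ## Coactions of words -/

section Coaction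

variable {M : Type u} [AddCommGroup M] [Module ℂ M] {n : ℕ} (p : Fin n → M)
variable {E F : Type*} [AddCommGroup E] [Module ℂ E] [AddCommGroup F] [Module ℂ F]

/-- The operator `∑ₐ θₐ ⊗ pₐ` on `E ⊗ T(M)`, with `pₐ` acting by prepending a letter. -/
abbrev letterOp (θ : Fin n → Module.End ℂ E) : Module.End ℂ (E ⊗[ℂ] ShuffleAlgebra M) :=
  opSum θ fun a => cons (p a)

/-- The coaction `e ↦ ∑ θ_{a₁} ⋯ θ_{aₛ} e ⊗ [p_{a₁}|⋯|p_{aₛ}]`. -/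
def wordCoact (θ : Fin n → Module.End ℂ E) : E →ₗ[ℂ] E ⊗[ℂ] ShuffleAlgebra M :=
  (∑ k ∈ Finset.range (nilpotencyClass (letterOp p θ)), letterOp p θ ^ k) ∘ₗ
    (TensorProduct.mk ℂ E (ShuffleAlgebra M)).flip 1

variable {p} {θ : Fin n → Module.End ℂ E} {θ' : Fin n → Module.End ℂ F}

theorem wordCoact_eq (h : IsNilpotentFamily θ) (e : E) :
    wordCoact p θ e = e ⊗ₜ 1 + letterOp p θ (wordCoact p θ e) := by
  have h₁ := pow_nilpotencyClass (h.isNilpotent_opSum fun a => cons (p a))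
  have h₂ := Finset.sum_range_succ' (fun k => letterOp p θ ^ k) (nilpotencyClass (letterOp p θ))
  rw [Finset.sum_range_succ, h₁, add_zero] at h₂
  simp only [wordCoact, LinearMap.comp_apply]
  conv_lhs => rw [h₂]
  rw [LinearMap.add_apply, pow_zero, add_comm, ← Module.End.mul_apply, Finset.mul_sum]
  simp [pow_succ']

theorem eq_wordCoact (h : IsNilpotentFamily θ) {e : E} {x : E ⊗[ℂ] ShuffleAlgebra M}
    (hx : x = e ⊗ₜ 1 + letterOp p θ x) : x = wordCoact p θ e :=
  h.eq_of_fixed hx (wordCoact_eq h e)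

theorem wordCoact_mem_wordsIn {V : Submodule ℂ M} (hp : ∀ a, p a ∈ V) (e : E) :
    wordCoact p θ e ∈ LinearMap.range (LinearMap.lTensor E (wordsIn V).subtype) := by
  have h₁ : ∀ z ∈ LinearMap.range (LinearMap.lTensor E (wordsIn V).subtype),
      letterOp p θ z ∈ LinearMap.range (LinearMap.lTensor E (wordsIn V).subtype) := by
    rintro _ ⟨y, rfl⟩
    induction y using TensorProduct.induction_on with
    | zero => simp
    | add x y hx hy => rw [map_add, map_add]; exact add_mem hx hy
    | tmul x y =>
      rw [LinearMap.lTensor_tmul, opSum_tmul]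
      exact sum_mem fun a _ => ⟨θ a x ⊗ₜ ⟨_, cons_mem_wordsIn (hp a) y.2⟩, rfl⟩
  have h₂ : ∀ k, (letterOp p θ ^ k) (e ⊗ₜ 1) ∈
      LinearMap.range (LinearMap.lTensor E (wordsIn V).subtype) := by
    intro k
    induction k with
    | zero => exact ⟨e ⊗ₜ ⟨1, one_mem_wordsIn⟩, rfl⟩
    | succ k ih => rw [pow_succ', Module.End.mul_apply]; exact h₁ _ ih
  rw [wordCoact, LinearMap.comp_apply, LinearMap.sum_apply]
  exact sum_mem fun k _ => h₂ k

theorem map_letterOp {T : E →ₗ[ℂ] F} (hT : ∀ a e, T (θ a e) = θ' a (T e))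
    (z : E ⊗[ℂ] ShuffleAlgebra M) :
    LinearMap.rTensor _ T (letterOp p θ z) = letterOp p θ' (LinearMap.rTensor _ T z) := by
  induction z using TensorProduct.induction_on with
  | zero => simp
  | add x y hx hy => simp only [map_add, hx, hy]
  | tmul x y => simp [hT]

theorem wordCoact_map (h : IsNilpotentFamily θ) (h' : IsNilpotentFamily θ') {T : E →ₗ[ℂ] F}
    (hT : ∀ a e, T (θ a e) = θ' a (T e)) (e : E) :
    wordCoact p θ' (T e) = LinearMap.rTensor _ T (wordCoact p θ e) := by
  refine (eq_wordCoact h' ?_).symm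
  conv_lhs => rw [wordCoact_eq h]
  rw [map_add, map_letterOp hT, LinearMap.rTensor_tmul]

theorem wordCoact_counit (h : IsNilpotentFamily θ) (e : E) :
    contractRight coeffOne (wordCoact p θ e) = e := by
  have h₁ : ∀ z, contractRight coeffOne (letterOp p θ z) = 0 := by
    intro z
    induction z using TensorProduct.induction_on with
    | zero => simp
    | add x y hx hy => simp only [map_add, hx, hy, add_zero]
    | tmul x y => simp
  rw [wordCoact_eq h, map_add, h₁]
  simp

theorem wordCoact_coassoc (h : IsNilpotentFamily θ) (e : E) :
    TensorProduct.assoc ℂ E _ _ (LinearMap.rTensor _ (wordCoact p θ) (wordCoact p θ e)) =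
      LinearMap.lTensor E Coalgebra.comul (wordCoact p θ e) := by
  let q : Fin n → Module.End ℂ (ShuffleAlgebra M ⊗[ℂ] ShuffleAlgebra M) :=
    fun a => LinearMap.rTensor _ (cons (p a))
  let ins : E ⊗[ℂ] ShuffleAlgebra M →ₗ[ℂ] E ⊗[ℂ] (ShuffleAlgebra M ⊗[ℂ] ShuffleAlgebra M) :=
    LinearMap.lTensor E (TensorProduct.mk ℂ _ _ 1)
  refine h.eq_of_fixed (q := q) (c := ins (wordCoact p θ e)) ?_ ?_
  · generalize wordCoact p θ e = z
    induction z using TensorProduct.induction_on with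
    | zero => simp
    | add x y hx hy =>
      simp only [map_add]
      conv_lhs => rw [hx, hy]
      abel
    | tmul x y =>
      have h₁ : ∀ z : E ⊗[ℂ] ShuffleAlgebra M,
          TensorProduct.assoc ℂ E _ _ (letterOp p θ z ⊗ₜ[ℂ] y) =
            opSum θ q (TensorProduct.assoc ℂ E _ _ (z ⊗ₜ[ℂ] y)) := by
        intro z
        induction z using TensorProduct.induction_on with
        | zero => simp
        | add x y hx hy => simp only [map_add, TensorProduct.add_tmul, hx, hy]
        | tmul x y => simp [q, TensorProduct.sum_tmul]
      rw [LinearMap.rTensor_tmul]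
      conv_lhs => rw [wordCoact_eq h, TensorProduct.add_tmul, map_add, h₁]
      simp [ins]
  · have h₁ : ∀ z : E ⊗[ℂ] ShuffleAlgebra M,
        LinearMap.lTensor E Coalgebra.comul (letterOp p θ z) =
          ins (letterOp p θ z) + opSum θ q (LinearMap.lTensor E Coalgebra.comul z) := by
      intro z
      induction z using TensorProduct.induction_on with
      | zero => simp
      | add x y hx hy => simp only [map_add, hx, hy]; abel
      | tmul x y =>
        simp only [opSum_tmul, map_sum, LinearMap.lTensor_tmul, comul_cons, ins, q,
          TensorProduct.tmul_add, Finset.sum_add_distrib, TensorProduct.mk_apply]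
    conv_lhs => rw [wordCoact_eq h, map_add, h₁]
    conv_rhs => rw [wordCoact_eq h, map_add, add_assoc, ← wordCoact_eq h]
    simp [ins, Algebra.TensorProduct.one_def]

variable (E F M) in
/-- The product of coefficients `(e ⊗ x) ⊗ (f ⊗ y) ↦ (e ⊗ f) ⊗ x y`. -/
def mulCoeff (H : Type*) [CommRing H] [Algebra ℂ H] :
    (E ⊗[ℂ] H) ⊗[ℂ] (F ⊗[ℂ] H) →ₗ[ℂ] (E ⊗[ℂ] F) ⊗[ℂ] H :=
  LinearMap.lTensor (E ⊗[ℂ] F) (LinearMap.mul' ℂ H) ∘ₗ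
    (TensorProduct.tensorTensorTensorComm ℂ E H F H).toLinearMap

@[simp] theorem mulCoeff_tmul (H : Type*) [CommRing H] [Algebra ℂ H] (e : E) (f : F) (x y : H) :
    mulCoeff E F H ((e ⊗ₜ x) ⊗ₜ (f ⊗ₜ y)) = (e ⊗ₜ f) ⊗ₜ (x * y) := by
  simp [mulCoeff]

/-- The family `θₐ ⊗ 1 + 1 ⊗ θ'ₐ`. -/
def tensorFamily (θ : Fin n → Module.End ℂ E) (θ' : Fin n → Module.End ℂ F) (a : Fin n) :
    Module.End ℂ (E ⊗[ℂ] F) :=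
  LinearMap.rTensor F (θ a) + LinearMap.lTensor E (θ' a)

theorem mulCoeff_wordCoact_eq (h : IsNilpotentFamily θ) (h' : IsNilpotentFamily θ') (e : E)
    (f : F) :
    mulCoeff E F (ShuffleAlgebra M) (wordCoact p θ e ⊗ₜ wordCoact p θ' f) =
      (e ⊗ₜ f) ⊗ₜ 1 + letterOp p (tensorFamily θ θ')
        (mulCoeff E F (ShuffleAlgebra M) (wordCoact p θ e ⊗ₜ wordCoact p θ' f)) := by
  let R := opSum (Y := ShuffleAlgebra M) (fun a => LinearMap.rTensor F (θ a))
    fun a => cons (p a)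
  let L := opSum (Y := ShuffleAlgebra M) (fun a => LinearMap.lTensor E (θ' a))
    fun a => cons (p a)
  have hRL : letterOp p (tensorFamily θ θ') = R + L := by
    simp only [letterOp, opSum, tensorFamily, TensorProduct.map_add_left,
      Finset.sum_add_distrib, R, L]
  have h₁ : ∀ x, mulCoeff E F (ShuffleAlgebra M) (letterOp p θ x ⊗ₜ (f ⊗ₜ 1)) =
      R (mulCoeff E F _ (x ⊗ₜ (f ⊗ₜ 1))) := by
    intro x
    induction x using TensorProduct.induction_on with
    | zero => simp
    | add x y hx hy => simp only [map_add, TensorProduct.add_tmul, hx, hy]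
    | tmul x u => simp [R, TensorProduct.sum_tmul]
  have h₂ : ∀ y, mulCoeff E F (ShuffleAlgebra M) ((e ⊗ₜ 1) ⊗ₜ letterOp p θ' y) =
      L (mulCoeff E F _ ((e ⊗ₜ 1) ⊗ₜ y)) := by
    intro y
    induction y using TensorProduct.induction_on with
    | zero => simp
    | add x y hx hy => simp only [map_add, TensorProduct.tmul_add, hx, hy]
    | tmul y v => simp [L, TensorProduct.tmul_sum]
  have h₃ : ∀ x y, mulCoeff E F (ShuffleAlgebra M) (letterOp p θ x ⊗ₜ letterOp p θ' y) =
      R (mulCoeff E F _ (x ⊗ₜ letterOp p θ' y)) + L (mulCoeff E F _ (letterOp p θ x ⊗ₜ y)) := by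
    intro x y
    induction x using TensorProduct.induction_on with
    | zero => simp
    | add x x' hx hx' => simp only [map_add, TensorProduct.add_tmul, hx, hx']; abel
    | tmul x u =>
      induction y using TensorProduct.induction_on with
      | zero => simp
      | add y y' hy hy' => simp only [map_add, TensorProduct.tmul_add, hy, hy']; abel
      | tmul y v =>
        simp only [R, L, opSum_tmul, TensorProduct.sum_tmul, TensorProduct.tmul_sum, map_sum,
          mulCoeff_tmul, cons_mul_cons, TensorProduct.tmul_add, LinearMap.rTensor_tmul,
          LinearMap.lTensor_tmul, Finset.sum_add_distrib]
        congr 1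
        · exact Finset.sum_comm
  rw [hRL]
  conv_lhs => rw [wordCoact_eq h, wordCoact_eq h']
  conv_rhs => rw [LinearMap.add_apply]
  have e₁ : R (mulCoeff E F _ (wordCoact p θ e ⊗ₜ wordCoact p θ' f)) =
      R (mulCoeff E F _ (wordCoact p θ e ⊗ₜ (f ⊗ₜ 1))) +
        R (mulCoeff E F _ (wordCoact p θ e ⊗ₜ letterOp p θ' (wordCoact p θ' f))) := by
    rw [← map_add, ← map_add, ← TensorProduct.tmul_add, ← wordCoact_eq h']
  have e₂ : L (mulCoeff E F _ (wordCoact p θ e ⊗ₜ wordCoact p θ' f)) =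
      L (mulCoeff E F _ ((e ⊗ₜ 1) ⊗ₜ wordCoact p θ' f)) +
        L (mulCoeff E F _ (letterOp p θ (wordCoact p θ e) ⊗ₜ wordCoact p θ' f)) := by
    rw [← map_add, ← map_add, ← TensorProduct.add_tmul, ← wordCoact_eq h]
  rw [e₁, e₂]
  simp only [TensorProduct.add_tmul, TensorProduct.tmul_add, map_add, h₁, h₂, h₃, mulCoeff_tmul,
    mul_one]
  abel

/-! ## Recognition of word coactions -/

section Recognition

/-- The first letter of words of length one. -/
def letter : ShuffleAlgebra M →ₗ[ℂ] M :=
  wordLift 0 (LinearMap.mk₂ ℂ (fun a w => coeffOne w • a)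
    (fun a b w => smul_add _ _ _) (fun c a w => smul_comm _ _ _)
    (fun a w w' => by rw [map_add, add_smul]) (fun c a w => by rw [map_smul, smul_assoc])) 0

@[simp] theorem letter_one : letter (1 : ShuffleAlgebra M) = 0 := wordLift_one ..

@[simp] theorem letter_cons (a : M) (w : ShuffleAlgebra M) :
    letter (cons a w) = coeffOne w • a := by
  simp [letter, wordLift_cons]

/-- Removal of the first letter, evaluated by a linear form. -/
def strip (ξ : M →ₗ[ℂ] ℂ) : ShuffleAlgebra M →ₗ[ℂ] ShuffleAlgebra M :=
  wordLift 0 ((LinearMap.lsmul ℂ (ShuffleAlgebra M)) ∘ₗ ξ) 0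

@[simp] theorem strip_one (ξ : M →ₗ[ℂ] ℂ) : strip ξ 1 = 0 := wordLift_one ..

@[simp] theorem strip_cons (ξ : M →ₗ[ℂ] ℂ) (a : M) (w : ShuffleAlgebra M) :
    strip ξ (cons a w) = ξ a • w := by
  simp [strip, wordLift_cons]

theorem strip_eq (ξ : M →ₗ[ℂ] ℂ) (w : ShuffleAlgebra M) :
    strip ξ w = contractLeft (ξ ∘ₗ letter) (Coalgebra.comul (R := ℂ) w) := by
  induction w using induction with
  | one => simp [Algebra.TensorProduct.one_def]
  | add x y hx hy => simp [hx, hy]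
  | smul c x hx => simp [hx]
  | cons a w hw =>
    have h : ξ ∘ₗ letter ∘ₗ cons a = ξ a • coeffOne := by ext; simp [mul_comm]
    have h' := Coalgebra.rTensor_counit_comul (R := ℂ) w
    rw [strip_cons, comul_cons, map_add, ← contractLeft_comp, LinearMap.comp_assoc, h,
      contractLeft_tmul, LinearMap.comp_apply, letter_one, map_zero, zero_smul, zero_add,
      contractLeft, LinearMap.rTensor_smul, LinearMap.comp_apply, LinearMap.smul_apply, map_smul]
    change _ = ξ a • TensorProduct.lid ℂ _
      (LinearMap.rTensor _ (Coalgebra.counit (R := ℂ)) (Coalgebra.comul (R := ℂ) w))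
    rw [h']
    simp

/-- The coefficient of a word, for given linear forms on letters. -/
def wordCoeff (ξ : Fin n → M →ₗ[ℂ] ℂ) : List (Fin n) → ShuffleAlgebra M →ₗ[ℂ] ℂ
  | [] => coeffOne
  | a :: l => wordCoeff ξ l ∘ₗ strip (ξ a)

theorem exists_wordCoeff_eq_zero (ξ : Fin n → M →ₗ[ℂ] ℂ) (w : ShuffleAlgebra M) :
    ∃ k, ∀ l : List (Fin n), k ≤ l.length → wordCoeff ξ l w = 0 := by
  induction w using induction with
  | one =>
    refine ⟨1, fun l hl => ?_⟩
    cases l with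
    | nil => simp at hl
    | cons a l => simp [wordCoeff]
  | add x y hx hy =>
    obtain ⟨k, hk⟩ := hx
    obtain ⟨m, hm⟩ := hy
    exact ⟨max k m, fun l hl => by
      rw [map_add, hk l (le_trans (le_max_left _ _) hl), hm l (le_trans (le_max_right _ _) hl),
        add_zero]⟩
  | smul c x hx =>
    obtain ⟨k, hk⟩ := hx
    exact ⟨k, fun l hl => by rw [map_smul, hk l hl, smul_zero]⟩
  | cons a w hw =>
    obtain ⟨k, hk⟩ := hw
    refine ⟨k + 1, fun l hl => ?_⟩
    cases l with
    | nil => simp at hl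
    | cons b l =>
      simp only [List.length_cons, add_le_add_iff_right] at hl
      simp [wordCoeff, hk l hl]

theorem exists_contractRight_wordCoeff_eq_zero (ξ : Fin n → M →ₗ[ℂ] ℂ)
    (z : E ⊗[ℂ] ShuffleAlgebra M) :
    ∃ k, ∀ l : List (Fin n), k ≤ l.length → contractRight (wordCoeff ξ l) z = 0 := by
  induction z using TensorProduct.induction_on with
  | zero => exact ⟨0, fun l _ => map_zero _⟩
  | tmul e w =>
    obtain ⟨k, hk⟩ := exists_wordCoeff_eq_zero ξ w
    exact ⟨k, fun l hl => by rw [contractRight_tmul, hk l hl, zero_smul]⟩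
  | add x y hx hy =>
    obtain ⟨k, hk⟩ := hx
    obtain ⟨m, hm⟩ := hy
    exact ⟨max k m, fun l hl => by
      rw [map_add, hk l (le_trans (le_max_left _ _) hl), hm l (le_trans (le_max_right _ _) hl),
        add_zero]⟩

variable {ξ : Fin n → M →ₗ[ℂ] ℂ}

theorem lTensor_strip_letterOp (hξ : ∀ a b, ξ a (p b) = if a = b then 1 else 0) (a : Fin n)
    (z : E ⊗[ℂ] ShuffleAlgebra M) :
    LinearMap.lTensor E (strip (ξ a)) (letterOp p θ z) = LinearMap.rTensor _ (θ a) z := by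
  induction z using TensorProduct.induction_on with
  | zero => simp
  | add x y hx hy => simp only [map_add, hx, hy]
  | tmul e w => simp [hξ, TensorProduct.tmul_ite]

theorem contractRight_wordCoeff (hξ : ∀ a b, ξ a (p b) = if a = b then 1 else 0)
    {R : E →ₗ[ℂ] E ⊗[ℂ] ShuffleAlgebra M} (hR : ∀ e, R e = e ⊗ₜ 1 + letterOp p θ (R e))
    (l : List (Fin n)) (e : E) : contractRight (wordCoeff ξ l) (R e) = (l.map θ).prod e := by
  induction l with
  | nil =>
    have h : ∀ z : E ⊗[ℂ] ShuffleAlgebra M, contractRight coeffOne (letterOp p θ z) = 0 := by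
      intro z
      induction z using TensorProduct.induction_on with
      | zero => simp
      | add x y hx hy => simp only [map_add, hx, hy, add_zero]
      | tmul x y => simp
    rw [hR, wordCoeff, map_add, h]
    simp
  | cons a l ih =>
    rw [wordCoeff, contractRight_comp, hR, map_add, lTensor_strip_letterOp hξ,
      LinearMap.lTensor_tmul, strip_one, TensorProduct.tmul_zero, zero_add,
      contractRight_rTensor, ih]
    rfl

theorem isNilpotentFamily_of_fixed [FiniteDimensional ℂ E]
    (hξ : ∀ a b, ξ a (p b) = if a = b then 1 else 0)
    {R : E →ₗ[ℂ] E ⊗[ℂ] ShuffleAlgebra M} (hR : ∀ e, R e = e ⊗ₜ 1 + letterOp p θ (R e)) :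
    IsNilpotentFamily θ := by
  let b := Module.finBasis ℂ E
  choose k hk using fun i => exists_contractRight_wordCoeff_eq_zero ξ (R (b i))
  refine ⟨Finset.univ.sup k, fun l hl => b.ext fun i => ?_⟩
  rw [← contractRight_wordCoeff hξ hR, hk i l, LinearMap.zero_apply]
  rw [hl]
  exact Finset.le_sup (Finset.mem_univ i)

theorem sum_cons_strip {V : Submodule ℂ M} (hV : ∀ x ∈ V, x = ∑ a, ξ a x • p a)
    {w : ShuffleAlgebra M} (hw : w ∈ wordsIn V) :
    w = coeffOne w • 1 + ∑ a, cons (p a) (strip (ξ a) w) := by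
  induction hw using wordsIn_induction with
  | one => simp
  | add x y _ _ hx hy =>
    simp only [map_add, Finset.sum_add_distrib, add_smul]
    linear_combination hx + hy
  | smul c x _ hx =>
    simp only [map_smul, ← Finset.smul_sum]
    conv_lhs => rw [hx]
    rw [smul_add, smul_assoc]
  | cons a ha w hw ih =>
    rw [coeffOne_cons, zero_smul, zero_add]
    conv_lhs => rw [hV a ha]
    simp

theorem eq_letterOp_of_coassoc {V : Submodule ℂ M} (hV : ∀ x ∈ V, x = ∑ a, ξ a x • p a)
    {R : E →ₗ[ℂ] E ⊗[ℂ] ShuffleAlgebra M}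
    (hmem : ∀ e, R e ∈ LinearMap.range (LinearMap.lTensor E (wordsIn V).subtype))
    (hassoc : ∀ e, TensorProduct.assoc ℂ E _ _ (LinearMap.rTensor _ R (R e)) =
      LinearMap.lTensor E Coalgebra.comul (R e))
    (hcounit : ∀ e, contractRight coeffOne (R e) = e)
    (hθ : ∀ a e, θ a e = contractRight (ξ a ∘ₗ letter) (R e)) (e : E) :
    R e = e ⊗ₜ 1 + letterOp p θ (R e) := by
  have h₁ : ∀ z ∈ LinearMap.range (LinearMap.lTensor E (wordsIn V).subtype),
      z = contractRight coeffOne z ⊗ₜ 1 +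
        ∑ a, LinearMap.lTensor E (cons (p a)) (LinearMap.lTensor E (strip (ξ a)) z) := by
    rintro _ ⟨y, rfl⟩
    induction y using TensorProduct.induction_on with
    | zero => simp
    | add x y hx hy =>
      simp only [map_add, Finset.sum_add_distrib, TensorProduct.add_tmul] at *
      conv_lhs => rw [hx, hy]
      abel
    | tmul e w =>
      simp only [LinearMap.lTensor_tmul, Submodule.subtype_apply, contractRight_tmul]
      conv_lhs => rw [sum_cons_strip hV w.2]
      simp [TensorProduct.tmul_add, TensorProduct.tmul_sum, TensorProduct.smul_tmul']
  have h₂ : ∀ a, LinearMap.lTensor E (strip (ξ a)) (R e) =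
      LinearMap.rTensor _ (θ a) (R e) := by
    intro a
    have e₁ : strip (ξ a) = contractLeft (ξ a ∘ₗ letter) ∘ₗ Coalgebra.comul :=
      LinearMap.ext (strip_eq (ξ a))
    have e₂ : LinearMap.lTensor E (contractLeft (ξ a ∘ₗ letter)) ∘ₗ
        (TensorProduct.assoc ℂ E (ShuffleAlgebra M) (ShuffleAlgebra M)).toLinearMap =
        LinearMap.rTensor _ (contractRight (ξ a ∘ₗ letter)) := by
      ext e x y
      simp [TensorProduct.smul_tmul]
    have e₃ : contractRight (ξ a ∘ₗ letter) ∘ₗ R = θ a := LinearMap.ext fun e => (hθ a e).symm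
    rw [e₁, LinearMap.lTensor_comp, LinearMap.comp_apply, ← hassoc, ← LinearEquiv.coe_coe,
      ← LinearMap.comp_apply, e₂, ← e₃, LinearMap.rTensor_comp, LinearMap.comp_apply]
  conv_lhs => rw [h₁ _ (hmem e), hcounit]
  congr 1
  rw [opSum_apply]
  refine Finset.sum_congr rfl fun a _ => ?_
  rw [h₂, ← LinearMap.comp_apply, LinearMap.lTensor_comp_rTensor]

end Recognition

/-! ## Flat families -/

section Flat

variable (p) (μ : M →ₗ[ℂ] M →ₗ[ℂ] M)

/-- The integrability condition `∑ₐ,ᵦ pₐ pᵦ ⊗ θₐ θᵦ = 0`. -/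
def IsFlatFamily (θ : Fin n → Module.End ℂ E) : Prop :=
  ∀ f : M →ₗ[ℂ] ℂ, ∑ a, ∑ b, f (μ (p a) (p b)) • (θ a * θ b) = 0

variable {p μ} {J : M →ₗ[ℂ] M}

theorem isFlatFamily_iff : IsFlatFamily p μ θ ↔
    ∀ e, ∑ a, ∑ b, (θ a (θ b e)) ⊗ₜ[ℂ] (μ (p a) (p b)) = 0 := by
  have h : ∀ (f : M →ₗ[ℂ] ℂ) e, contractRight f
      (∑ a, ∑ b, (θ a (θ b e)) ⊗ₜ[ℂ] (μ (p a) (p b))) =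
      (∑ a, ∑ b, f (μ (p a) (p b)) • (θ a * θ b)) e := by
    intro f e
    simp [map_sum, LinearMap.sum_apply]
  refine ⟨fun hf e => eq_zero_of_contractRight fun f => ?_, fun he f => LinearMap.ext fun e => ?_⟩
  · rw [h, hf, LinearMap.zero_apply]
  · rw [← h, he, map_zero, LinearMap.zero_apply]

theorem opSum_headMul_letterOp (z : E ⊗[ℂ] ShuffleAlgebra M) :
    LinearMap.lTensor E letter (opSum θ (fun a => headMul μ (p a)) (letterOp p θ z)) =
      ∑ a, ∑ b, (θ a (θ b (contractRight coeffOne z))) ⊗ₜ[ℂ] (μ (p a) (p b)) := by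
  induction z using TensorProduct.induction_on with
  | zero => simp
  | add x y hx hy => simp only [map_add, hx, hy, TensorProduct.add_tmul, Finset.sum_add_distrib]
  | tmul e w =>
    rw [opSum_tmul, map_sum, map_sum, Finset.sum_comm]
    simp [TensorProduct.smul_tmul]

theorem IsFlatFamily.opSum_headMul (hf : IsFlatFamily p μ θ) (z : E ⊗[ℂ] ShuffleAlgebra M) :
    opSum θ (fun a => headMul μ (p a)) (letterOp p θ z) = 0 := by
  induction z using TensorProduct.induction_on with
  | zero => simp
  | add x y hx hy => simp only [map_add, hx, hy, add_zero]
  | tmul e w =>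
    have h := congrArg (LinearMap.lTensor E (cons.flip w)) (isFlatFamily_iff.1 hf e)
    rw [opSum_tmul, map_sum, ← map_zero (LinearMap.lTensor E (cons.flip w)), ← h, map_sum]
    simp only [map_sum, opSum_tmul]
    rw [Finset.sum_comm]
    simp

variable {V : Submodule ℂ M}

theorem lTensor_barD_letterOp (hV : IsOddSubspace J μ V) (hp : ∀ a, p a ∈ V)
    (z : E ⊗[ℂ] ShuffleAlgebra M) :
    LinearMap.lTensor E (barD J μ) (letterOp p θ z) =
      letterOp p θ (LinearMap.lTensor E (barD J μ) z) - opSum θ (fun a => headMul μ (p a)) z := by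
  induction z using TensorProduct.induction_on with
  | zero => simp
  | add x y hx hy => simp only [map_add, hx, hy]; abel
  | tmul e w =>
    simp [hV.barD_cons (hp _), TensorProduct.tmul_sub]

theorem lTensor_barD_wordCoact (hV : IsOddSubspace J μ V) (hp : ∀ a, p a ∈ V)
    (h : IsNilpotentFamily θ) (hf : IsFlatFamily p μ θ) (e : E) :
    LinearMap.lTensor E (barD J μ) (wordCoact p θ e) = 0 := by
  have h₁ : opSum θ (fun a => headMul μ (p a)) (wordCoact p θ e) = 0 := by
    rw [wordCoact_eq h, map_add, hf.opSum_headMul]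
    simp
  refine h.eq_of_fixed (q := fun a => cons (p a)) (c := 0) ?_ (by simp)
  conv_lhs => rw [wordCoact_eq h, map_add, lTensor_barD_letterOp hV hp, h₁]
  simp

theorem wordCoact_mem_cocycles (hV : IsOddSubspace J μ V) (hp : ∀ a, p a ∈ V)
    (h : IsNilpotentFamily θ) (hf : IsFlatFamily p μ θ) (e : E)
    (ξ : Module.Dual ℂ E) : contractLeft ξ (wordCoact p θ e) ∈ hV.cocycles := by
  refine ⟨contractLeft_mem (wordCoact_mem_wordsIn hp e) ξ, ?_⟩
  rw [← contractLeft_lTensor, lTensor_barD_wordCoact hV hp h hf, map_zero]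

theorem isFlatFamily_of_fixed (hV : IsOddSubspace J μ V) (hp : ∀ a, p a ∈ V)
    {R : E →ₗ[ℂ] E ⊗[ℂ] ShuffleAlgebra M} (hR : ∀ e, R e = e ⊗ₜ 1 + letterOp p θ (R e))
    (hcounit : ∀ e, contractRight coeffOne (R e) = e)
    (hd : ∀ e, LinearMap.lTensor E (barD J μ) (R e) = 0) : IsFlatFamily p μ θ := by
  refine isFlatFamily_iff.2 fun e => ?_
  have h₁ := hd e
  rw [hR, map_add, lTensor_barD_letterOp hV hp, hd, map_zero, LinearMap.lTensor_tmul, barD_one,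
    TensorProduct.tmul_zero, zero_add, zero_sub, neg_eq_zero, hR, map_add] at h₁
  have h₂ : opSum θ (fun a => headMul μ (p a)) (e ⊗ₜ[ℂ] (1 : ShuffleAlgebra M)) = 0 := by simp
  rw [h₂, zero_add] at h₁
  have h₃ := opSum_headMul_letterOp (p := p) (μ := μ) (θ := θ) (R e)
  rw [hcounit, h₁, map_zero] at h₃
  exact h₃.symm

end Flat

end Coaction

open ShuffleAlgebra

namespace EnrichedFan

variable {N N' : Type u} [AddCommGroup N] [AddCommGroup N'] (X : EnrichedFan N N')

/-! ## The bar construction of the tropical de Rham algebra -/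

/-- The global tropical `1`-forms, in the augmentation ideal. -/
def oneForms : Submodule ℂ X.augIdeal := (X.forms 1 X.origin).comap X.augIdeal.subtype

theorem isOddSubspace_oneForms : IsOddSubspace X.augSign X.augMul X.oneForms where
  sign a ha := Subtype.ext (by
    change X.signForms X.origin a.1 = _
    rw [X.signForms_of_mem (p := 1) (a := a.1) ha]
    simp)
  sign_mul a ha b hb := Subtype.ext (by
    change X.signForms X.origin (a.1 * b.1) = a.1 * b.1
    rw [map_mul, X.signForms_of_mem (p := 1) (a := a.1) ha,
      X.signForms_of_mem (p := 1) (a := b.1) hb]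
    simp)
  anticomm a ha b hb := Subtype.ext (X.forms_one_anticomm ha hb)

theorem forms_one_le_augIdeal : X.forms 1 X.origin ≤ X.augIdeal :=
  le_iSup (fun p : ℕ => X.forms (p + 1) X.origin) 0

/-- The cocycles of degree zero in the bar construction, as a subalgebra of the shuffle algebra. -/
abbrev barCocycles : Subalgebra ℂ (ShuffleAlgebra X.augIdeal) := X.isOddSubspace_oneForms.cocycles

/-- The Hopf algebra of cocycles of degree zero in the bar construction. -/
def CocycleAlgebra : Type u := X.barCocycles

instance : CommRing X.CocycleAlgebra := inferInstanceAs (CommRing X.barCocycles)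

instance : HopfAlgebra ℂ X.CocycleAlgebra :=
  X.isOddSubspace_oneForms.isHopfSubalgebra_cocycles.hopfAlgebra

/-- The inclusion of the cocycles in the shuffle algebra. -/
def cocycleVal : X.CocycleAlgebra →ₗ[ℂ] ShuffleAlgebra X.augIdeal := X.barCocycles.val.toLinearMap

theorem cocycleVal_injective : Function.Injective X.cocycleVal :=
  Subalgebra.val_toLinearMap_injective _

theorem cocycleVal_mem (x : X.CocycleAlgebra) : X.cocycleVal x ∈ X.barCocycles := Subtype.property x

theorem cocycleVal_one : X.cocycleVal 1 = 1 := rfl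

theorem cocycleVal_mul (x y : X.CocycleAlgebra) :
    X.cocycleVal (x * y) = X.cocycleVal x * X.cocycleVal y := rfl

theorem map_cocycleVal_comul (x : X.CocycleAlgebra) :
    TensorProduct.map X.cocycleVal X.cocycleVal (Coalgebra.comul (R := ℂ) x) =
      Coalgebra.comul (R := ℂ) (X.cocycleVal x) :=
  X.isOddSubspace_oneForms.isHopfSubalgebra_cocycles.map_comul x

theorem mem_barCocycles_iff (x : ShuffleAlgebra X.augIdeal) :
    x ∈ X.barCocycles ↔ toTensor X.augIdeal x ∈ X.H0 := by
  have h : (TensorAlgebra.ι ℂ '' (X.oneForms : Set X.augIdeal)) =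
      {w | ∃ η : X.augIdeal, η.1 ∈ X.forms 1 X.origin ∧ w = TensorAlgebra.ι ℂ η} := by
    ext w
    exact ⟨fun ⟨η, h, e⟩ => ⟨η, h, e.symm⟩, fun ⟨η, h, e⟩ => ⟨η, h, e.symm⟩⟩
  change (toTensor X.augIdeal x ∈ Subalgebra.toSubmodule (Algebra.adjoin ℂ _) ∧ _) ↔ _
  rw [h]
  rfl

/-- The Hopf algebra of cocycles is `H⁰(B)`. -/
def cocycleEquiv : X.CocycleAlgebra ≃ₗ[ℂ] X.H0 where
  toFun x := ⟨toTensor X.augIdeal (X.cocycleVal x),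
    (X.mem_barCocycles_iff _).1 (X.cocycleVal_mem x)⟩
  invFun x := ⟨(toTensor X.augIdeal).symm x, (X.mem_barCocycles_iff _).2 x.2⟩
  map_add' _ _ := rfl
  map_smul' _ _ := rfl
  left_inv _ := rfl
  right_inv _ := rfl

theorem subtype_comp_cocycleEquiv : X.H0.subtype ∘ₗ X.cocycleEquiv.toLinearMap =
    (toTensor X.augIdeal).toLinearMap ∘ₗ X.cocycleVal := rfl

theorem isHopfModel_cocycleAlgebra : X.IsHopfModel X.CocycleAlgebra X.cocycleEquiv where
  one := rfl
  mul _ _ := rfl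
  comul x := by
    rw [subtype_comp_cocycleEquiv, TensorProduct.map_comp, LinearMap.comp_apply,
      map_cocycleVal_comul]
    change TensorProduct.map (toTensor X.augIdeal).toLinearMap (toTensor X.augIdeal).toLinearMap
      (TensorProduct.map (toTensor X.augIdeal).symm.toLinearMap
        (toTensor X.augIdeal).symm.toLinearMap
        (deconcat (toTensor X.augIdeal (X.cocycleVal x)))) = _
    rw [← LinearMap.comp_apply, ← TensorProduct.map_comp, LinearEquiv.comp_symm,
      TensorProduct.map_id]
    rfl
  counit _ := rfl

/-! ## Frames of the space of `1`-forms -/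

/-- A basis of the space of global `1`-forms, with linear forms that extend the dual basis. -/
structure Frame where
  n : ℕ
  vec : Fin n → X.augIdeal
  coord : Fin n → X.StarForms X.origin →ₗ[ℂ] ℂ
  vec_mem : ∀ a, vec a ∈ X.oneForms
  coord_vec : ∀ a b, coord a (vec b) = if a = b then 1 else 0
  expand : ∀ x ∈ X.forms 1 X.origin, x = ∑ a, coord a x • (vec a : X.StarForms X.origin)

instance [Module.Finite ℤ N] (σ : X.Cone) : FiniteDimensional ℂ (X.forms 1 σ) := by
  have h : FiniteDimensional ℂ (FormSpace N) := by
    have : Module.Finite ℝ (RealSpace N →ₗ[ℝ] ℂ) := inferInstance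
    exact Module.Finite.of_restrictScalars_finite ℝ ℂ _
  rw [forms, pow_one]
  infer_instance

theorem nonempty_frame [Module.Finite ℤ N] : Nonempty X.Frame := by
  obtain ⟨P, hP⟩ := LinearMap.exists_leftInverse_of_injective (X.forms 1 X.origin).subtype
    (Submodule.ker_subtype _)
  let b := Module.finBasis ℂ (X.forms 1 X.origin)
  have hP' : ∀ x : X.forms 1 X.origin, P x = x := LinearMap.congr_fun hP
  refine ⟨⟨_, fun a => ⟨b a, X.forms_one_le_augIdeal (b a).2⟩, fun a => b.coord a ∘ₗ P,
    fun a => (b a).2, fun a c => ?_, fun x hx => ?_⟩⟩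
  · simp [hP', Finsupp.single_apply, eq_comm]
  · have h := congrArg Subtype.val (b.sum_repr ⟨x, hx⟩)
    have hx' : P x = ⟨x, hx⟩ := hP' ⟨x, hx⟩
    simp only [LinearMap.comp_apply, hx', Module.Basis.coord_apply]
    refine h.symm.trans ?_
    rw [Submodule.coe_sum]
    rfl

variable {X}

namespace Frame

variable (B : X.Frame)

/-- The coordinate forms on the augmentation ideal. -/
def augCoord (a : Fin B.n) : X.augIdeal →ₗ[ℂ] ℂ := B.coord a ∘ₗ X.augIdeal.subtype

theorem augCoord_vec (a b : Fin B.n) : B.augCoord a (B.vec b) = if a = b then 1 else 0 :=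
  B.coord_vec a b

theorem augCoord_expand (x : X.augIdeal) (hx : x ∈ X.oneForms) :
    x = ∑ a, B.augCoord a x • B.vec a := by
  refine Subtype.ext ((B.expand x hx).trans ?_)
  simp [augCoord]

end Frame

theorem origin_le (σ : X.Cone) : X.origin ≤ σ := by
  obtain ⟨S, hS⟩ := X.fan.isRationalCone σ.1 σ.2
  change ({0} : Set (RealSpace N')) ⊆ σ.1
  rw [hS, Set.singleton_subset_iff]
  intro m _
  simp

theorem restrictForms_mem {σ τ : X.Cone} (h : σ ≤ τ) {x : X.StarForms σ} (hx : x ∈ X.forms 1 σ) :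
    X.restrictForms h x ∈ X.forms 1 τ := by
  rw [forms, pow_one] at hx ⊢
  obtain ⟨y, rfl⟩ := hx
  refine ⟨X.restrictLinear h y, funext fun ρ => ?_⟩
  change ExteriorAlgebra.ι ℂ (X.restrictLinear ρ.2.1 (X.restrictLinear h y)) =
    ExteriorAlgebra.ι ℂ (X.restrictLinear (h.trans ρ.2.1) y)
  rw [restrictLinear_restrictLinear]

namespace FlatBundle

/-! ## Bundles as families of endomorphisms of the fiber at the origin -/

variable (B : X.Frame)

/-- The coefficients of the connection form at the origin. -/
def conn (E : X.FlatBundle) (a : Fin B.n) : Module.End ℂ (E.fiber X.origin) :=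
  contractLeft (B.coord a) (E.θ X.origin)

theorem contractLeft_act (E : X.FlatBundle) (ξ : X.StarForms X.origin →ₗ[ℂ] ℂ)
    (s : E.fiber X.origin) : contractLeft ξ (E.act X.origin s) =
      contractLeft ξ (E.θ X.origin) s := by
  rw [act, contractLeft_lTensor]
  rfl

theorem θ_origin (E : X.FlatBundle) :
    E.θ X.origin = ∑ a, (B.vec a : X.StarForms X.origin) ⊗ₜ[ℂ] E.conn B a := by
  have h : ∀ z ∈ LinearMap.range (LinearMap.rTensor (Module.End ℂ (E.fiber X.origin))
      (X.forms 1 X.origin).subtype),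
      z = ∑ a, (B.vec a : X.StarForms X.origin) ⊗ₜ[ℂ] contractLeft (B.coord a) z := by
    rintro _ ⟨y, rfl⟩
    induction y using TensorProduct.induction_on with
    | zero => simp
    | add x y hx hy =>
      simp only [map_add, TensorProduct.tmul_add, Finset.sum_add_distrib]
      conv_lhs => rw [hx, hy]
    | tmul x A =>
      rw [LinearMap.rTensor_tmul]
      conv_lhs => rw [Submodule.subtype_apply, B.expand x x.2]
      simp [TensorProduct.sum_tmul, TensorProduct.smul_tmul']
  exact h _ (E.θ_mem X.origin)

theorem isFlatFamily_conn (E : X.FlatBundle) : IsFlatFamily B.vec X.augMul (E.conn B) := by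
  intro f
  obtain ⟨g, rfl⟩ := LinearMap.exists_extend f
  have h := congrArg (contractLeft g) (E.integrable X.origin)
  rw [θ_origin B, Finset.sum_mul_sum] at h
  simp only [Algebra.TensorProduct.tmul_mul_tmul, map_sum, contractLeft_tmul, map_zero] at h
  exact h

theorem Hom.conn_comm {E F : X.FlatBundle} (T : E ⟶ F) (a : Fin B.n) (s : E.fiber X.origin) :
    T.app X.origin (E.conn B a s) = F.conn B a (T.app X.origin s) := by
  have h := congrArg (contractLeft (B.coord a)) (T.horizontal X.origin s)
  rw [contractLeft_lTensor, contractLeft_act, contractLeft_act] at h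
  exact h.symm

theorem act_res (E : X.FlatBundle) {σ τ : X.Cone} (h : σ ≤ τ) (s : E.fiber σ) :
    E.act τ (E.res h s) = TensorProduct.map (X.restrictForms h).toLinearMap
      (E.res h).toLinearMap (E.act σ s) := by
  rw [act, act, ← E.θ_res h]
  generalize E.θ σ = z
  induction z using TensorProduct.induction_on with
  | zero => simp
  | add x y hx hy => simp only [map_add, hx, hy]
  | tmul x A => simp [LinearEquiv.conj_apply]

theorem act_origin (E : X.FlatBundle) (s : E.fiber X.origin) :
    E.act X.origin s = ∑ a, (B.vec a : X.StarForms X.origin) ⊗ₜ[ℂ] E.conn B a s := by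
  rw [act, E.θ_origin B, map_sum]
  rfl

variable {B} in
/-- The morphism of bundles that is given by a linear map of the fibers at the origin that
commutes with the coefficients of the connections. -/
def homOfOrigin {E F : X.FlatBundle} (T : E.fiber X.origin →ₗ[ℂ] F.fiber X.origin)
    (hT : ∀ a s, T (E.conn B a s) = F.conn B a (T s)) : E ⟶ F where
  app σ := (F.res (origin_le σ)).toLinearMap ∘ₗ T ∘ₗ (E.res (origin_le σ)).symm.toLinearMap
  app_res {σ τ} h s := by
    obtain ⟨s, rfl⟩ := (E.res (origin_le σ)).surjective s
    simp [E.res_trans, F.res_trans, (E.res (origin_le τ)).symm_apply_apply]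
  horizontal σ s := by
    obtain ⟨s, rfl⟩ := (E.res (origin_le σ)).surjective s
    have h : F.act X.origin (T s) = LinearMap.lTensor _ T (E.act X.origin s) := by
      simp [act_origin B, hT]
    simp only [LinearMap.comp_apply, LinearEquiv.coe_coe, LinearEquiv.symm_apply_apply]
    rw [act_res, act_res, h, ← LinearMap.comp_apply, ← LinearMap.comp_apply,
      LinearMap.map_comp_lTensor, LinearMap.lTensor_comp_map]
    congr 2
    ext
    simp

theorem res_refl' (E : X.FlatBundle) {σ : X.Cone} (h : σ ≤ σ) (s : E.fiber σ) :
    E.res h s = s := E.res_refl σ s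

variable {B} in
theorem homOfOrigin_app_origin {E F : X.FlatBundle}
    (T : E.fiber X.origin →ₗ[ℂ] F.fiber X.origin)
    (hT : ∀ a s, T (E.conn B a s) = F.conn B a (T s)) :
    (homOfOrigin T hT).app X.origin = T := by
  ext s
  have h : (E.res (origin_le X.origin)).symm s = s := by
    rw [LinearEquiv.symm_apply_eq, res_refl']
  change F.res _ (T ((E.res (origin_le X.origin)).symm s)) = T s
  rw [h, res_refl']

theorem hom_ext_origin {E F : X.FlatBundle} {S T : E ⟶ F}
    (h : S.app X.origin = T.app X.origin) : S = T := by
  refine Hom.ext (funext fun σ => LinearMap.ext fun s => ?_)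
  obtain ⟨s, rfl⟩ := (E.res (origin_le σ)).surjective s
  rw [S.app_res, T.app_res, h]

/-- The bundle with constant fiber and given coefficients of the connection. -/
@[reducible] def ofFamily (W : Type u) [AddCommGroup W] [Module ℂ W] [FiniteDimensional ℂ W]
    (θ : Fin B.n → Module.End ℂ W) (hθ : IsFlatFamily B.vec X.augMul θ) : X.FlatBundle where
  fiber _ := W
  res _ := LinearEquiv.refl ℂ W
  res_refl _ _ := rfl
  res_trans _ _ _ := rfl
  θ σ := ∑ a, X.restrictForms (origin_le σ) (B.vec a) ⊗ₜ θ a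
  θ_mem σ := sum_mem fun a _ =>
    ⟨⟨_, restrictForms_mem (origin_le σ) (B.vec_mem a)⟩ ⊗ₜ θ a, rfl⟩
  θ_res {σ τ} h := by
    rw [map_sum]
    rfl
  integrable σ := by
    have h₀ : ∑ a, ∑ b, ((B.vec a : X.StarForms X.origin) * (B.vec b : X.StarForms X.origin))
        ⊗ₜ[ℂ] (θ a * θ b) = 0 := by
      refine eq_zero_of_contractLeft fun f => ?_
      simp only [map_sum, contractLeft_tmul]
      exact hθ (f ∘ₗ X.augIdeal.subtype)
    have h := congrArg (LinearMap.rTensor (Module.End ℂ W)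
      (X.restrictForms (origin_le σ)).toLinearMap) h₀
    simp only [map_sum, LinearMap.rTensor_tmul, AlgHom.toLinearMap_apply, map_mul, map_zero] at h
    rw [Finset.sum_mul_sum]
    simpa only [Algebra.TensorProduct.tmul_mul_tmul] using h

theorem conn_ofFamily (W : Type u) [AddCommGroup W] [Module ℂ W] [FiniteDimensional ℂ W]
    (θ : Fin B.n → Module.End ℂ W) (hθ : IsFlatFamily B.vec X.augMul θ) :
    (ofFamily B W θ hθ).conn B = θ := by
  funext a
  change contractLeft (B.coord a)
    (∑ b, X.restrictForms (origin_le X.origin) (B.vec b : X.StarForms X.origin) ⊗ₜ θ b) = θ a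
  have h : ∀ b, X.restrictForms (origin_le X.origin) (B.vec b : X.StarForms X.origin) = B.vec b :=
    fun b => rfl
  simp only [h, map_sum, contractLeft_tmul, B.coord_vec]
  simp

theorem conn_trivial (V : Type u) [AddCommGroup V] [Module ℂ V] [FiniteDimensional ℂ V] :
    (trivial X V).conn B = 0 :=
  funext fun a => map_zero (contractLeft (B.coord a))

theorem conn_tensor (E F : X.FlatBundle) :
    (E.tensor F).conn B = tensorFamily (E.conn B) (F.conn B) := by
  funext a
  change contractLeft (B.coord a) (E.tensorForm F X.origin) = _
  rw [tensorForm, map_add, contractLeft_lTensor, contractLeft_lTensor]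
  rfl

/-! ## Unipotent bundles -/

theorem IsUnipotent.isNilpotentFamily {E : X.FlatBundle} (hE : E.IsUnipotent) :
    IsNilpotentFamily (E.conn B) := by
  induction hE with
  | zero E hE =>
    exact ⟨0, fun l _ => LinearMap.ext fun s => (hE X.origin).elim _ _⟩
  | step E' E V f g hf hfg hg hE' ih =>
    obtain ⟨k, hk⟩ := ih
    refine ⟨k + 1, fun l hl => LinearMap.ext fun s => ?_⟩
    obtain ⟨l, a, rfl⟩ : ∃ l' a, l = l' ++ [a] := by
      rcases List.eq_nil_or_concat l with h | ⟨l', a, h⟩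
      · simp [h] at hl
      · exact ⟨l', a, by simpa using h⟩
    have h₁ : g.app X.origin (E.conn B a s) = 0 := by
      rw [Hom.conn_comm, conn_trivial]
      rfl
    obtain ⟨t, ht⟩ := (hfg X.origin _).1 h₁
    have h₂ : ∀ (l : List (Fin B.n)) t, ((l.map (E.conn B)).prod) (f.app X.origin t) =
        f.app X.origin ((l.map (E'.conn B)).prod t) := by
      intro l
      induction l with
      | nil => intro t; rfl
      | cons b l ih => intro t; simp [ih, Hom.conn_comm]
    have hl' : l.length = k := by simpa using hl
    simp only [List.map_append, List.prod_append, List.map_cons, List.map_nil, List.prod_cons,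
      List.prod_nil, mul_one, Module.End.mul_apply, ← ht, h₂, hk l hl']
    simp

theorem isUnipotent_of_prod_eq_zero (k : ℕ) (E : X.FlatBundle)
    (h : ∀ l : List (Fin B.n), l.length = k → (l.map (E.conn B)).prod = 0) : E.IsUnipotent := by
  induction k generalizing E with
  | zero =>
    refine IsUnipotent.zero E fun σ => ?_
    have h₀ : ∀ s : E.fiber X.origin, s = 0 := fun s => LinearMap.congr_fun (h [] rfl) s
    have h₁ : Subsingleton (E.fiber X.origin) := ⟨fun s t => (h₀ s).trans (h₀ t).symm⟩
    exact (E.res (origin_le σ)).symm.injective.subsingleton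
  | succ k ih =>
    let W : Submodule ℂ (E.fiber X.origin) := ⨆ a, LinearMap.range (E.conn B a)
    have hW : ∀ a s, E.conn B a s ∈ W := fun a s =>
      Submodule.mem_iSup_of_mem (p := fun a => LinearMap.range (E.conn B a)) a ⟨s, rfl⟩
    let θ : Fin B.n → Module.End ℂ W := fun a => (E.conn B a).restrict fun s _ => hW a s
    have hθ : IsFlatFamily B.vec X.augMul θ := by
      intro f
      have h₁ := E.isFlatFamily_conn B f
      refine LinearMap.ext fun s => Subtype.ext ?_
      have h₂ := LinearMap.congr_fun h₁ (s : E.fiber X.origin)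
      simpa [LinearMap.sum_apply, θ] using h₂
    have hθ' := conn_ofFamily B W θ hθ
    let E' := ofFamily B W θ hθ
    let f : E' ⟶ E := homOfOrigin (B := B) W.subtype fun a s => by
      rw [hθ']
      rfl
    let g : E ⟶ trivial X (E.fiber X.origin ⧸ W) := homOfOrigin (B := B) W.mkQ fun a s => by
      rw [conn_trivial]
      exact (Submodule.Quotient.mk_eq_zero W).2 (hW a s)
    refine IsUnipotent.step E' E (E.fiber X.origin ⧸ W) f g ?_ ?_ ?_ ?_
    · intro σ
      exact (E.res (origin_le σ)).injective.comp W.injective_subtype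
    · intro σ s
      obtain ⟨s, rfl⟩ := (E.res (origin_le σ)).surjective s
      change W.mkQ ((E.res (origin_le σ)).symm (E.res (origin_le σ) s)) = 0 ↔
        ∃ t : W, E.res (origin_le σ) t = E.res (origin_le σ) s
      rw [LinearEquiv.symm_apply_apply, Submodule.mkQ_apply, Submodule.Quotient.mk_eq_zero]
      exact ⟨fun hs => ⟨⟨s, hs⟩, rfl⟩, fun ⟨t, ht⟩ => (E.res (origin_le σ)).injective ht ▸ t.2⟩
    · intro σ
      exact W.mkQ_surjective.comp (E.res (origin_le σ)).symm.surjective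
    · refine ih E' fun l hl => LinearMap.ext fun s => Subtype.ext ?_
      have h₂ : ∀ (l : List (Fin B.n)) (t : W), (((l.map θ).prod t : W) : E.fiber X.origin) =
          (l.map (E.conn B)).prod (t : E.fiber X.origin) := by
        intro l
        induction l with
        | nil => intro t; rfl
        | cons b l ih => intro t; simp [← ih, θ]
      have h₃ : W ≤ LinearMap.ker ((l.map (E.conn B)).prod) := by
        refine iSup_le fun a => ?_
        rintro _ ⟨s, rfl⟩
        have h₄ := LinearMap.congr_fun (h (l ++ [a]) (by simp [hl])) s
        simpa using h₄
      rw [hθ', h₂]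
      exact h₃ s.2

theorem isUnipotent_iff (E : X.FlatBundle) :
    E.IsUnipotent ↔ IsNilpotentFamily (E.conn B) :=
  ⟨fun h => h.isNilpotentFamily B, fun ⟨k, hk⟩ => isUnipotent_of_prod_eq_zero B k E hk⟩

end FlatBundle

end EnrichedFan

open ShuffleAlgebra

namespace EnrichedFan

variable {N N' : Type u} [AddCommGroup N] [AddCommGroup N'] {X : EnrichedFan N N'}

/-! ## Unipotent bundles and comodules -/

section Injection

variable {W : Type*} [AddCommGroup W] [Module ℂ W]

theorem lTensor_cocycleVal_injective :
    Function.Injective (LinearMap.lTensor W X.cocycleVal) :=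
  lTensor_injective W X.cocycleVal_injective

theorem mem_range_lTensor_cocycleVal {z : W ⊗[ℂ] ShuffleAlgebra X.augIdeal}
    (hz : ∀ ξ : Module.Dual ℂ W, contractLeft ξ z ∈ X.barCocycles) :
    z ∈ LinearMap.range (LinearMap.lTensor W X.cocycleVal) := by
  obtain ⟨y, rfl⟩ := mem_range_lTensor (S := Subalgebra.toSubmodule X.barCocycles) hz
  exact ⟨y, rfl⟩

theorem lTensor_map_cocycleVal_injective :
    Function.Injective (LinearMap.lTensor W (TensorProduct.map X.cocycleVal X.cocycleVal)) :=
  lTensor_injective W (map_injective X.cocycleVal_injective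
    X.cocycleVal_injective)

theorem lTensor_map_assoc_rTensor (ρ : W →ₗ[ℂ] W ⊗[ℂ] X.CocycleAlgebra)
    (z : W ⊗[ℂ] X.CocycleAlgebra) :
    LinearMap.lTensor W (TensorProduct.map X.cocycleVal X.cocycleVal)
        (TensorProduct.assoc ℂ W X.CocycleAlgebra X.CocycleAlgebra (LinearMap.rTensor _ ρ z)) =
      TensorProduct.assoc ℂ W _ _ (LinearMap.rTensor _ (LinearMap.lTensor W X.cocycleVal ∘ₗ ρ)
        (LinearMap.lTensor W X.cocycleVal z)) := by
  induction z using TensorProduct.induction_on with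
  | zero => simp
  | add x y hx hy => simp only [map_add, hx, hy]
  | tmul w h =>
    rw [LinearMap.rTensor_tmul, LinearMap.lTensor_tmul, LinearMap.rTensor_tmul,
      LinearMap.comp_apply]
    induction ρ w using TensorProduct.induction_on with
    | zero => simp
    | add x y hx hy => simp only [map_add, TensorProduct.add_tmul, hx, hy]
    | tmul w h => rfl

theorem lTensor_map_lTensor_comul (z : W ⊗[ℂ] X.CocycleAlgebra) :
    LinearMap.lTensor W (TensorProduct.map X.cocycleVal X.cocycleVal)
        (LinearMap.lTensor W Coalgebra.comul z) =
      LinearMap.lTensor W Coalgebra.comul (LinearMap.lTensor W X.cocycleVal z) := by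
  have h : TensorProduct.map X.cocycleVal X.cocycleVal ∘ₗ Coalgebra.comul =
      Coalgebra.comul ∘ₗ X.cocycleVal := LinearMap.ext fun x => X.map_cocycleVal_comul x
  rw [← LinearMap.lTensor_comp_apply, h, LinearMap.lTensor_comp_apply]

theorem contractRight_counit (z : W ⊗[ℂ] X.CocycleAlgebra) :
    contractRight (Coalgebra.counit (R := ℂ)) z =
      contractRight coeffOne (LinearMap.lTensor W X.cocycleVal z) := by
  rw [← contractRight_comp]
  rfl

end Injection

section Comodules

variable (B : X.Frame)

theorem contractRight_letter_wordCoact {W : Type*} [AddCommGroup W] [Module ℂ W]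
    {θ : Fin B.n → Module.End ℂ W} (h : IsNilpotentFamily θ) (a : Fin B.n) (w : W) :
    contractRight (B.augCoord a ∘ₗ letter) (wordCoact B.vec θ w) = θ a w := by
  have h₁ : ∀ z : W ⊗[ℂ] ShuffleAlgebra X.augIdeal,
      contractRight (B.augCoord a ∘ₗ letter) (letterOp B.vec θ z) =
        θ a (contractRight coeffOne z) := by
    intro z
    induction z using TensorProduct.induction_on with
    | zero => simp
    | add x y hx hy => simp only [map_add, hx, hy]
    | tmul w x => simp [B.augCoord_vec]
  rw [wordCoact_eq h, map_add, h₁, wordCoact_counit h]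
  simp

/-- The coaction on the fiber at the origin of a unipotent bundle. -/
def coact (E : X.UnipotentBundle) :
    E.obj.fiber X.origin →ₗ[ℂ] E.obj.fiber X.origin ⊗[ℂ] X.CocycleAlgebra :=
  liftInjective (LinearMap.lTensor _ X.cocycleVal) lTensor_cocycleVal_injective
    (wordCoact B.vec (E.obj.conn B)) fun e => mem_range_lTensor_cocycleVal <|
      wordCoact_mem_cocycles X.isOddSubspace_oneForms B.vec_mem
        (E.property.isNilpotentFamily B) (E.obj.isFlatFamily_conn B) e

theorem lTensor_coact (E : X.UnipotentBundle) (e : E.obj.fiber X.origin) :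
    LinearMap.lTensor _ X.cocycleVal (coact B E e) = wordCoact B.vec (E.obj.conn B) e :=
  apply_liftInjective ..

theorem lTensor_comp_coact (E : X.UnipotentBundle) :
    LinearMap.lTensor _ X.cocycleVal ∘ₗ coact B E = wordCoact B.vec (E.obj.conn B) :=
  LinearMap.ext (lTensor_coact B E)

theorem coact_coassoc (E : X.UnipotentBundle) (e : E.obj.fiber X.origin) :
    TensorProduct.assoc ℂ _ _ _ (LinearMap.rTensor _ (coact B E) (coact B E e)) =
      LinearMap.lTensor _ Coalgebra.comul (coact B E e) := by
  refine lTensor_map_cocycleVal_injective ?_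
  rw [lTensor_map_assoc_rTensor, lTensor_map_lTensor_comul, lTensor_comp_coact, lTensor_coact,
    wordCoact_coassoc (E.property.isNilpotentFamily B)]

theorem coact_counit (E : X.UnipotentBundle) (e : E.obj.fiber X.origin) :
    contractRight (Coalgebra.counit (R := ℂ)) (coact B E e) = e := by
  rw [contractRight_counit, lTensor_coact, wordCoact_counit (E.property.isNilpotentFamily B)]

theorem coact_map {E F : X.UnipotentBundle} (T : E.obj ⟶ F.obj) (e : E.obj.fiber X.origin) :
    coact B F (T.app X.origin e) = LinearMap.rTensor _ (T.app X.origin) (coact B E e) := by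
  refine lTensor_cocycleVal_injective ?_
  rw [lTensor_coact, wordCoact_map (E.property.isNilpotentFamily B)
    (F.property.isNilpotentFamily B) (FlatBundle.Hom.conn_comm B T), ← lTensor_coact,
    lTensor_rTensor_comm]

theorem conn_eq_contractRight (E : X.UnipotentBundle) (a : Fin B.n) (e : E.obj.fiber X.origin) :
    E.obj.conn B a e = contractRight (B.augCoord a ∘ₗ letter)
      (LinearMap.lTensor _ X.cocycleVal (coact B E e)) := by
  rw [lTensor_coact, contractRight_letter_wordCoact B (E.property.isNilpotentFamily B)]

/-- Colinear maps of the fibers at the origin are morphisms of bundles. -/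
theorem exists_hom_of_colinear {E F : X.UnipotentBundle}
    (T : E.obj.fiber X.origin →ₗ[ℂ] F.obj.fiber X.origin)
    (hT : ∀ e, coact B F (T e) = LinearMap.rTensor _ T (coact B E e)) :
    ∃ S : E.obj ⟶ F.obj, S.app X.origin = T := by
  refine ⟨FlatBundle.homOfOrigin (B := B) T fun a s => ?_, FlatBundle.homOfOrigin_app_origin ..⟩
  rw [conn_eq_contractRight, conn_eq_contractRight, hT, ← contractRight_rTensor,
    lTensor_rTensor_comm]

/-- The functor from unipotent bundles to comodules. -/
def toComodule : X.UnipotentBundle ⥤ FDComodule X.CocycleAlgebra where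
  obj E :=
    { carrier := E.obj.fiber X.origin
      coact := coact B E
      coassoc := coact_coassoc B E
      counit := coact_counit B E }
  map T :=
    { map := T.hom.app X.origin
      coact := coact_map B T.hom }

instance : (toComodule B).Faithful where
  map_injective {E F S T} h := by
    refine ObjectProperty.hom_ext _ (FlatBundle.hom_ext_origin ?_)
    exact congrArg FDComodule.Hom.map h

instance : (toComodule B).Full where
  map_surjective {E F} T := by
    obtain ⟨S, hS⟩ := exists_hom_of_colinear B (E := E) (F := F) T.map T.coact
    exact ⟨ObjectProperty.homMk S, FDComodule.Hom.ext hS⟩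

variable (W : FDComodule X.CocycleAlgebra)

/-- The coefficients of the connection that corresponds to a comodule. -/
def comoduleConn (a : Fin B.n) : Module.End ℂ W.carrier :=
  contractRight (B.augCoord a ∘ₗ letter) ∘ₗ LinearMap.lTensor _ X.cocycleVal ∘ₗ W.coact

theorem lTensor_comodule_counit (w : W.carrier) :
    contractRight coeffOne (LinearMap.lTensor _ X.cocycleVal (W.coact w)) = w := by
  rw [← contractRight_counit]
  exact W.counit w

theorem comodule_fixed (w : W.carrier) :
    (LinearMap.lTensor _ X.cocycleVal ∘ₗ W.coact) w = w ⊗ₜ 1 +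
      letterOp B.vec (comoduleConn B W) ((LinearMap.lTensor _ X.cocycleVal ∘ₗ W.coact) w) := by
  refine eq_letterOp_of_coassoc B.augCoord_expand (fun e => ?_) (fun e => ?_)
    (lTensor_comodule_counit W) (fun a e => rfl) w
  · exact mem_range_lTensor fun ξ => by
      rw [LinearMap.comp_apply, contractLeft_lTensor]
      exact (X.isOddSubspace_oneForms.mem_cocycles.1 (contractLeft ξ (W.coact e)).2).1
  · rw [LinearMap.comp_apply, ← lTensor_map_assoc_rTensor, W.coassoc, lTensor_map_lTensor_comul]

theorem isNilpotentFamily_comoduleConn : IsNilpotentFamily (comoduleConn B W) :=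
  isNilpotentFamily_of_fixed B.augCoord_vec (comodule_fixed B W)

theorem isFlatFamily_comoduleConn : IsFlatFamily B.vec X.augMul (comoduleConn B W) := by
  refine isFlatFamily_of_fixed X.isOddSubspace_oneForms B.vec_mem (comodule_fixed B W)
    (lTensor_comodule_counit W) fun e => ?_
  have h : barD X.augSign X.augMul ∘ₗ X.cocycleVal = 0 := by
    refine LinearMap.ext fun x => ?_
    exact (X.isOddSubspace_oneForms.mem_cocycles.1 x.2).2
  rw [LinearMap.comp_apply, ← LinearMap.lTensor_comp_apply, h, LinearMap.lTensor_zero,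
    LinearMap.zero_apply]

/-- The unipotent bundle that corresponds to a comodule. -/
@[reducible] def comoduleBundle : X.UnipotentBundle :=
  ⟨FlatBundle.ofFamily B W.carrier (comoduleConn B W) (isFlatFamily_comoduleConn B W), by
    rw [FlatBundle.isUnipotent_iff B, FlatBundle.conn_ofFamily]
    exact isNilpotentFamily_comoduleConn B W⟩

theorem coact_comoduleBundle : coact B (comoduleBundle B W) = W.coact := by
  refine LinearMap.ext fun w => lTensor_cocycleVal_injective ?_
  rw [lTensor_coact, FlatBundle.conn_ofFamily B _ _ (isFlatFamily_comoduleConn B W)]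
  exact (eq_wordCoact (isNilpotentFamily_comoduleConn B W) (comodule_fixed B W w)).symm

instance : (toComodule B).EssSurj where
  mem_essImage V := ⟨comoduleBundle B V, ⟨
    { hom :=
        { map := (LinearMap.id : V.carrier →ₗ[ℂ] V.carrier)
          coact := fun w => by
            change V.coact w = LinearMap.rTensor _ LinearMap.id (coact B (comoduleBundle B V) w)
            rw [coact_comoduleBundle, LinearMap.rTensor_id]
            rfl }
      inv :=
        { map := (LinearMap.id : V.carrier →ₗ[ℂ] V.carrier)
          coact := fun w => by
            change coact B (comoduleBundle B V) w = LinearMap.rTensor _ LinearMap.id (V.coact w)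
            rw [coact_comoduleBundle, LinearMap.rTensor_id]
            rfl }
      hom_inv_id := rfl
      inv_hom_id := rfl }⟩⟩

instance : (toComodule B).IsEquivalence where

/-- Unipotent bundles are equivalent to comodules, compatibly with the fiber functors. -/
theorem exists_equivalence_comodules (B : X.Frame) :
    ∃ F : X.UnipotentBundle ≌ FDComodule X.CocycleAlgebra,
      Nonempty (F.functor ⋙ FDComodule.forget X.CocycleAlgebra ≅ X.fiberFunctor) :=
  ⟨(toComodule B).asEquivalence, ⟨Iso.refl _⟩⟩

end Comodules

end EnrichedFan

/-! ## The action of points on comodules -/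

section PointAct

variable {H : Type*} [CommRing H] [HopfAlgebra ℂ H] {A : Type*} [CommRing A] [Algebra ℂ A]
  {V W : Type*} [AddCommGroup V] [Module ℂ V] [AddCommGroup W] [Module ℂ W]

/-- The map `v ⊗ h ↦ φ(h) ⊗ v`. -/
def twist (φ : H →ₗ[ℂ] A) : V ⊗[ℂ] H →ₗ[ℂ] A ⊗[ℂ] V :=
  (TensorProduct.comm ℂ V A).toLinearMap ∘ₗ LinearMap.lTensor V φ

@[simp] theorem twist_tmul (φ : H →ₗ[ℂ] A) (v : V) (h : H) : twist φ (v ⊗ₜ h) = φ h ⊗ₜ v := rfl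

/-- The `A`-linear action of an `A`-point of a coalgebra on a comodule. -/
def pointAct (φ : H →ₗ[ℂ] A) (ρ : V →ₗ[ℂ] V ⊗[ℂ] H) : A ⊗[ℂ] V →ₗ[A] A ⊗[ℂ] V :=
  LinearMap.liftBaseChange A (twist φ ∘ₗ ρ)

@[simp] theorem pointAct_tmul (φ : H →ₗ[ℂ] A) (ρ : V →ₗ[ℂ] V ⊗[ℂ] H) (a : A) (v : V) :
    pointAct φ ρ (a ⊗ₜ v) = a • twist φ (ρ v) := by
  simp [pointAct]

theorem twist_rTensor (φ : H →ₗ[ℂ] A) (T : V →ₗ[ℂ] W) (z : V ⊗[ℂ] H) :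
    twist φ (LinearMap.rTensor H T z) = T.baseChange A (twist φ z) := by
  induction z using TensorProduct.induction_on with
  | zero => simp
  | add x y hx hy => simp only [map_add, hx, hy]
  | tmul v h => simp

theorem pointAct_baseChange (φ : H →ₗ[ℂ] A) {ρ : V →ₗ[ℂ] V ⊗[ℂ] H} {σ : W →ₗ[ℂ] W ⊗[ℂ] H}
    {T : V →ₗ[ℂ] W} (hT : ∀ v, σ (T v) = LinearMap.rTensor H T (ρ v)) (x : A ⊗[ℂ] V) :
    pointAct φ σ (T.baseChange A x) = T.baseChange A (pointAct φ ρ x) := by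
  induction x using TensorProduct.induction_on with
  | zero => simp
  | add x y hx hy => simp only [map_add, hx, hy]
  | tmul a v =>
    rw [LinearMap.baseChange_tmul, pointAct_tmul, pointAct_tmul, hT, twist_rTensor, map_smul]

theorem contractRight_twist (ξ : V →ₗ[ℂ] ℂ) (φ : H →ₗ[ℂ] A) (z : V ⊗[ℂ] H) :
    contractRight ξ (twist φ z) = φ (contractLeft ξ z) := by
  induction z using TensorProduct.induction_on with
  | zero => simp
  | add x y hx hy => simp only [map_add, hx, hy]
  | tmul v h => simp

theorem contractRight_baseChange (ξ : W →ₗ[ℂ] ℂ) (T : V →ₗ[ℂ] W) (x : A ⊗[ℂ] V) :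
    contractRight ξ (T.baseChange A x) = contractRight (ξ ∘ₗ T) x := by
  induction x using TensorProduct.induction_on with
  | zero => simp
  | add x y hx hy => simp only [map_add, hx, hy]
  | tmul a v => simp

theorem pointAct_mul (φ ψ : WithConv (H →ₐ[ℂ] A)) {ρ : V →ₗ[ℂ] V ⊗[ℂ] H}
    (hρ : ∀ v, TensorProduct.assoc ℂ V H H (LinearMap.rTensor H ρ (ρ v)) =
      LinearMap.lTensor V Coalgebra.comul (ρ v)) (x : A ⊗[ℂ] V) :
    pointAct (φ * ψ).ofConv.toLinearMap ρ x =
      pointAct φ.ofConv.toLinearMap ρ (pointAct ψ.ofConv.toLinearMap ρ x) := by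
  let m : H ⊗[ℂ] H →ₗ[ℂ] A :=
    (Algebra.TensorProduct.lift φ.ofConv ψ.ofConv fun _ _ => Commute.all _ _).toLinearMap
  have h₁ : (φ * ψ).ofConv.toLinearMap = m ∘ₗ Coalgebra.comul :=
    LinearMap.ext fun h => AlgHom.convMul_apply φ ψ h
  have h₂ : ∀ z : V ⊗[ℂ] H, twist (m ∘ₗ Coalgebra.comul) z =
      TensorProduct.comm ℂ V A (LinearMap.lTensor V m (LinearMap.lTensor V Coalgebra.comul z)) := by
    intro z
    rw [← LinearMap.lTensor_comp_apply]
    rfl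
  have h₃ : ∀ z : V ⊗[ℂ] H, TensorProduct.comm ℂ V A (LinearMap.lTensor V m
      (TensorProduct.assoc ℂ V H H (LinearMap.rTensor H ρ z))) =
        pointAct φ.ofConv.toLinearMap ρ (twist ψ.ofConv.toLinearMap z) := by
    intro z
    induction z using TensorProduct.induction_on with
    | zero => simp
    | add x y hx hy => simp only [map_add, hx, hy]
    | tmul v h =>
      rw [twist_tmul, pointAct_tmul, LinearMap.rTensor_tmul]
      induction ρ v using TensorProduct.induction_on with
      | zero => simp
      | add x y hx hy => simp only [map_add, TensorProduct.add_tmul, hx, hy, smul_add]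
      | tmul w k => simp [m, TensorProduct.smul_tmul', mul_comm]
  induction x using TensorProduct.induction_on with
  | zero => simp
  | add x y hx hy => simp only [map_add, hx, hy]
  | tmul a v => rw [pointAct_tmul, pointAct_tmul, map_smul, h₁, h₂, ← hρ, h₃]

theorem pointAct_one {ρ : V →ₗ[ℂ] V ⊗[ℂ] H}
    (hρ : ∀ v, contractRight (Coalgebra.counit (R := ℂ)) (ρ v) = v) (x : A ⊗[ℂ] V) :
    pointAct (1 : WithConv (H →ₐ[ℂ] A)).ofConv.toLinearMap ρ x = x := by
  have h : ∀ z : V ⊗[ℂ] H, twist (1 : WithConv (H →ₐ[ℂ] A)).ofConv.toLinearMap z =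
      1 ⊗ₜ contractRight (Coalgebra.counit (R := ℂ)) z := by
    intro z
    induction z using TensorProduct.induction_on with
    | zero => simp
    | add x y hx hy => simp only [map_add, hx, hy, TensorProduct.tmul_add]
    | tmul v h =>
      rw [twist_tmul, contractRight_tmul, TensorProduct.tmul_smul, TensorProduct.smul_tmul',
        ← Algebra.algebraMap_eq_smul_one]
      rfl
  induction x using TensorProduct.induction_on with
  | zero => simp
  | add x y hx hy => simp only [map_add, hx, hy]
  | tmul a v => rw [pointAct_tmul, h, hρ, TensorProduct.smul_tmul', smul_eq_mul, mul_one]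

theorem rTensor_pointAct {A' : Type*} [CommRing A'] [Algebra ℂ A'] (f : A →ₐ[ℂ] A')
    (φ : H →ₗ[ℂ] A) (ρ : V →ₗ[ℂ] V ⊗[ℂ] H) (x : A ⊗[ℂ] V) :
    LinearMap.rTensor V f.toLinearMap (pointAct φ ρ x) =
      pointAct (f.toLinearMap ∘ₗ φ) ρ (LinearMap.rTensor V f.toLinearMap x) := by
  have h : ∀ (a : A) (z : V ⊗[ℂ] H), LinearMap.rTensor V f.toLinearMap (a • twist φ z) =
      f a • twist (f.toLinearMap ∘ₗ φ) z := by
    intro a z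
    induction z using TensorProduct.induction_on with
    | zero => simp
    | add x y hx hy => simp only [map_add, smul_add, hx, hy]
    | tmul v h => simp [TensorProduct.smul_tmul']
  induction x using TensorProduct.induction_on with
  | zero => simp
  | add x y hx hy => simp only [map_add, hx, hy]
  | tmul a v =>
    rw [pointAct_tmul, h, LinearMap.rTensor_tmul, pointAct_tmul]
    rfl

theorem distribBaseChange_twist (φ : H →ₐ[ℂ] A) (a b : A) (y : V ⊗[ℂ] H) (z : W ⊗[ℂ] H) :
    TensorProduct.AlgebraTensorModule.distribBaseChange ℂ A V W
        ((a * b) • twist φ.toLinearMap (mulCoeff V W H (y ⊗ₜ z))) =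
      (a • twist φ.toLinearMap y) ⊗ₜ[A] (b • twist φ.toLinearMap z) := by
  induction y using TensorProduct.induction_on with
  | zero => simp
  | add x y hx hy => simp only [map_add, smul_add, TensorProduct.add_tmul, hx, hy]
  | tmul v h =>
    induction z using TensorProduct.induction_on with
    | zero => simp
    | add x y hx hy => simp only [map_add, smul_add, TensorProduct.tmul_add, hx, hy]
    | tmul w k =>
      simp only [mulCoeff_tmul, twist_tmul, TensorProduct.smul_tmul', AlgHom.toLinearMap_apply,
        map_mul, smul_eq_mul]
      rw [← LinearEquiv.eq_symm_apply,
        TensorProduct.AlgebraTensorModule.distribBaseChange_symm_tmul, mul_mul_mul_comm]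

theorem distribBaseChange_pointAct (φ : H →ₐ[ℂ] A) {ρ : V →ₗ[ℂ] V ⊗[ℂ] H}
    {σ : W →ₗ[ℂ] W ⊗[ℂ] H} {τ : V ⊗[ℂ] W →ₗ[ℂ] (V ⊗[ℂ] W) ⊗[ℂ] H}
    (hτ : ∀ v w, τ (v ⊗ₜ w) = mulCoeff V W H (ρ v ⊗ₜ σ w)) (x : A ⊗[ℂ] (V ⊗[ℂ] W)) :
    TensorProduct.AlgebraTensorModule.distribBaseChange ℂ A V W (pointAct φ.toLinearMap τ x) =
      TensorProduct.map (pointAct φ.toLinearMap ρ) (pointAct φ.toLinearMap σ)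
        (TensorProduct.AlgebraTensorModule.distribBaseChange ℂ A V W x) := by
  induction x using TensorProduct.induction_on with
  | zero => simp
  | add x y hx hy => simp only [map_add, hx, hy]
  | tmul a x =>
    induction x using TensorProduct.induction_on with
    | zero => simp
    | add x y hx hy => simp only [map_add, TensorProduct.tmul_add, hx, hy]
    | tmul v w =>
      have h := distribBaseChange_twist φ a 1 (ρ v) (σ w)
      rw [mul_one, ← hτ, ← pointAct_tmul] at h
      rw [h]
      simp

end PointAct

/-! ## Finite-dimensional subcomodules -/

section Subcomodule

variable {H : Type u} [AddCommGroup H] [Module ℂ H] [Coalgebra ℂ H]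

/-- Subcomodules of the right regular comodule of a coalgebra. -/
def IsSubcomodule (D : Submodule ℂ H) : Prop :=
  ∀ x ∈ D, ∀ ξ : H →ₗ[ℂ] ℂ, contractRight ξ (Coalgebra.comul (R := ℂ) x) ∈ D

theorem IsSubcomodule.sup {D D' : Submodule ℂ H} (hD : IsSubcomodule D) (hD' : IsSubcomodule D') :
    IsSubcomodule (D ⊔ D') := by
  intro x hx ξ
  obtain ⟨y, hy, z, hz, rfl⟩ := Submodule.mem_sup.1 hx
  rw [map_add, map_add]
  exact add_mem (Submodule.mem_sup_left (hD y hy ξ)) (Submodule.mem_sup_right (hD' z hz ξ))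

theorem contractRight_counit_comul (x : H) :
    contractRight (Coalgebra.counit (R := ℂ)) (Coalgebra.comul (R := ℂ) x) = x := by
  rw [contractRight, LinearMap.comp_apply, Coalgebra.lTensor_counit_comul]
  simp

theorem contractLeft_counit_comul (x : H) :
    contractLeft (Coalgebra.counit (R := ℂ)) (Coalgebra.comul (R := ℂ) x) = x := by
  rw [contractLeft, LinearMap.comp_apply, Coalgebra.rTensor_counit_comul]
  simp

/-- The right coefficients of the coproduct of an element. -/
def contractions (x : H) : Submodule ℂ H :=
  LinearMap.range
    (LinearMap.mk₂ ℂ (fun (z : H ⊗[ℂ] H) (ξ : H →ₗ[ℂ] ℂ) => contractRight (E := H) ξ z)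
      (fun z z' ξ => map_add _ z z') (fun c z ξ => map_smul _ c z)
      (fun z ξ ξ' => by
        induction z using TensorProduct.induction_on with
        | zero => simp
        | add x y hx hy => simp only [map_add, hx, hy]; abel
        | tmul x y => simp [add_smul])
      (fun c z ξ => by
        induction z using TensorProduct.induction_on with
        | zero => simp
        | add x y hx hy => simp only [map_add, hx, hy, smul_add]
        | tmul x y => simp [mul_smul]) (Coalgebra.comul (R := ℂ) x))

theorem mem_contractions {x y : H} :
    y ∈ contractions x ↔ ∃ ξ : H →ₗ[ℂ] ℂ, contractRight ξ (Coalgebra.comul (R := ℂ) x) = y :=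
  Iff.rfl

theorem self_mem_contractions (x : H) : x ∈ contractions x :=
  mem_contractions.2 ⟨_, contractRight_counit_comul x⟩

theorem exists_finite_contractRight {V W : Type*} [AddCommGroup V] [Module ℂ V] [AddCommGroup W]
    [Module ℂ W] (z : V ⊗[ℂ] W) :
    ∃ S : Submodule ℂ V, FiniteDimensional ℂ S ∧ ∀ ξ : W →ₗ[ℂ] ℂ, contractRight ξ z ∈ S := by
  induction z using TensorProduct.induction_on with
  | zero => exact ⟨⊥, inferInstance, by simp⟩
  | add x y hx hy =>
    obtain ⟨S, hS, h⟩ := hx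
    obtain ⟨S', hS', h'⟩ := hy
    refine ⟨S ⊔ S', inferInstance, fun ξ => ?_⟩
    rw [map_add]
    exact add_mem (Submodule.mem_sup_left (h ξ)) (Submodule.mem_sup_right (h' ξ))
  | tmul v w =>
    refine ⟨Submodule.span ℂ {v}, inferInstance, fun ξ => ?_⟩
    rw [contractRight_tmul]
    exact Submodule.smul_mem _ _ (Submodule.mem_span_singleton_self v)

instance (x : H) : FiniteDimensional ℂ (contractions x) := by
  obtain ⟨S, hS, h⟩ := exists_finite_contractRight (Coalgebra.comul (R := ℂ) x)
  refine Submodule.finiteDimensional_of_le (S₂ := S) ?_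
  rintro _ ⟨ξ, rfl⟩
  exact h ξ

/-- Coassociativity: contracting twice is contracting with a convolution product. -/
theorem contractRight_comul_contractRight (ξ η : H →ₗ[ℂ] ℂ) {V : Type*} [AddCommGroup V]
    [Module ℂ V] {ρ : V →ₗ[ℂ] V ⊗[ℂ] H}
    (hρ : ∀ v, TensorProduct.assoc ℂ V H H (LinearMap.rTensor H ρ (ρ v)) =
      LinearMap.lTensor V Coalgebra.comul (ρ v)) (v : V) :
    contractRight ξ (ρ (contractRight η (ρ v))) =
      contractRight (ξ ∘ₗ contractRight η ∘ₗ Coalgebra.comul (R := ℂ)) (ρ v) := by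
  rw [← contractRight_rTensor, ← LinearMap.comp_assoc, contractRight_comp, ← hρ]
  generalize LinearMap.rTensor H ρ (ρ v) = z
  have h : contractRight ξ ∘ₗ contractRight η =
      contractRight (ξ ∘ₗ contractRight η) ∘ₗ (TensorProduct.assoc ℂ V H H).toLinearMap := by
    refine TensorProduct.ext_threefold fun x y w => ?_
    simp [mul_smul]
  exact LinearMap.congr_fun h z

theorem isSubcomodule_contractions (x : H) : IsSubcomodule (contractions x) := by
  rintro _ ⟨η, rfl⟩ ξ
  exact ⟨_, (contractRight_comul_contractRight ξ η (V := H) (ρ := Coalgebra.comul)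
    (Coalgebra.coassoc_apply) x).symm⟩

/-- A finite-dimensional subcomodule of the regular comodule. -/
@[reducible] def IsSubcomodule.comodule {D : Submodule ℂ H} [FiniteDimensional ℂ D]
    (hD : IsSubcomodule D) : FDComodule H :=
  let ρ : D →ₗ[ℂ] D ⊗[ℂ] H := liftInjective (LinearMap.rTensor H D.subtype)
    (rTensor_injective H D.injective_subtype) (Coalgebra.comul ∘ₗ D.subtype)
    fun x => mem_range_rTensor fun ξ => hD x x.2 ξ
  have hρ : ∀ x, LinearMap.rTensor H D.subtype (ρ x) = Coalgebra.comul (R := ℂ) (x : H) :=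
    fun x => apply_liftInjective ..
  { carrier := D
    coact := ρ
    coassoc := fun x => by
      refine rTensor_injective (H ⊗[ℂ] H) D.injective_subtype ?_
      have h : ∀ z : D ⊗[ℂ] H, LinearMap.rTensor (H ⊗[ℂ] H) D.subtype
          (TensorProduct.assoc ℂ D H H (LinearMap.rTensor H ρ z)) =
            TensorProduct.assoc ℂ H H H (LinearMap.rTensor H Coalgebra.comul
              (LinearMap.rTensor H D.subtype z)) := by
        intro z
        induction z using TensorProduct.induction_on with
        | zero => simp
        | add x y hx hy => simp only [map_add, hx, hy]
        | tmul x k =>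
          rw [LinearMap.rTensor_tmul, LinearMap.rTensor_tmul, LinearMap.rTensor_tmul,
            Submodule.subtype_apply, ← hρ]
          induction ρ x using TensorProduct.induction_on with
          | zero => simp
          | add x y hx hy => simp only [map_add, TensorProduct.add_tmul, hx, hy]
          | tmul y l => rfl
      rw [h, hρ, Coalgebra.coassoc_apply, ← lTensor_rTensor_comm, hρ]
    counit := fun x => by
      refine D.injective_subtype ?_
      change D.subtype (contractRight Coalgebra.counit (ρ x)) = _
      rw [← contractRight_rTensor, hρ, contractRight_counit_comul]
      rfl }

theorem IsSubcomodule.rTensor_coact {D : Submodule ℂ H} [FiniteDimensional ℂ D]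
    (hD : IsSubcomodule D) (x : D) :
    LinearMap.rTensor H D.subtype (hD.comodule.coact x) = Coalgebra.comul (R := ℂ) (x : H) :=
  apply_liftInjective ..

/-- The range of a colinear map to the regular comodule is a subcomodule. -/
theorem isSubcomodule_range {V : Type*} [AddCommGroup V] [Module ℂ V] {ρ : V →ₗ[ℂ] V ⊗[ℂ] H}
    {j : V →ₗ[ℂ] H} (hj : ∀ v, Coalgebra.comul (R := ℂ) (j v) = LinearMap.rTensor H j (ρ v)) :
    IsSubcomodule (LinearMap.range j) := by
  rintro _ ⟨v, rfl⟩ ξ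
  rw [hj, contractRight_rTensor]
  exact ⟨_, rfl⟩

end Subcomodule

namespace EnrichedFan

variable {N N' : Type u} [AddCommGroup N] [AddCommGroup N'] {X : EnrichedFan N N'}

/-! ## Tensor products of unipotent bundles -/

section Tensor

variable (B : X.Frame)

theorem lTensor_mulCoeff {E F : Type*} [AddCommGroup E] [Module ℂ E] [AddCommGroup F] [Module ℂ F]
    (y : E ⊗[ℂ] X.CocycleAlgebra) (z : F ⊗[ℂ] X.CocycleAlgebra) :
    LinearMap.lTensor _ X.cocycleVal (mulCoeff E F _ (y ⊗ₜ z)) =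
      mulCoeff E F _
        (LinearMap.lTensor _ X.cocycleVal y ⊗ₜ LinearMap.lTensor _ X.cocycleVal z) := by
  induction y using TensorProduct.induction_on with
  | zero => simp
  | add x y hx hy => simp only [map_add, TensorProduct.add_tmul, hx, hy]
  | tmul v h =>
    induction z using TensorProduct.induction_on with
    | zero => simp
    | add x y hx hy => simp only [map_add, TensorProduct.tmul_add, hx, hy]
    | tmul w k => simp [cocycleVal_mul]

theorem isUnipotent_tensor (B : X.Frame) {E F : X.FlatBundle} (hE : E.IsUnipotent)
    (hF : F.IsUnipotent) :
    (E.tensor F).IsUnipotent := by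
  rw [FlatBundle.isUnipotent_iff B, FlatBundle.conn_tensor]
  let R := mulCoeff (E.fiber X.origin) (F.fiber X.origin) (ShuffleAlgebra X.augIdeal) ∘ₗ
    TensorProduct.map (wordCoact B.vec (E.conn B)) (wordCoact B.vec (F.conn B))
  refine isNilpotentFamily_of_fixed B.augCoord_vec (p := B.vec) (R := R) fun z => ?_
  induction z using TensorProduct.induction_on with
  | zero => simp
  | add x y hx hy =>
    rw [map_add, map_add, TensorProduct.add_tmul]
    nth_rewrite 1 [hx, hy]
    abel
  | tmul e f =>
    exact mulCoeff_wordCoact_eq (hE.isNilpotentFamily B) (hF.isNilpotentFamily B) e f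

theorem coact_tensor (E F : X.UnipotentBundle) (h : (E.obj.tensor F.obj).IsUnipotent)
    (e : E.obj.fiber X.origin) (f : F.obj.fiber X.origin) :
    coact B ⟨E.obj.tensor F.obj, h⟩ (e ⊗ₜ f) = mulCoeff _ _ _ (coact B E e ⊗ₜ coact B F f) := by
  refine lTensor_cocycleVal_injective ?_
  rw [lTensor_mulCoeff, lTensor_coact, lTensor_coact, lTensor_coact, FlatBundle.conn_tensor]
  have h' := h.isNilpotentFamily B
  rw [FlatBundle.conn_tensor] at h'
  exact (eq_wordCoact h' (mulCoeff_wordCoact_eq (E.property.isNilpotentFamily B)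
    (F.property.isNilpotentFamily B) e f)).symm

theorem coact_trivial (V : Type u) [AddCommGroup V] [Module ℂ V] [FiniteDimensional ℂ V]
    (h : (FlatBundle.trivial X V).IsUnipotent) (v : V) :
    coact B ⟨FlatBundle.trivial X V, h⟩ v = v ⊗ₜ 1 := by
  refine lTensor_cocycleVal_injective ?_
  rw [lTensor_coact, LinearMap.lTensor_tmul, cocycleVal_one]
  refine (eq_wordCoact (h.isNilpotentFamily B) ?_).symm
  rw [FlatBundle.conn_trivial]
  simp

end Tensor

end EnrichedFan

section ConvInverse

variable {H : Type*} [CommRing H] [HopfAlgebra ℂ H] {A : Type*} [CommRing A] [Algebra ℂ A]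

/-- The inverse of an `A`-point of a Hopf algebra. -/
def convInverse (φ : WithConv (H →ₐ[ℂ] A)) : WithConv (H →ₐ[ℂ] A) :=
  WithConv.toConv (φ.ofConv.comp (HopfAlgebra.antipodeAlgHom ℂ H))

theorem mul_convInverse (φ : WithConv (H →ₐ[ℂ] A)) : φ * convInverse φ = 1 := by
  refine WithConv.ofConv_injective (AlgHom.ext fun h => ?_)
  refine (AlgHom.convMul_apply _ _ h).trans (Eq.trans ?_ (AlgHom.convOne_apply h).symm)
  refine Eq.trans ?_ ((congrArg φ.ofConv (HopfAlgebra.mul_antipode_lTensor_comul_apply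
    (R := ℂ) h)).trans (φ.ofConv.commutes _))
  induction Coalgebra.comul (R := ℂ) h using TensorProduct.induction_on with
  | zero => simp
  | add x y hx hy => simp only [map_add, hx, hy]
  | tmul x y => simp [convInverse]

theorem convInverse_mul (φ : WithConv (H →ₐ[ℂ] A)) : convInverse φ * φ = 1 := by
  refine WithConv.ofConv_injective (AlgHom.ext fun h => ?_)
  refine (AlgHom.convMul_apply _ _ h).trans (Eq.trans ?_ (AlgHom.convOne_apply h).symm)
  refine Eq.trans ?_ ((congrArg φ.ofConv (HopfAlgebra.mul_antipode_rTensor_comul_apply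
    (R := ℂ) h)).trans (φ.ofConv.commutes _))
  induction Coalgebra.comul (R := ℂ) h using TensorProduct.induction_on with
  | zero => simp
  | add x y hx hy => simp only [map_add, hx, hy]
  | tmul x y => simp [convInverse]

end ConvInverse

namespace EnrichedFan

variable {N N' : Type u} [AddCommGroup N] [AddCommGroup N'] {X : EnrichedFan N N'}

/-! ## Tannaka reconstruction -/

section Tannaka

variable (B : X.Frame) {A : Type v} [CommRing A] [Algebra ℂ A]

/-- The automorphism of a fiber that is given by a point of the cocycle algebra. -/
def fiberAct (φ : WithConv (X.CocycleAlgebra →ₐ[ℂ] A)) (E : X.UnipotentBundle) :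
    (A ⊗[ℂ] E.obj.fiber X.origin) ≃ₗ[A] (A ⊗[ℂ] E.obj.fiber X.origin) :=
  LinearEquiv.ofLinearMap (pointAct φ.ofConv.toLinearMap (coact B E))
    (pointAct (convInverse φ).ofConv.toLinearMap (coact B E))
    (LinearMap.ext fun x => by
      rw [LinearMap.comp_apply, ← pointAct_mul _ _ (coact_coassoc B E), mul_convInverse,
        pointAct_one (coact_counit B E)]
      rfl)
    (LinearMap.ext fun x => by
      rw [LinearMap.comp_apply, ← pointAct_mul _ _ (coact_coassoc B E), convInverse_mul,
        pointAct_one (coact_counit B E)]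
      rfl)

theorem fiberAct_apply (φ : WithConv (X.CocycleAlgebra →ₐ[ℂ] A)) (E : X.UnipotentBundle)
    (x : A ⊗[ℂ] E.obj.fiber X.origin) :
    fiberAct B φ E x = pointAct φ.ofConv.toLinearMap (coact B E) x := rfl

theorem fiberAct_mem (φ : WithConv (X.CocycleAlgebra →ₐ[ℂ] A)) :
    fiberAct B φ ∈ X.fundamentalGroup A := by
  refine ⟨fun E F T x => pointAct_baseChange _ (coact_map B T) x, fun E F h x => ?_, ?_⟩
  · exact distribBaseChange_pointAct φ.ofConv (coact_tensor B E F h) x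
  · refine LinearEquiv.ext fun x => ?_
    rw [fiberAct_apply]
    induction x using TensorProduct.induction_on with
    | zero => simp
    | add x y hx hy => rw [map_add, hx, hy, map_add]
    | tmul a v =>
      rw [pointAct_tmul, coact_trivial, twist_tmul, AlgHom.toLinearMap_apply, map_one,
        TensorProduct.smul_tmul', smul_eq_mul, mul_one]
      rfl

/-- The action of the points of the cocycle algebra on the fibers at the origin. -/
def fiberActHom : WithConv (X.CocycleAlgebra →ₐ[ℂ] A) →* X.fundamentalGroup A where
  toFun φ := ⟨fiberAct B φ, fiberAct_mem B φ⟩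
  map_one' := Subtype.ext <| funext fun E => LinearEquiv.ext fun x =>
    pointAct_one (coact_counit B E) x
  map_mul' φ ψ := Subtype.ext <| funext fun E => LinearEquiv.ext fun x =>
    pointAct_mul φ ψ (coact_coassoc B E) x

/-- The matrix coefficient of an automorphism of the fiber functor at an element of a
finite-dimensional subcomodule. -/
def matrixCoeff (g : X.fundamentalGroup A) {D : Submodule ℂ X.CocycleAlgebra}
    [FiniteDimensional ℂ D] (hD : IsSubcomodule D) : D →ₗ[ℂ] A :=
  contractRight (Coalgebra.counit ∘ₗ D.subtype) ∘ₗ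
    (g.1 (comoduleBundle B hD.comodule)).toLinearMap.restrictScalars ℂ ∘ₗ
      TensorProduct.mk ℂ A D 1

/-- Matrix coefficients do not depend on the comodule. -/
theorem matrixCoeff_eq (g : X.fundamentalGroup A) {D : Submodule ℂ X.CocycleAlgebra}
    [FiniteDimensional ℂ D] (hD : IsSubcomodule D) {E : X.UnipotentBundle}
    {j : E.obj.fiber X.origin →ₗ[ℂ] X.CocycleAlgebra}
    (hj : ∀ e, Coalgebra.comul (R := ℂ) (j e) = LinearMap.rTensor _ j (coact B E e))
    (x : D) (e : E.obj.fiber X.origin) (hx : j e = x) :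
    matrixCoeff B g hD x = contractRight (Coalgebra.counit ∘ₗ j) (g.1 E (1 ⊗ₜ e)) := by
  let D' : Submodule ℂ X.CocycleAlgebra := D ⊔ LinearMap.range j
  have hD' : IsSubcomodule D' := hD.sup (isSubcomodule_range hj)
  let F := comoduleBundle B hD'.comodule
  let i : D →ₗ[ℂ] D' := Submodule.inclusion le_sup_left
  let k : E.obj.fiber X.origin →ₗ[ℂ] D' :=
    j.codRestrict D' fun e => Submodule.mem_sup_right ⟨e, rfl⟩
  have hinj := rTensor_injective X.CocycleAlgebra D'.injective_subtype
  obtain ⟨S, hS⟩ := exists_hom_of_colinear B (E := comoduleBundle B hD.comodule) (F := F) i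
    fun y => hinj (by
      rw [coact_comoduleBundle, coact_comoduleBundle, hD'.rTensor_coact,
        ← LinearMap.rTensor_comp_apply]
      exact (hD.rTensor_coact y).symm)
  obtain ⟨T, hT⟩ := exists_hom_of_colinear B (E := E) (F := F) k fun y => hinj (by
      rw [coact_comoduleBundle, hD'.rTensor_coact, ← LinearMap.rTensor_comp_apply]
      exact hj y)
  have h₁ := g.2.1 _ _ S (1 ⊗ₜ x)
  have h₂ := g.2.1 _ _ T (1 ⊗ₜ e)
  rw [hS, LinearMap.baseChange_tmul] at h₁
  rw [hT, LinearMap.baseChange_tmul] at h₂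
  have h₃ : k e = i x := Subtype.ext hx
  rw [h₃, h₁] at h₂
  have h₄ := congrArg (contractRight (Coalgebra.counit ∘ₗ D'.subtype)) h₂
  rw [contractRight_baseChange, contractRight_baseChange] at h₄
  exact h₄

end Tannaka

end EnrichedFan

namespace EnrichedFan

variable {N N' : Type u} [AddCommGroup N] [AddCommGroup N'] {X : EnrichedFan N N'}

section Tannaka

variable (B : X.Frame) {A : Type v} [CommRing A] [Algebra ℂ A]

/-- The value at an element of the cocycle algebra of the point given by an automorphism of the
fiber functor. -/
def pointValue (g : X.fundamentalGroup A) (x : X.CocycleAlgebra) : A :=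
  matrixCoeff B g (isSubcomodule_contractions x) ⟨x, self_mem_contractions x⟩

theorem pointValue_eq (g : X.fundamentalGroup A) {E : X.UnipotentBundle}
    {j : E.obj.fiber X.origin →ₗ[ℂ] X.CocycleAlgebra}
    (hj : ∀ e, Coalgebra.comul (R := ℂ) (j e) = LinearMap.rTensor _ j (coact B E e))
    (e : E.obj.fiber X.origin) :
    pointValue B g (j e) = contractRight (Coalgebra.counit ∘ₗ j) (g.1 E (1 ⊗ₜ e)) :=
  matrixCoeff_eq B g _ hj _ e rfl

theorem comul_subtype {D : Submodule ℂ X.CocycleAlgebra} [FiniteDimensional ℂ D]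
    (hD : IsSubcomodule D) (x : D) :
    Coalgebra.comul (R := ℂ) (D.subtype x) =
      LinearMap.rTensor _ D.subtype (coact B (comoduleBundle B hD.comodule) x) := by
  rw [coact_comoduleBundle]
  exact (hD.rTensor_coact x).symm

theorem pointValue_eq_matrixCoeff (g : X.fundamentalGroup A) {D : Submodule ℂ X.CocycleAlgebra}
    [FiniteDimensional ℂ D] (hD : IsSubcomodule D) (x : D) :
    pointValue B g x = matrixCoeff B g hD x :=
  pointValue_eq B g (E := comoduleBundle B hD.comodule) (j := D.subtype) (comul_subtype B hD) x

theorem pointValue_one (g : X.fundamentalGroup A) : pointValue B g 1 = 1 := by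
  let E : X.UnipotentBundle := ⟨FlatBundle.unit X, FlatBundle.isUnipotent_unit X⟩
  let j : ULift.{u} ℂ →ₗ[ℂ] X.CocycleAlgebra :=
    LinearMap.toSpanSingleton ℂ _ 1 ∘ₗ ULift.moduleEquiv.toLinearMap
  have h := pointValue_eq B g (E := E) (j := j) (fun e => by
    rw [coact_trivial, LinearMap.rTensor_tmul]
    simp [j, Algebra.TensorProduct.one_def]
    rfl) (ULift.up 1)
  have h₁ : j (ULift.up 1) = 1 := by simp [j]
  rw [h₁, g.2.2.2] at h
  rw [h]
  change contractRight (Coalgebra.counit ∘ₗ j) (1 ⊗ₜ[ℂ] ULift.up 1) = _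
  rw [contractRight_tmul, LinearMap.comp_apply, h₁, Bialgebra.counit_one, one_smul]

theorem comul_mul'_map {D D' : Submodule ℂ X.CocycleAlgebra} [FiniteDimensional ℂ D]
    [FiniteDimensional ℂ D'] (hD : IsSubcomodule D) (hD' : IsSubcomodule D')
    (h : ((comoduleBundle B hD.comodule).obj.tensor
      (comoduleBundle B hD'.comodule).obj).IsUnipotent)
    (z : D ⊗[ℂ] D') :
    Coalgebra.comul (R := ℂ)
        ((LinearMap.mul' ℂ X.CocycleAlgebra ∘ₗ TensorProduct.map D.subtype D'.subtype) z) =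
      LinearMap.rTensor _ (LinearMap.mul' ℂ X.CocycleAlgebra ∘ₗ
        TensorProduct.map D.subtype D'.subtype) (coact B ⟨_, h⟩ z) := by
  have key : ∀ (y : D ⊗[ℂ] X.CocycleAlgebra) (z : D' ⊗[ℂ] X.CocycleAlgebra),
      LinearMap.rTensor _ (LinearMap.mul' ℂ X.CocycleAlgebra ∘ₗ
        TensorProduct.map D.subtype D'.subtype) (mulCoeff D D' _ (y ⊗ₜ z)) =
      LinearMap.rTensor _ D.subtype y * LinearMap.rTensor _ D'.subtype z := by
    intro y z
    induction y using TensorProduct.induction_on with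
    | zero => simp
    | add x y hx hy => simp only [map_add, TensorProduct.add_tmul, hx, hy, add_mul]
    | tmul v h =>
      induction z using TensorProduct.induction_on with
      | zero => simp
      | add x y hx hy => simp only [map_add, TensorProduct.tmul_add, hx, hy, mul_add]
      | tmul w k => simp
  induction z using TensorProduct.induction_on with
  | zero => simp
  | add x y hx hy => simp only [map_add, hx, hy]
  | tmul x y =>
    have h₁ := coact_tensor B _ _ h x y
    refine Eq.trans ?_ (congrArg (LinearMap.rTensor _ (LinearMap.mul' ℂ X.CocycleAlgebra ∘ₗ
        TensorProduct.map D.subtype D'.subtype)) h₁).symm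
    refine Eq.trans ?_ (key _ _).symm
    rw [← comul_subtype, ← comul_subtype, ← Bialgebra.comul_mul]
    rfl

theorem contractRight_distribBaseChange {V W : Type*} [AddCommGroup V] [Module ℂ V]
    [AddCommGroup W] [Module ℂ W] (ξ : V →ₗ[ℂ] ℂ) (η : W →ₗ[ℂ] ℂ) (ζ : V ⊗[ℂ] W →ₗ[ℂ] ℂ)
    (hζ : ∀ v w, ζ (v ⊗ₜ w) = ξ v * η w) {z : A ⊗[ℂ] (V ⊗[ℂ] W)} {x : A ⊗[ℂ] V} {y : A ⊗[ℂ] W}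
    (h : TensorProduct.AlgebraTensorModule.distribBaseChange ℂ A V W z = x ⊗ₜ y) :
    contractRight ζ z = contractRight ξ x * contractRight η y := by
  rw [← LinearEquiv.eq_symm_apply] at h
  subst h
  induction x using TensorProduct.induction_on with
  | zero => simp
  | add x x' hx hx' => simp only [TensorProduct.add_tmul, map_add, hx, hx', add_mul]
  | tmul a v =>
    induction y using TensorProduct.induction_on with
    | zero => simp
    | add y y' hy hy' => simp only [TensorProduct.tmul_add, map_add, hy, hy', mul_add]
    | tmul b w =>
      rw [TensorProduct.AlgebraTensorModule.distribBaseChange_symm_tmul, contractRight_tmul,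
        contractRight_tmul, contractRight_tmul, hζ, smul_mul_smul_comm]

theorem pointValue_mul (g : X.fundamentalGroup A) (x y : X.CocycleAlgebra) :
    pointValue B g (x * y) = pointValue B g x * pointValue B g y := by
  have hD := isSubcomodule_contractions x
  have hD' := isSubcomodule_contractions y
  let E := comoduleBundle B hD.comodule
  let F := comoduleBundle B hD'.comodule
  let x' : contractions x := ⟨x, self_mem_contractions x⟩
  let y' : contractions y := ⟨y, self_mem_contractions y⟩
  have h := isUnipotent_tensor B E.property F.property
  have h₁ := pointValue_eq B g (E := ⟨E.obj.tensor F.obj, h⟩) (comul_mul'_map B hD hD' h) (x' ⊗ₜ y')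
  have h₂ := g.2.2.1 E F h (1 ⊗ₜ (x' ⊗ₜ y'))
  refine h₁.trans ?_
  refine contractRight_distribBaseChange _ _ _ (fun v w => ?_) h₂
  exact Bialgebra.counit_mul (R := ℂ) (v : X.CocycleAlgebra) (w : X.CocycleAlgebra)

theorem pointValue_add (g : X.fundamentalGroup A) (x y : X.CocycleAlgebra) :
    pointValue B g (x + y) = pointValue B g x + pointValue B g y := by
  have hD := (isSubcomodule_contractions x).sup (isSubcomodule_contractions y)
  let x' : ↥(contractions x ⊔ contractions y) :=
    ⟨x, Submodule.mem_sup_left (self_mem_contractions x)⟩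
  let y' : ↥(contractions x ⊔ contractions y) :=
    ⟨y, Submodule.mem_sup_right (self_mem_contractions y)⟩
  have h := pointValue_eq_matrixCoeff B g hD
  have h₁ := h (x' + y')
  rw [map_add, ← h, ← h] at h₁
  exact h₁

theorem pointValue_smul (g : X.fundamentalGroup A) (c : ℂ) (x : X.CocycleAlgebra) :
    pointValue B g (c • x) = c • pointValue B g x := by
  let x' : contractions x := ⟨x, self_mem_contractions x⟩
  have h := pointValue_eq_matrixCoeff B g (isSubcomodule_contractions x)
  have h₁ := h (c • x')
  rw [map_smul, ← h] at h₁
  exact h₁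

/-- The point of the cocycle algebra that is given by an automorphism of the fiber functor. -/
def pointOf (g : X.fundamentalGroup A) : X.CocycleAlgebra →ₐ[ℂ] A :=
  AlgHom.ofLinearMap
    { toFun := pointValue B g
      map_add' := pointValue_add B g
      map_smul' := pointValue_smul B g } (pointValue_one B g) (pointValue_mul B g)

/-- Matrix coefficients of a bundle are colinear. -/
theorem comul_contractLeft_coact (E : X.UnipotentBundle) (ξ : E.obj.fiber X.origin →ₗ[ℂ] ℂ)
    (e : E.obj.fiber X.origin) :
    Coalgebra.comul (R := ℂ) ((contractLeft ξ ∘ₗ coact B E) e) =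
      LinearMap.rTensor _ (contractLeft ξ ∘ₗ coact B E) (coact B E e) := by
  rw [LinearMap.comp_apply, ← contractLeft_lTensor, ← coact_coassoc]
  generalize coact B E e = z
  induction z using TensorProduct.induction_on with
  | zero => simp
  | add x y hx hy => simp only [map_add, hx, hy]
  | tmul v h =>
    rw [LinearMap.rTensor_tmul, LinearMap.rTensor_tmul, LinearMap.comp_apply]
    induction coact B E v using TensorProduct.induction_on with
    | zero => simp
    | add x y hx hy => simp only [map_add, TensorProduct.add_tmul, hx, hy]
    | tmul w k => simp [TensorProduct.smul_tmul']

theorem apply_contractLeft {V W : Type*} [AddCommGroup V] [Module ℂ V] [AddCommGroup W]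
    [Module ℂ W] (ξ : V →ₗ[ℂ] ℂ) (η : W →ₗ[ℂ] ℂ) (z : V ⊗[ℂ] W) :
    η (contractLeft ξ z) = ξ (contractRight η z) := by
  induction z using TensorProduct.induction_on with
  | zero => simp
  | add x y hx hy => simp only [map_add, hx, hy]
  | tmul v w => simp [mul_comm]

theorem fiberAct_pointOf (g : X.fundamentalGroup A) :
    fiberActHom B (WithConv.toConv (pointOf B g)) = g := by
  refine Subtype.ext <| funext fun E => LinearEquiv.toLinearMap_injective ?_
  refine TensorProduct.AlgebraTensorModule.curry_injective ?_
  ext e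
  refine sub_eq_zero.1 (eq_zero_of_contractRight fun ξ => ?_)
  rw [map_sub, sub_eq_zero]
  change contractRight ξ (pointAct (pointOf B g).toLinearMap (coact B E) (1 ⊗ₜ e)) =
    contractRight ξ (g.1 E (1 ⊗ₜ e))
  rw [pointAct_tmul, one_smul, contractRight_twist]
  refine (pointValue_eq B g (comul_contractLeft_coact B E ξ) e).trans ?_
  congr 1
  congr 1
  refine LinearMap.ext fun e => ?_
  rw [LinearMap.comp_apply, LinearMap.comp_apply, apply_contractLeft, coact_counit]

theorem pointOf_fiberAct (φ : WithConv (X.CocycleAlgebra →ₐ[ℂ] A)) :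
    WithConv.toConv (pointOf B (fiberActHom B φ)) = φ := by
  refine WithConv.ofConv_injective (AlgHom.ext fun x => ?_)
  have hD := isSubcomodule_contractions x
  let x' : contractions x := ⟨x, self_mem_contractions x⟩
  change contractRight (Coalgebra.counit ∘ₗ (contractions x).subtype)
    (pointAct φ.ofConv.toLinearMap (coact B (comoduleBundle B hD.comodule)) (1 ⊗ₜ x')) = _
  rw [pointAct_tmul, one_smul, contractRight_twist, contractLeft_comp, ← comul_subtype]
  exact congrArg φ.ofConv (contractLeft_counit_comul x)

/-- The points of the fundamental group are the points of the cocycle algebra. -/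
def fundamentalGroupEquiv (B : X.Frame) (A : Type v) [CommRing A] [Algebra ℂ A] :
    X.fundamentalGroup A ≃* WithConv (X.CocycleAlgebra →ₐ[ℂ] A) :=
  MulEquiv.symm
    { fiberActHom B with
      invFun := fun g => WithConv.toConv (pointOf B g)
      left_inv := pointOf_fiberAct B
      right_inv := fiberAct_pointOf B }

theorem isBaseChange_fundamentalGroupEquiv {A' : Type v} [CommRing A'] [Algebra ℂ A']
    (f : A →ₐ[ℂ] A') (g : X.fundamentalGroup A) :
    X.IsBaseChange f g ((fundamentalGroupEquiv B A').symm
      (WithConv.toConv (f.comp (fundamentalGroupEquiv B A g).ofConv))) := by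
  intro E x
  obtain ⟨φ, rfl⟩ := (fundamentalGroupEquiv B A).symm.surjective g
  rw [MulEquiv.apply_symm_apply]
  exact rTensor_pointAct f φ.ofConv.toLinearMap (coact B E) x

end Tannaka

end EnrichedFan

end TropFan

end

theorem mainTheorem3 {N N' : Type u}
    [AddCommGroup N] [Module.Free ℤ N] [Module.Finite ℤ N]
    [AddCommGroup N'] [Module.Free ℤ N'] [Module.Finite ℤ N']
    (X : TropFan.EnrichedFan N N') :
    ∃ (H : Type u) (_ : CommRing H) (_ : HopfAlgebra ℂ H) (e : H ≃ₗ[ℂ] X.H0),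
      X.IsHopfModel H e ∧
      (∃ Φ : ∀ (A : Type v) [CommRing A] [Algebra ℂ A],
          X.fundamentalGroup A ≃* WithConv (H →ₐ[ℂ] A),
        ∀ (A A' : Type v) [CommRing A] [Algebra ℂ A] [CommRing A'] [Algebra ℂ A']
          (f : A →ₐ[ℂ] A') (g : X.fundamentalGroup A),
          X.IsBaseChange f g ((Φ A').symm (WithConv.toConv (f.comp (Φ A g).ofConv)))) ∧
      (∃ F : X.UnipotentBundle ≌ TropFan.FDComodule H,
        Nonempty (F.functor ⋙ TropFan.FDComodule.forget H ≅ X.fiberFunctor)) := by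
  obtain ⟨B⟩ := X.nonempty_frame
  exact ⟨X.CocycleAlgebra, inferInstance, inferInstance, X.cocycleEquiv,
    X.isHopfModel_cocycleAlgebra,
    ⟨fun A _ _ => TropFan.EnrichedFan.fundamentalGroupEquiv B A, fun A A' _ _ _ _ f g =>
      TropFan.EnrichedFan.isBaseChange_fundamentalGroupEquiv B f g⟩,
    TropFan.EnrichedFan.exists_equivalence_comodules B⟩
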